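/- Let $\Sigma$ be an alphabet. An input of Pattern Matching with Edits consists of a pattern $P$ of length $m\ge 2$, a text $T$ of length $n\ge m$ (both strings over $\Sigma$), and an integer threshold $k\ge 1$. For $0\le i\le j\le n$ write $T[i..j)=T[i]\cdots T[j-1]$. An alignment of $P$ onto $T[i..j)$ is a sequence $\mathcal A=(x_t,y_t)_{t=0}^{s}$ of pairs of integers with $(x_0,y_0)=(0,i)$, $(x_s,y_s)=(m,j)$ and $(x_{t+1},y_{t+1})\in\{(x_t+1,y_t+1),(x_t+1,y_t),(x_t,y_t+1)\}$ for $0\le t<s$. A step deletes $P[x_t]$ if it is $(x_t+1,y_t)$, inserts $T[y_t]$ if it is $(x_t,y_t+1)$, and substitutes if it is $(x_t+1,y_t+1)$ and $P[x_t]\ne T[y_t]$; the cost of $\mathcal A$ is the number of deletions, insertions and substitutions. The edit distance $\delta_E(P,T[i..j))$ is the minimum cost of an alignment of $P$ onto $T[i..j)$, and an alignment attaining it is optimal. The edit information of $\mathcal A$ is the set of all 4-tuples $(x_t,c_t,y_t,d_t)$, $0\le t<s$, with $c_t\ne d_t$, where $c_t=P[x_t]$ if $x_{t+1}=x_t+1$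 and $c_t=\varepsilon$ otherwise, and $d_t=T[y_t]$ if $y_{t+1}=y_t+1$ and $d_t=\varepsilon$ otherwise. Finally, $\mathrm{Occ}^E_k(P,T)$ is the set of all $i\in\{0,\dots,n\}$ such that $\delta_E(P,T[i..j))\le k$ for some $j\in\{i,\dots,n\}$. In a deterministic one-way protocol, Alice, who knows the input $(P,T,k)$, sends one bit string to Bob, who has no input (he knows only the protocol, which may depend on $\Sigma$) and computes the output from the message. There are absolute constants in the $\mathcal O$-bounds below, independent of $\Sigma,P,T,n,m,k$, such that the following holds. 1. For every alphabet $\Sigma$ (possibly infinite) there is such a protocol whose message has $\mathcal O\!\left(\frac nm\cdot k\log^2 m\right)$ bits and from which Bob obtains $\mathrm{Occ}^E_k(P,T)$, the family of all fragments $T[i..j)$ (that is, of all pairs $(i,j)$ with $0\le i\le j\le n$) with $\delta_E(P,T[i..j))\le k$, and, for each of these fragments, all optimal alignments of $P$ onto $T[i..j)$. 2. For every finite alphabet $\Sigma$ there is such a protocol whose message has $\mathcal O\!\left(\frac nm\cdot k\log m\,\log(m|\Sigma|)\right)$ bits and from which Bob obtains everything listed in 1 and, in addition, the edit information of each of these optimal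 alignments. -/

import Mathlib

universe u

namespace EditMatching

/-- The fragment `X[i..j)` of a string, for `i ≤ j ≤ |X|`. -/
def fragment {α : Type u} (X : List α) (i j : ℕ) : List α :=
  (X.take j).drop i

/-- One step of an alignment: it aligns two characters, deletes one, or inserts one. -/
def Step (p q : ℕ × ℕ) : Prop :=
  q = (p.1 + 1, p.2 + 1) ∨ q = (p.1 + 1, p.2) ∨ q = (p.1, p.2 + 1)

/-- `A` is an alignment of the fragment `X[x..x')` onto the fragment `Y[y..y')`: a sequence of
positions from `(x, y)` to `(x', y')` all of whose consecutive elements form a `Step`. -/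
def IsAlignment (A : List (ℕ × ℕ)) (x x' y y' : ℕ) : Prop :=
  A.head? = some (x, y) ∧ A.getLast? = some (x', y') ∧ A.IsChain Step

/-- The pairs of consecutive elements of a sequence. -/
def steps (A : List (ℕ × ℕ)) : List ((ℕ × ℕ) × (ℕ × ℕ)) :=
  A.zip A.tail

/-- The step `s` deletes a character of `X`, inserts a character of `Y`, or substitutes a character
of `X` with a different character of `Y`. -/
def IsEdit {α : Type u} (X Y : List α) (s : (ℕ × ℕ) × (ℕ × ℕ)) : Prop :=
  s.2 = (s.1.1 + 1, s.1.2) ∨ s.2 = (s.1.1, s.1.2 + 1) ∨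
    (s.2 = (s.1.1 + 1, s.1.2 + 1) ∧ X[s.1.1]? ≠ Y[s.1.2]?)

open Classical in
/-- The cost of an alignment between fragments of `X` and `Y`: the number of characters that it
deletes, inserts, or substitutes. -/
noncomputable def cost {α : Type u} (X Y : List α) (A : List (ℕ × ℕ)) : ℕ :=
  (steps A).countP (fun s => decide (IsEdit X Y s))

/-- The edit distance: the minimum cost of an alignment of all of `X` onto all of `Y`. -/
noncomputable def editDist {α : Type u} (X Y : List α) : ℕ :=
  sInf {c | ∃ A, IsAlignment A 0 X.length 0 Y.length ∧ cost X Y A = c}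

theorem exists_isAlignment (a b : ℕ) : ∃ A, IsAlignment A 0 a 0 b := by
  induction a with
  | zero =>
    induction b with
    | zero => exact ⟨[(0, 0)], by simp [IsAlignment]⟩
    | succ b ih =>
      obtain ⟨A, h1, h2, h3⟩ := ih
      refine ⟨A ++ [(0, b + 1)], by simp [h1], by simp, ?_⟩
      simp [List.isChain_append, h2, h3, Step]
  | succ a ih =>
    obtain ⟨A, h1, h2, h3⟩ := ih
    refine ⟨A ++ [(a + 1, b)], by simp [h1], by simp, ?_⟩
    simp [List.isChain_append, h2, h3, Step]

/-- The infimum in `editDist` is attained. -/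
theorem exists_cost_eq_editDist {α : Type u} (X Y : List α) :
    ∃ A, IsAlignment A 0 X.length 0 Y.length ∧ cost X Y A = editDist X Y := by
  obtain ⟨A, hA⟩ := exists_isAlignment X.length Y.length
  exact Nat.sInf_mem (s := {c | ∃ A, IsAlignment A 0 X.length 0 Y.length ∧ cost X Y A = c})
    ⟨_, A, hA, rfl⟩

/-- `A` is an optimal alignment of `P` onto the fragment `T[i..j)`. -/
def IsOptimalAlignment {α : Type u} (P T : List α) (i j : ℕ) (A : List (ℕ × ℕ)) : Prop :=
  IsAlignment A 0 P.length i j ∧ cost P T A = editDist P (fragment T i j)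

/-- The character of `X` that is read when the position moves from `a` to `b`;
`none` is the empty string `ε`. -/
def readChar {α : Type u} (X : List α) (a b : ℕ) : Option α :=
  if b = a + 1 then X[a]? else none

/-- The edit information of an alignment between fragments of `X` and `Y`: the set of 4-tuples
`(xᵢ, cxᵢ, yᵢ, cyᵢ)` with `cxᵢ ≠ cyᵢ`. -/
def editInfo {α : Type u} (X Y : List α) (A : List (ℕ × ℕ)) :
    Set (ℕ × Option α × ℕ × Option α) :=
  {e | ∃ s ∈ steps A, readChar X s.1.1 s.2.1 ≠ readChar Y s.1.2 s.2.2 ∧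
    e = (s.1.1, readChar X s.1.1 s.2.1, s.1.2, readChar Y s.1.2 s.2.2)}

/-- An input of Pattern Matching with Edits. -/
structure Instance (α : Type u) where
  pattern : List α
  text : List α
  threshold : ℕ

namespace Instance

variable {α : Type u} (I : Instance α)

/-- The pairs `(i, j)`, `0 ≤ i ≤ j ≤ n`, such that the fragment `T[i..j)` is at edit distance at
most `k` from `P`. -/
def fragments : Set (ℕ × ℕ) :=
  {f | f.1 ≤ f.2 ∧ f.2 ≤ I.text.length ∧
    editDist I.pattern (fragment I.text f.1 f.2) ≤ I.threshold}

/-- The starting positions of the `k`-error occurrences of `P` in `T`. -/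
def occ : Set ℕ :=
  {i | i ≤ I.text.length ∧ ∃ j, i ≤ j ∧ j ≤ I.text.length ∧
    editDist I.pattern (fragment I.text i j) ≤ I.threshold}

/-- All optimal alignments of `P` onto fragments `T[i..j)` at edit distance at most `k`, each
recorded together with `(i, j)`. -/
def optimalAlignments : Set ((ℕ × ℕ) × List (ℕ × ℕ)) :=
  {a | a.1 ∈ I.fragments ∧ IsOptimalAlignment I.pattern I.text a.1.1 a.1.2 a.2}

/-- All optimal alignments as above, each recorded together with its edit information. -/
def alignmentsWithInfo :
    Set (((ℕ × ℕ) × List (ℕ × ℕ)) × Set (ℕ × Option α × ℕ × Option α)) :=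
  {e | e.1 ∈ I.optimalAlignments ∧ e.2 = editInfo I.pattern I.text e.1.2}

end Instance

/-- A deterministic one-way protocol: Alice, who holds the whole input, sends a single message,
a string of bits; Bob, who has no input, computes the output from the message alone. -/
structure OneWayProtocol (Input Output : Type*) where
  message : Input → List Bool
  output : List Bool → Output

end EditMatching

/-! Information is handled by comparing two inputs: `Agree P T P' T' A` expresses that `(P', T')`
has the same edits, with the same characters, along `A`. If equal messages force the cheap optimal
alignments of each input to agree with the other input, then both inputs have the same optimal
alignments and edit information (`CheapAgree.optimalAlignments_eq`, `CheapAgree.editInfo_eq`), and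
Bob's output is a function of the message (`exists_protocol`). So it suffices to find, for every
window of `m / 4` starting positions, alignments of total cost `O(k log m)` whose edits force
agreement along every optimal alignment of cost at most `k` that starts there
(`exists_certificate`).

Let `S` be a set of cheap alignments reaching both ends of the relevant part of `T`. Join two
characters if `S` matches them. Components containing an edited character are red, and the edits of
`S` reveal them. On the other, black, characters each alignment in `S` is a shift of ranks, and a
Fine–Wilf argument shows that whatever is constant along `S` is constant on residue classes of ranks
modulo the gcd `g` of the shifts (`label_eq_of_modEq`). Adding an alignment `X` to `S` either at
least halves the number of classes, or `X` coincides on a whole class with the shift by some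
multiple `j * g` (`Enclosing.exists_shared`). After `O(log m)` additions only the second case
remains, or nothing is black (`Enclosing.exists_saturated`).

The edits of `S`, distributed over the residues, give weights with sum at most `|S| k`, and shifting
a part of `P` by `j * g` costs at most the weights it passes (`Enclosing.edits_between`). Between
consecutive matches shared with the shift, an optimal `X` is no more expensive than that. As it
avoids the shift there, following its matches from a black character leads monotonically to a
revealed one, so this piece of `X` reveals a whole arc of classes (`Enclosing.exists_piece`). Arcs
can be thinned to multiplicity two (`exists_subcover`), so everything between shared matches is
revealed at cost `O(|S| k)`. Deletions of the outermost black characters of `P` and four extremal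
alignments handle what lies outside the shared matches. Then each black character met by `X` lies on
a shared match, where periodicity gives equality in the second input too, or is known; agreement
along `X` follows (`agree_of_known`).

Each edit costs `O(log m + log K)` bits if characters are numbers up to `K`; if `16 k > m`, both
strings are sent verbatim. For arbitrary alphabets a character is renamed to its first position in
`P`, which preserves all comparisons between `P` and `T` and allows `K = m`. -/

namespace EditMatching

/-! ### Alignments as lattice paths. -/

/-- `Route p q A` says that `A` is a sequence of steps from the point `p` to the point `q`. -/
inductive Route : ℕ × ℕ → ℕ × ℕ → List (ℕ × ℕ) → Prop
  | single (p : ℕ × ℕ) : Route p p [p]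
  | cons {p r q : ℕ × ℕ} {A : List (ℕ × ℕ)} : Step p r → Route r q A → Route p q (p :: A)

namespace Route

variable {p q r : ℕ × ℕ} {A B : List (ℕ × ℕ)}

theorem exists_eq_cons (h : Route p q A) : ∃ B, A = p :: B := by
  cases h <;> exact ⟨_, rfl⟩

theorem steps_cons (h : Route r q A) : steps (p :: A) = (p, r) :: steps A := by
  obtain ⟨B, rfl⟩ := h.exists_eq_cons
  simp [steps]

theorem of_isChain (h1 : A.head? = some p) (h2 : A.getLast? = some q) (h3 : A.IsChain Step) :
    Route p q A := by
  induction A generalizing p with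
  | nil => simp at h1
  | cons a A ih =>
    obtain rfl : a = p := by simpa using h1
    cases A with
    | nil =>
      obtain rfl : a = q := by simpa using h2
      exact .single _
    | cons b A =>
      rw [List.isChain_cons_cons] at h3
      exact .cons h3.1 (ih (by simp) (by simpa using h2) h3.2)

theorem isChain (h : Route p q A) :
    A.head? = some p ∧ A.getLast? = some q ∧ A.IsChain Step := by
  induction h with
  | single p => simp
  | @cons p r q A hs hr ih =>
    obtain ⟨B, rfl⟩ := hr.exists_eq_cons
    refine ⟨by simp, by simpa using ih.2.1, ?_⟩
    rw [List.isChain_cons_cons]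
    exact ⟨hs, ih.2.2⟩

theorem isAlignment_iff {x x' y y' : ℕ} :
    IsAlignment A x x' y y' ↔ Route (x, y) (x', y') A :=
  ⟨fun h => of_isChain h.1 h.2.1 h.2.2, isChain⟩

theorem le (h : Route p q A) : p.1 ≤ q.1 ∧ p.2 ≤ q.2 := by
  induction h with
  | single p => simp
  | cons hs _ ih => rcases hs with rfl | rfl | rfl <;> simp at ih <;> omega

theorem step_of_mem (h : Route p q A) {s : (ℕ × ℕ) × (ℕ × ℕ)} (hs : s ∈ steps A) :
    Step s.1 s.2 := by
  induction h with
  | single p => simp [steps] at hs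
  | @cons p r q A h1 h2 ih =>
    rw [h2.steps_cons, List.mem_cons] at hs
    rcases hs with rfl | hs
    · exact h1
    · exact ih hs

/-- A route splits at each of its steps. -/
theorem split (h : Route p q A) {s : (ℕ × ℕ) × (ℕ × ℕ)} (hs : s ∈ steps A) :
    ∃ A₁ A₂, Route p s.1 A₁ ∧ Route s.2 q A₂ ∧ steps A = steps A₁ ++ s :: steps A₂ := by
  induction h with
  | single p => simp [steps] at hs
  | @cons p r q A h1 h2 ih =>
    rw [h2.steps_cons, List.mem_cons] at hs
    rcases hs with rfl | hs
    · exact ⟨[p], A, .single p, h2, by rw [h2.steps_cons]; simp [steps]⟩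
    · obtain ⟨A₁, A₂, a1, a2, a3⟩ := ih hs
      exact ⟨p :: A₁, A₂, .cons h1 a1, a2, by rw [h2.steps_cons, a1.steps_cons, a3]; rfl⟩

theorem bounds (h : Route p q A) {s : (ℕ × ℕ) × (ℕ × ℕ)} (hs : s ∈ steps A) :
    (p.1 ≤ s.1.1 ∧ p.2 ≤ s.1.2) ∧ (s.2.1 ≤ q.1 ∧ s.2.2 ≤ q.2) := by
  obtain ⟨_, _, h1, h2, _⟩ := h.split hs
  exact ⟨h1.le, h2.le⟩

theorem append (h : Route p q A) (h' : Route q r B) :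
    ∃ C, Route p r C ∧ steps C = steps A ++ steps B := by
  induction h with
  | single p => exact ⟨B, h', by simp [steps]⟩
  | @cons p r q A h1 h2 ih =>
    obtain ⟨C, c1, c2⟩ := ih h'
    exact ⟨p :: C, .cons h1 c1, by rw [h2.steps_cons, c1.steps_cons, c2]; rfl⟩

/-- Two steps of a route are equal or one precedes the other. -/
theorem trichotomy (h : Route p q A) {s t : (ℕ × ℕ) × (ℕ × ℕ)} (hs : s ∈ steps A)
    (ht : t ∈ steps A) :
    s = t ∨ (s.2.1 ≤ t.1.1 ∧ s.2.2 ≤ t.1.2) ∨ (t.2.1 ≤ s.1.1 ∧ t.2.2 ≤ s.1.2) := by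
  obtain ⟨A₁, A₂, h1, h2, h3⟩ := h.split hs
  rw [h3, List.mem_append, List.mem_cons] at ht
  rcases ht with ht | rfl | ht
  · exact .inr (.inr (h1.bounds ht).2)
  · exact .inl rfl
  · exact .inr (.inl (h2.bounds ht).1)

theorem exists_step_fst (h : Route p q A) {x : ℕ} (h1 : p.1 ≤ x) (h2 : x < q.1) :
    ∃ s ∈ steps A, s.1.1 = x ∧ s.2.1 = x + 1 := by
  induction h with
  | single p => omega
  | @cons p r q A hs hr ih =>
    rw [hr.steps_cons]
    by_cases hx : r.1 ≤ x
    · obtain ⟨s, hs, h⟩ := ih hx h2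
      exact ⟨s, by simp [hs], h⟩
    · refine ⟨(p, r), by simp, ?_⟩
      rcases hs with rfl | rfl | rfl <;> simp at hx ⊢ <;> omega

theorem exists_step_snd (h : Route p q A) {y : ℕ} (h1 : p.2 ≤ y) (h2 : y < q.2) :
    ∃ s ∈ steps A, s.1.2 = y ∧ s.2.2 = y + 1 := by
  induction h with
  | single p => omega
  | @cons p r q A hs hr ih =>
    rw [hr.steps_cons]
    by_cases hx : r.2 ≤ y
    · obtain ⟨s, hs, h⟩ := ih hx h2
      exact ⟨s, by simp [hs], h⟩
    · refine ⟨(p, r), by simp, ?_⟩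
      rcases hs with rfl | rfl | rfl <;> simp at hx ⊢ <;> omega

/-- A property of points that every step preserves holds before and after each step. -/
theorem invariant (h : Route p q A) {I : ℕ × ℕ → Prop} (h0 : I p)
    (hstep : ∀ s ∈ steps A, I s.1 → I s.2) : I q ∧ ∀ s ∈ steps A, I s.1 ∧ I s.2 := by
  induction h with
  | single p => simp [steps, h0]
  | @cons p r q A hs hr ih =>
    rw [hr.steps_cons] at hstep ⊢
    have hr' := hstep (p, r) (by simp) h0
    obtain ⟨i1, i2⟩ := ih hr' (fun s hs => hstep s (by simp [hs]))
    refine ⟨i1, ?_⟩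
    simp only [List.mem_cons]
    rintro s (rfl | hs)
    · exact ⟨h0, hr'⟩
    · exact i2 s hs

end Route

/-! ### Matches and edits along a path. -/

section Matched

variable {α : Type u} (X Y : List α)

/-- The alignment `A` matches `X[x]` with `Y[y]`. -/
def Matched (A : List (ℕ × ℕ)) (x y : ℕ) : Prop :=
  ((x, y), (x + 1, y + 1)) ∈ steps A ∧ X[x]? = Y[y]?

variable {X Y} {A : List (ℕ × ℕ)} {p q : ℕ × ℕ}

theorem isEdit_or_eq {s : (ℕ × ℕ) × (ℕ × ℕ)} (h : Step s.1 s.2) :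
    IsEdit X Y s ∨ (¬ IsEdit X Y s ∧ s.2 = (s.1.1 + 1, s.1.2 + 1) ∧ X[s.1.1]? = Y[s.1.2]?) := by
  obtain ⟨⟨a, b⟩, ⟨c, d⟩⟩ := s
  by_cases h' : IsEdit X Y ((a, b), (c, d))
  · exact .inl h'
  · refine .inr ⟨h', ?_⟩
    simp only [IsEdit, Step, Prod.mk.injEq] at h h' ⊢
    push Not at h'
    rcases h with h | h | h
    · exact ⟨h, h'.2.2 h⟩
    · exact absurd h.2 (h'.1 h.1)
    · exact absurd h.2 (h'.2.1 h.1)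

theorem Matched.not_isEdit {x y : ℕ} (h : Matched X Y A x y) :
    ¬ IsEdit X Y ((x, y), (x + 1, y + 1)) := by
  simp [IsEdit, h.2]

theorem Matched.lt_iff {x y x' y' : ℕ} (hA : Route p q A) (h : Matched X Y A x y)
    (h' : Matched X Y A x' y') : x < x' ↔ y < y' := by
  have := hA.trichotomy h.1 h'.1
  simp only [Prod.mk.injEq] at this
  omega

theorem Matched.eq_iff {x y x' y' : ℕ} (hA : Route p q A) (h : Matched X Y A x y)
    (h' : Matched X Y A x' y') : x = x' ↔ y = y' := by
  have := hA.trichotomy h.1 h'.1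
  simp only [Prod.mk.injEq] at this
  omega

theorem Route.matched_or_edit_fst (hA : Route p q A) {x : ℕ} (h1 : p.1 ≤ x) (h2 : x < q.1) :
    (∃ y, Matched X Y A x y) ∨ ∃ s ∈ steps A, IsEdit X Y s ∧ s.1.1 = x ∧ s.2.1 = x + 1 := by
  obtain ⟨s, hs, hx⟩ := hA.exists_step_fst h1 h2
  rcases isEdit_or_eq (X := X) (Y := Y) (hA.step_of_mem hs) with h | ⟨_, h3, h4⟩
  · exact .inr ⟨s, hs, h, hx⟩
  · obtain ⟨⟨a, b⟩, c⟩ := s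
    simp only at hx h3 h4
    obtain ⟨rfl, -⟩ := hx
    subst h3
    exact .inl ⟨b, hs, h4⟩

theorem Route.matched_or_edit_snd (hA : Route p q A) {y : ℕ} (h1 : p.2 ≤ y) (h2 : y < q.2) :
    (∃ x, Matched X Y A x y) ∨ ∃ s ∈ steps A, IsEdit X Y s ∧ s.1.2 = y ∧ s.2.2 = y + 1 := by
  obtain ⟨s, hs, hx⟩ := hA.exists_step_snd h1 h2
  rcases isEdit_or_eq (X := X) (Y := Y) (hA.step_of_mem hs) with h | ⟨_, h3, h4⟩
  · exact .inr ⟨s, hs, h, hx⟩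
  · obtain ⟨⟨a, b⟩, c⟩ := s
    simp only at hx h3 h4
    obtain ⟨rfl, -⟩ := hx
    subst h3
    exact .inl ⟨a, hs, h4⟩

variable (X Y)

open Classical in
/-- The number of edits in a list of steps. -/
noncomputable def editCount (l : List ((ℕ × ℕ) × (ℕ × ℕ))) : ℕ :=
  l.countP (fun s => decide (IsEdit X Y s))

theorem cost_eq_editCount (A : List (ℕ × ℕ)) : cost X Y A = editCount X Y (steps A) := rfl

theorem editCount_append (l l' : List ((ℕ × ℕ) × (ℕ × ℕ))) :
    editCount X Y (l ++ l') = editCount X Y l + editCount X Y l' := by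
  simp [editCount]

theorem editCount_cons (s : (ℕ × ℕ) × (ℕ × ℕ)) (l : List ((ℕ × ℕ) × (ℕ × ℕ))) :
    editCount X Y (s :: l) = editCount X Y [s] + editCount X Y l := by
  rw [← List.singleton_append, editCount_append]

variable {X Y}

theorem editCount_edit {s : (ℕ × ℕ) × (ℕ × ℕ)} (h : IsEdit X Y s) : editCount X Y [s] = 1 := by
  simp [editCount, h]

theorem editCount_not_edit {s : (ℕ × ℕ) × (ℕ × ℕ)} (h : ¬ IsEdit X Y s) :
    editCount X Y [s] = 0 := by
  simp [editCount, h]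

/-- A step that is not an edit is diagonal, so the diagonal changes only at edits, by at most one
each. -/
theorem Route.length_diff_le (h : Route p q A) :
    q.1 - p.1 ≤ q.2 - p.2 + cost X Y A ∧ q.2 - p.2 ≤ q.1 - p.1 + cost X Y A := by
  induction h with
  | single p => simp
  | @cons p r q A hs hr ih =>
    have hle := hr.le
    rw [cost_eq_editCount, hr.steps_cons, editCount_cons, ← cost_eq_editCount]
    rcases hs with rfl | rfl | rfl
    · simp only at *
      omega
    · rw [editCount_edit (by simp [IsEdit])]
      simp only at *
      omega
    · rw [editCount_edit (by simp [IsEdit])]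
      simp only at *
      omega

/-- The part of a route after one step and before a later one. -/
theorem Route.between (hA : Route p q A) {s t : (ℕ × ℕ) × (ℕ × ℕ)} (hs : s ∈ steps A)
    (ht : t ∈ steps A) (hst : s.2.1 ≤ t.1.1 ∧ s.2.2 ≤ t.1.2) :
    ∃ A₁ B A₂, Route p s.1 A₁ ∧ Route s.2 t.1 B ∧ Route t.2 q A₂ ∧
      steps A = steps A₁ ++ s :: (steps B ++ t :: steps A₂) := by
  obtain ⟨A₁, C, h1, h2, h3⟩ := hA.split hs
  have hss := hA.step_of_mem hs
  have hts := hA.step_of_mem ht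
  have ht' : t ∈ steps C := by
    rw [h3, List.mem_append, List.mem_cons] at ht
    obtain ⟨⟨a, b⟩, ⟨c, d⟩⟩ := s
    obtain ⟨⟨a', b'⟩, ⟨c', d'⟩⟩ := t
    rcases ht with ht | ht | ht
    · have := (h1.bounds ht).2
      simp only [Step, Prod.mk.injEq] at *
      omega
    · simp only [Step, Prod.mk.injEq] at *
      omega
    · exact ht
  obtain ⟨B, A₂, h4, h5, h6⟩ := h2.split ht'
  exact ⟨A₁, B, A₂, h1, h4, h5, by rw [h3, h6]⟩

end Matched

/-! ### Edit scripts, the triangle inequality, and optimality of parts. -/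

section Edits

variable {α : Type u}

/-- `Edits n X Y` says that at most `n` edits turn `X` into `Y`. -/
inductive Edits : ℕ → List α → List α → Prop
  | nil (n : ℕ) : Edits n [] []
  | keep {n : ℕ} {X Y : List α} (a : α) : Edits n X Y → Edits n (a :: X) (a :: Y)
  | del {n : ℕ} {X Y : List α} (a : α) : Edits n X Y → Edits (n + 1) (a :: X) Y
  | ins {n : ℕ} {X Y : List α} (a : α) : Edits n X Y → Edits (n + 1) X (a :: Y)
  | sub {n : ℕ} {X Y : List α} (a b : α) : Edits n X Y → Edits (n + 1) (a :: X) (b :: Y)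

namespace Edits

variable {X Y Z X' Y' : List α} {a b : ℕ}

theorem mono (h : Edits a X Y) : ∀ {b}, a ≤ b → Edits b X Y := by
  induction h with
  | nil n => exact fun _ => .nil _
  | keep c _ ih => exact fun hb => .keep c (ih hb)
  | del c _ ih =>
    intro b hb
    obtain ⟨b, rfl⟩ := Nat.exists_eq_add_of_le' (Nat.one_le_of_lt hb)
    exact .del c (ih (by omega))
  | ins c _ ih =>
    intro b hb
    obtain ⟨b, rfl⟩ := Nat.exists_eq_add_of_le' (Nat.one_le_of_lt hb)
    exact .ins c (ih (by omega))
  | sub c d _ ih =>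
    intro b hb
    obtain ⟨b, rfl⟩ := Nat.exists_eq_add_of_le' (Nat.one_le_of_lt hb)
    exact .sub c d (ih (by omega))

theorem symm (h : Edits a X Y) : Edits a Y X := by
  induction h with
  | nil n => exact .nil n
  | keep c _ ih => exact .keep c ih
  | del c _ ih => exact .ins c ih
  | ins c _ ih => exact .del c ih
  | sub c d _ ih => exact .sub d c ih

theorem refl (X : List α) : Edits 0 X X := by
  induction X with
  | nil => exact .nil 0
  | cons a X ih => exact .keep a ih

theorem append (h : Edits a X Y) (h' : Edits b X' Y') : Edits (a + b) (X ++ X') (Y ++ Y') := by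
  induction h with
  | nil n => exact h'.mono (by omega)
  | keep c _ ih => exact .keep c ih
  | del c _ ih => rw [Nat.add_right_comm]; exact .del c ih
  | ins c _ ih => rw [Nat.add_right_comm]; exact .ins c ih
  | sub c d _ ih => rw [Nat.add_right_comm]; exact .sub c d ih

/-- The scripts are merged along the middle string. Insertions of the second and deletions of the
first do not touch it and come first; every other pair of operations acts on one common character of
`Y`. -/
theorem trans : ∀ {X Y Z : List α} {a b : ℕ}, Edits a X Y → Edits b Y Z → Edits (a + b) X Z
  | _, _, _, _, _, h, .ins c h' => .ins c (trans h h')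
  | _, _, _, _, b, .del c h, h' => (Edits.del c (trans h h')).mono (by omega)
  | _, _, _, _, _, .nil _, .nil _ => .nil _
  | _, _, _, _, _, .keep c h, .keep _ h' => .keep c (trans h h')
  | _, _, _, _, _, .keep c h, .del _ h' => .del c (trans h h')
  | _, _, _, _, _, .keep c h, .sub _ d h' => .sub c d (trans h h')
  | _, _, _, _, _, .ins c h, .keep _ h' => (Edits.ins c (trans h h')).mono (by omega)
  | _, _, _, _, _, .ins c h, .del _ h' => (trans h h').mono (by omega)
  | _, _, _, _, _, .ins c h, .sub _ d h' => (Edits.ins d (trans h h')).mono (by omega)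
  | _, _, _, _, _, .sub c d h, .keep _ h' => (Edits.sub c d (trans h h')).mono (by omega)
  | _, _, _, _, _, .sub c d h, .del _ h' => (Edits.del c (trans h h')).mono (by omega)
  | _, _, _, _, _, .sub c _ h, .sub _ e h' => (Edits.sub c e (trans h h')).mono (by omega)
termination_by X Y Z => X.length + Y.length + Z.length

theorem length_le (h : Edits a X Y) : X.length ≤ Y.length + a ∧ Y.length ≤ X.length + a := by
  induction h <;> simp <;> omega

end Edits

theorem fragment_self (X : List α) (x : ℕ) : fragment X x x = [] := by
  simp [fragment]

theorem fragment_eq_cons {X : List α} {x x' : ℕ} (h : x < x') (h' : x' ≤ X.length) :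
    fragment X x x' = X[x]'(by omega) :: fragment X (x + 1) x' := by
  rw [fragment, List.drop_eq_getElem_cons (by simp; omega)]
  simp [fragment]

theorem fragment_append {X : List α} {x y z : ℕ} (h : x ≤ y) (h' : y ≤ z) (h'' : z ≤ X.length) :
    fragment X x y ++ fragment X y z = fragment X x z := by
  apply List.ext_getElem?
  intro i
  simp only [fragment, List.getElem?_append, List.getElem?_drop, List.getElem?_take,
    List.length_drop, List.length_take]
  split_ifs <;> first | omega | rfl | (congr 1; omega)

theorem length_fragment {X : List α} {x y : ℕ} (h : y ≤ X.length) :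
    (fragment X x y).length = y - x := by
  simp [fragment]; omega

theorem fragment_full (X : List α) : fragment X 0 X.length = X := by simp [fragment]

/-- One half of the dictionary between paths and edit scripts. Scripts forget positions, which is
what makes them composable. -/
theorem Route.edits {X Y : List α} {p q : ℕ × ℕ} {A : List (ℕ × ℕ)} (h : Route p q A)
    (h1 : q.1 ≤ X.length) (h2 : q.2 ≤ Y.length) :
    Edits (cost X Y A) (fragment X p.1 q.1) (fragment Y p.2 q.2) := by
  induction h with
  | single p => simpa [fragment_self] using Edits.nil _
  | @cons p r q A hs hr ih =>
    have hle := hr.le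
    have ih := ih h1 h2
    rw [cost_eq_editCount, hr.steps_cons, editCount_cons, ← cost_eq_editCount, add_comm]
    rcases hs with rfl | rfl | rfl
    · simp only at hle ih
      rw [fragment_eq_cons (show p.1 < q.1 by omega) h1,
        fragment_eq_cons (show p.2 < q.2 by omega) h2]
      by_cases he : IsEdit X Y (p, (p.1 + 1, p.2 + 1))
      · rw [editCount_edit he]
        exact .sub _ _ ih
      · rw [editCount_not_edit he]
        have : X[p.1]? = Y[p.2]? := by
          simp only [IsEdit] at he
          push Not at he
          simpa using he.2.2
        rw [List.getElem?_eq_getElem (by omega), List.getElem?_eq_getElem (by omega),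
          Option.some_inj] at this
        rw [this]
        exact .keep _ ih
    · simp only at hle ih
      rw [fragment_eq_cons (show p.1 < q.1 by omega) h1, editCount_edit (by simp [IsEdit])]
      exact .del _ ih
    · simp only at hle ih
      rw [fragment_eq_cons (show p.2 < q.2 by omega) h2, editCount_edit (by simp [IsEdit])]
      exact .ins _ ih

/-- The converse half. The fragments are replaced by variables `F` and `G` so that induction on the
script is possible. -/
theorem Edits.exists_route_aux {X Y F G : List α} {n : ℕ} (h : Edits n F G) :
    ∀ {x x' y y' : ℕ}, x ≤ x' → y ≤ y' → x' ≤ X.length → y' ≤ Y.length →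
    F = fragment X x x' → G = fragment Y y y' →
    ∃ A, Route (x, y) (x', y') A ∧ cost X Y A ≤ n := by
  have nil_iff : ∀ {Z : List α} {z z' : ℕ}, z ≤ z' → z' ≤ Z.length → fragment Z z z' = [] →
      z = z' := by
    intro Z z z' h1 h2 h3
    have := length_fragment (x := z) h2
    rw [h3] at this
    simp at this
    omega
  have cons_iff : ∀ {Z : List α} {z z' : ℕ} {c : α} {F : List α}, z ≤ z' → z' ≤ Z.length →
      c :: F = fragment Z z z' → z + 1 ≤ z' ∧ Z[z]? = some c ∧ F = fragment Z (z + 1) z' := by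
    intro Z z z' c F h1 h2 h3
    have h4 : z < z' := by
      by_contra h4
      obtain rfl : z = z' := by omega
      simp [fragment_self] at h3
    rw [fragment_eq_cons h4 h2, List.cons.injEq] at h3
    refine ⟨h4, ?_, h3.2⟩
    rw [List.getElem?_eq_getElem (by omega), h3.1]
  induction h with
  | nil n =>
    intro x x' y y' h1 h2 h3 h4 hF hG
    obtain rfl := nil_iff h1 h3 hF.symm
    obtain rfl := nil_iff h2 h4 hG.symm
    exact ⟨_, .single _, by simp [cost, steps]⟩
  | keep c h ih =>
    intro x x' y y' h1 h2 h3 h4 hF hG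
    obtain ⟨a1, a2, a3⟩ := cons_iff h1 h3 hF
    obtain ⟨b1, b2, b3⟩ := cons_iff h2 h4 hG
    obtain ⟨A, hA, hc⟩ := ih a1 b1 h3 h4 a3 b3
    refine ⟨_, .cons (.inl rfl) hA, ?_⟩
    rw [cost_eq_editCount, hA.steps_cons, editCount_cons, ← cost_eq_editCount,
      editCount_not_edit (by simp [IsEdit, a2, b2])]
    omega
  | del c h ih =>
    intro x x' y y' h1 h2 h3 h4 hF hG
    obtain ⟨a1, a2, a3⟩ := cons_iff h1 h3 hF
    obtain ⟨A, hA, hc⟩ := ih a1 h2 h3 h4 a3 hG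
    refine ⟨_, .cons (.inr (.inl rfl)) hA, ?_⟩
    rw [cost_eq_editCount, hA.steps_cons, editCount_cons, ← cost_eq_editCount,
      editCount_edit (by simp [IsEdit])]
    omega
  | ins c h ih =>
    intro x x' y y' h1 h2 h3 h4 hF hG
    obtain ⟨a1, a2, a3⟩ := cons_iff h2 h4 hG
    obtain ⟨A, hA, hc⟩ := ih h1 a1 h3 h4 hF a3
    refine ⟨_, .cons (.inr (.inr rfl)) hA, ?_⟩
    rw [cost_eq_editCount, hA.steps_cons, editCount_cons, ← cost_eq_editCount,
      editCount_edit (by simp [IsEdit])]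
    omega
  | sub c d h ih =>
    intro x x' y y' h1 h2 h3 h4 hF hG
    obtain ⟨a1, a2, a3⟩ := cons_iff h1 h3 hF
    obtain ⟨b1, b2, b3⟩ := cons_iff h2 h4 hG
    obtain ⟨A, hA, hc⟩ := ih a1 b1 h3 h4 a3 b3
    refine ⟨_, .cons (.inl rfl) hA, ?_⟩
    rw [cost_eq_editCount, hA.steps_cons, editCount_cons, ← cost_eq_editCount]
    have : editCount X Y [((x, y), (x + 1, y + 1))] ≤ 1 := List.countP_le_length
    omega

theorem Edits.exists_route {X Y : List α} {n x x' y y' : ℕ}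
    (h : Edits n (fragment X x x') (fragment Y y y')) (hx : x ≤ x') (hy : y ≤ y')
    (hx' : x' ≤ X.length) (hy' : y' ≤ Y.length) :
    ∃ A, Route (x, y) (x', y') A ∧ cost X Y A ≤ n :=
  h.exists_route_aux hx hy hx' hy' rfl rfl

theorem editDist_le_iff {X Y : List α} {n : ℕ} : editDist X Y ≤ n ↔ Edits n X Y := by
  constructor
  · intro h
    obtain ⟨A, h1, h2⟩ := exists_cost_eq_editDist X Y
    have := (Route.isAlignment_iff.1 h1).edits (X := X) (Y := Y) le_rfl le_rfl
    simp only [fragment_full, h2] at this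
    exact this.mono h
  · intro h
    obtain ⟨A, h1, h2⟩ := Edits.exists_route (X := X) (Y := Y) (x := 0) (y := 0)
      (by rwa [fragment_full, fragment_full]) (by omega) (by omega) le_rfl le_rfl
    have h3 : editDist X Y ≤ cost X Y A := Nat.sInf_le ⟨A, Route.isAlignment_iff.2 h1, rfl⟩
    exact h3.trans h2

theorem edits_editDist (X Y : List α) : Edits (editDist X Y) X Y := editDist_le_iff.1 le_rfl

theorem editDist_triangle (X Y Z : List α) : editDist X Z ≤ editDist X Y + editDist Y Z :=
  editDist_le_iff.2 ((edits_editDist X Y).trans (edits_editDist Y Z))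

theorem editDist_comm (X Y : List α) : editDist X Y = editDist Y X :=
  le_antisymm (editDist_le_iff.2 (edits_editDist Y X).symm)
    (editDist_le_iff.2 (edits_editDist X Y).symm)

theorem editDist_self (X : List α) : editDist X X = 0 :=
  Nat.le_zero.1 (editDist_le_iff.2 (.refl X))

/-- Any route from `(0, i)` to `(|P|, j)` costs at least the edit distance. -/
theorem Route.editDist_le {P T : List α} {i j : ℕ} {A : List (ℕ × ℕ)}
    (h : Route (0, i) (P.length, j) A) (hj : j ≤ T.length) :
    editDist P (fragment T i j) ≤ cost P T A := by
  have := h.edits (X := P) (Y := T) le_rfl hj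
  rw [fragment_full] at this
  exact editDist_le_iff.2 this

/-- Every part of an optimal alignment is as cheap as possible. -/
theorem IsOptimalAlignment.part_le {P T : List α} {i j : ℕ} {A A₁ B A₂ : List (ℕ × ℕ)}
    (h : IsOptimalAlignment P T i j A) (hj : j ≤ T.length)
    {s t : (ℕ × ℕ) × (ℕ × ℕ)} (h1 : Route (0, i) s.1 A₁) (hs : Step s.1 s.2)
    (hB : Route s.2 t.1 B) (ht : Step t.1 t.2) (h2 : Route t.2 (P.length, j) A₂)
    (hA : steps A = steps A₁ ++ s :: (steps B ++ t :: steps A₂)) {n : ℕ}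
    (hn : Edits n (fragment P s.2.1 t.1.1) (fragment T s.2.2 t.1.2)) : cost P T B ≤ n := by
  have hBle := hB.le
  have h2le := h2.le
  have ht1 : t.1.1 ≤ t.2.1 ∧ t.1.2 ≤ t.2.2 := by
    rcases ht with h | h | h <;> rw [h] <;> simp
  simp only at h2le
  -- Exchange argument: the cheaper `B'` is spliced in place of `B`, and the resulting alignment
  -- still costs at least the edit distance.
  obtain ⟨B', hB', hc⟩ := hn.exists_route hBle.1 hBle.2 (by omega) (by omega)
  obtain ⟨D, hD, hD'⟩ := hB'.append (.cons ht h2)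
  obtain ⟨C, hC, hC'⟩ := h1.append (.cons hs hD)
  rw [hD.steps_cons, hD', h2.steps_cons] at hC'
  have := hC.editDist_le hj
  rw [← h.2, cost_eq_editCount, cost_eq_editCount, hA, hC'] at this
  rw [cost_eq_editCount] at hc ⊢
  rw [editCount_append, editCount_append, editCount_cons _ _ s, editCount_cons _ _ s (_ ++ _),
    editCount_append, editCount_append] at this
  simp only [Prod.mk.eta] at this
  omega

end Edits

/-! ### Periodicity of labellings preserved by shifts. -/

section Stride

/-- The greatest common divisor of the shifts, or `M` if all of them are zero. -/
def stride (sh : Finset ℕ) (M : ℕ) : ℕ :=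
  if sh.gcd id = 0 then M else sh.gcd id

theorem stride_dvd {sh : Finset ℕ} {M s : ℕ} (hs : s ∈ sh) : stride sh M ∣ s := by
  unfold stride
  split_ifs with h
  · rw [Finset.gcd_eq_zero_iff] at h
    have : s = 0 := h s hs
    simp [this]
  · exact Finset.gcd_dvd (f := id) hs

theorem stride_eq_gcd {sh : Finset ℕ} {M s : ℕ} (hs : s ∈ sh) (h0 : s ≠ 0) :
    stride sh M = sh.gcd id := by
  unfold stride
  rw [if_neg]
  intro h
  rw [Finset.gcd_eq_zero_iff] at h
  exact h0 (h s hs)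

theorem stride_pos {sh : Finset ℕ} {M : ℕ} (hM : 0 < M) : 0 < stride sh M := by
  unfold stride
  split_ifs with h
  · exact hM
  · exact Nat.pos_of_ne_zero h

theorem stride_le {sh : Finset ℕ} {M : ℕ} (h : ∀ s ∈ sh, s ≤ M) : stride sh M ≤ M := by
  by_cases h0 : ∃ s ∈ sh, s ≠ 0
  · obtain ⟨s, hs, h0⟩ := h0
    exact (Nat.le_of_dvd (Nat.pos_of_ne_zero h0) (stride_dvd hs)).trans (h s hs)
  · push Not at h0
    unfold stride
    rw [if_pos]
    rw [Finset.gcd_eq_zero_iff]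
    exact h0

/-- Euclid's algorithm carried out on the periods. -/
theorem periodic_gcd {L : Type*} {f : ℕ → L} {a b : ℕ} (ha : ∀ n, f (n + a) = f n)
    (hb : ∀ n, f (n + b) = f n) : ∀ n, f (n + Nat.gcd a b) = f n := by
  have mult : ∀ {a : ℕ}, (∀ n, f (n + a) = f n) → ∀ c n, f (n + a * c) = f n := by
    intro a ha c
    induction c with
    | zero => simp
    | succ c ih => intro n; rw [Nat.mul_succ, ← Nat.add_assoc, ha, ih]
  induction a, b using Nat.gcd.induction with
  | H0 b => simpa using hb
  | H1 a b h ih =>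
    rw [Nat.gcd_rec]
    refine ih (fun n => ?_) ha
    rw [← mult ha (b / a) (n + b % a), Nat.add_assoc, Nat.mod_add_div, hb]

/-- A labelling that the shifts preserve is periodic. -/
theorem label_eq_of_modEq {L : Type*} {f : ℕ → L} {sh : Finset ℕ} {M M' q : ℕ} (hq : q ∈ sh)
    (hle : ∀ s ∈ sh, s ≤ q) (hM : M' ≤ M) (hqM : q ≤ M')
    (hf : ∀ s ∈ sh, ∀ i < M', f (i + s) = f i) {t t' : ℕ} (ht : t < M' + q) (ht' : t' < M' + q)
    (h : t ≡ t' [MOD stride sh M]) : f t = f t' := by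
  rcases Nat.eq_zero_or_pos q with rfl | hq0
  -- All shifts vanish. The modulus is then the default `M ≥ M'`, so congruent indices are equal.
  · have : stride sh M = M := by
      unfold stride
      rw [if_pos]
      rw [Finset.gcd_eq_zero_iff]
      exact fun s hs => Nat.le_zero.1 (hle s hs)
    rw [this] at h
    rw [Nat.ModEq.eq_of_lt_of_lt h (by omega) (by omega)]
  · have hfmod : ∀ t, t < M' + q → f t = f (t % q) := by
      intro t
      induction t using Nat.strong_induction_on with
      | _ t ih =>
        intro ht
        by_cases htq : t < q
        · rw [Nat.mod_eq_of_lt htq]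
        · have h1 := hf q hq (t - q) (by omega)
          rw [Nat.sub_add_cancel (by omega)] at h1
          rw [h1, ih (t - q) (by omega) (by omega), ← Nat.mod_eq_sub_mod (by omega)]
    set F : ℕ → L := fun n => f (n % q) with hF
    have hper : ∀ s ∈ sh, ∀ n, F (n + s) = F n := by
      intro s hs n
      have h1 := Nat.mod_lt n hq0
      have h2 := hle s hs
      simp only [hF]
      rw [← hf s hs (n % q) (by omega), hfmod (n % q + s) (by omega), Nat.mod_add_mod]
    have hgcd : ∀ s : Finset ℕ, s ⊆ sh → ∀ n, F (n + s.gcd id) = F n := by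
      intro s
      induction s using Finset.induction_on with
      | empty => simp
      | insert a s _ ih =>
        intro hs
        rw [Finset.gcd_insert]
        exact periodic_gcd (hper a (hs (Finset.mem_insert_self a s)))
          (ih (fun x hx => hs (Finset.mem_insert_of_mem hx)))
    have hg := hgcd sh le_rfl
    rw [stride_eq_gcd hq hq0.ne'] at h
    have hmod : ∀ n, F n = F (n % sh.gcd id) := by
      intro n
      exact (Function.Periodic.map_mod_nat hg n).symm
    rw [hfmod t ht, hfmod t' ht']
    change F t = F t'
    rw [hmod t, hmod t', h]

end Stride

/-! ### Arcs of residues and covers of small multiplicity. -/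

section Arcs

/-- The residues modulo `g` of the integers strictly between `u` and `v`. -/
def arc (g u v : ℕ) : Finset ℕ := (Finset.Ioo u v).image (· % g)

theorem exists_maximum {β : Type*} {p : β → Prop} (h : ∃ b, p b) (f : β → ℕ) {K : ℕ}
    (hK : ∀ b, p b → f b ≤ K) : ∃ b, p b ∧ ∀ c, p c → f c ≤ f b := by
  have hne : (f '' {b | p b}).Nonempty := by
    obtain ⟨b, hb⟩ := h
    exact ⟨_, b, hb, rfl⟩
  have hbd : BddAbove (f '' {b | p b}) := ⟨K, by rintro _ ⟨b, hb, rfl⟩; exact hK b hb⟩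
  obtain ⟨b, hb, hb'⟩ := Nat.sSup_mem hne hbd
  exact ⟨b, hb, fun c hc => by rw [hb']; exact le_csSup hbd ⟨c, hc, rfl⟩⟩

/-- Of a family of arcs, few suffice to cover what all of them cover. -/
theorem exists_subcover (g : ℕ) (C : Finset (Finset ℕ))
    (hC : ∀ A ∈ C, ∃ u v, A = arc g u v) :
    ∃ F ⊆ C, F.biUnion id = C.biUnion id ∧ ∀ p, (F.filter (p ∈ ·)).card ≤ 2 := by
  classical
  -- A subfamily of least cardinality with the same union works.
  have hne : (C.powerset.filter (fun F => F.biUnion id = C.biUnion id)).Nonempty :=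
    ⟨C, by simp⟩
  obtain ⟨F, hF, hmin⟩ := Finset.exists_min_image _ Finset.card hne
  simp only [Finset.mem_filter, Finset.mem_powerset] at hF hmin
  refine ⟨F, hF.1, hF.2, fun p => ?_⟩
  by_contra! hcard
  have hrep : ∀ A ∈ F.filter (p ∈ ·), ∃ u v e, A = arc g u v ∧ u < e ∧ e < v ∧ e % g = p := by
    intro A hA
    rw [Finset.mem_filter] at hA
    obtain ⟨u, v, rfl⟩ := hC A (hF.1 hA.1)
    have := hA.2
    simp only [arc, Finset.mem_image, Finset.mem_Ioo] at this
    obtain ⟨e, he, he'⟩ := this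
    exact ⟨u, v, e, rfl, he.1, he.2, he'⟩
  choose! u v e hrep1 hrep2 hrep3 hrep4 using hrep
  have hne : (F.filter (p ∈ ·)).Nonempty := Finset.card_pos.1 (by omega)
  -- Among the arcs through `p`, `A` reaches furthest back from its representative `e` of `p` and
  -- `B` furthest forward. A third arc `D` through `p` is covered by these two and could be dropped.
  obtain ⟨A, hA, hAmax⟩ := Finset.exists_max_image _ (fun A => e A - u A) hne
  obtain ⟨B, hB, hBmax⟩ := Finset.exists_max_image _ (fun A => v A - e A) hne
  obtain ⟨D, hD, hDAB⟩ : ∃ D ∈ F.filter (p ∈ ·), D ∉ ({A, B} : Finset (Finset ℕ)) := by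
    by_contra! h
    have h1 := Finset.card_le_card (fun D hD => h D hD : F.filter (p ∈ ·) ⊆ {A, B})
    have h2 : ({A, B} : Finset (Finset ℕ)).card ≤ 2 := Finset.card_le_two
    omega
  simp only [Finset.mem_insert, Finset.mem_singleton, not_or] at hDAB
  have hsub : D ⊆ A ∪ B := by
    intro z hz
    rw [hrep1 D hD] at hz
    simp only [arc, Finset.mem_image, Finset.mem_Ioo] at hz
    obtain ⟨z, ⟨hz1, hz2⟩, rfl⟩ := hz
    have hA1 := hAmax D hD
    have hB1 := hBmax D hD
    have hA2 := hrep2 A hA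
    have hA3 := hrep3 A hA
    have hB2 := hrep2 B hB
    have hB3 := hrep3 B hB
    have hD2 := hrep2 D hD
    have hD3 := hrep3 D hD
    have hAD : e A ≡ e D [MOD g] := (hrep4 A hA).trans (hrep4 D hD).symm
    have hBD : e B ≡ e D [MOD g] := (hrep4 B hB).trans (hrep4 D hD).symm
    rw [Finset.mem_union]
    by_cases hze : z ≤ e D
    · left
      rw [hrep1 A hA]
      simp only [arc, Finset.mem_image, Finset.mem_Ioo]
      refine ⟨e A - (e D - z), by omega, ?_⟩
      have : e A - (e D - z) + e D = z + e A := by omega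
      have h2 : e A - (e D - z) + e A ≡ e A - (e D - z) + e D [MOD g] := hAD.add_left _
      rw [this] at h2
      exact Nat.ModEq.add_right_cancel' (e A) h2
    · right
      rw [hrep1 B hB]
      simp only [arc, Finset.mem_image, Finset.mem_Ioo]
      refine ⟨e B + (z - e D), by omega, ?_⟩
      have h2 : e B + (z - e D) ≡ e D + (z - e D) [MOD g] := hBD.add_right _
      rw [show e D + (z - e D) = z by omega] at h2
      exact h2
  rw [Finset.mem_filter] at hA hB hD
  have hErase : (F.erase D).biUnion id = C.biUnion id := by
    rw [← hF.2]
    ext z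
    simp only [Finset.mem_biUnion, Finset.mem_erase, id]
    constructor
    · rintro ⟨E, ⟨_, hE⟩, hz⟩
      exact ⟨E, hE, hz⟩
    · rintro ⟨E, hE, hz⟩
      by_cases hED : E = D
      · subst hED
        rcases Finset.mem_union.1 (hsub hz) with hz | hz
        · exact ⟨A, ⟨fun h => hDAB.1 h.symm, hA.1⟩, hz⟩
        · exact ⟨B, ⟨fun h => hDAB.2 h.symm, hB.1⟩, hz⟩
      · exact ⟨E, ⟨hED, hE⟩, hz⟩
  have h3 := hmin (F.erase D) ⟨(Finset.erase_subset _ _).trans hF.1, hErase⟩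
  have h4 := Finset.card_erase_lt_of_mem hD.1
  omega

theorem sum_sum_le_of_multiplicity {F : Finset (Finset ℕ)} {U : Finset ℕ} (w : ℕ → ℕ) {d : ℕ}
    (hU : ∀ A ∈ F, A ⊆ U) (hd : ∀ p, (F.filter (p ∈ ·)).card ≤ d) :
    ∑ A ∈ F, ∑ c ∈ A, w c ≤ d * ∑ c ∈ U, w c := by
  classical
  have h1 : ∑ A ∈ F, ∑ c ∈ A, w c = ∑ c ∈ U, ∑ A ∈ F.filter (c ∈ ·), w c := by
    apply Finset.sum_comm'
    intro A c
    simp only [Finset.mem_filter]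
    exact ⟨fun h => ⟨⟨h.1, h.2⟩, hU A h.1 h.2⟩, fun h => h.1⟩
  rw [h1, Finset.mul_sum]
  refine Finset.sum_le_sum fun c _ => ?_
  rw [Finset.sum_const, smul_eq_mul]
  exact Nat.mul_le_mul_right _ (hd c)

/-- The open interval contains at most `g` integers, so no residue occurs twice. -/
theorem sum_arc {g u v : ℕ} (h : v ≤ u + g + 1) (w : ℕ → ℕ) :
    ∑ c ∈ arc g u v, w c = ∑ h ∈ Finset.Ioo u v, w (h % g) := by
  unfold arc
  rw [Finset.sum_image]
  intro a ha b hb hab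
  simp only [Finset.coe_Ioo, Set.mem_Ioo] at ha hb
  have hab : a ≡ b [MOD g] := hab
  rcases le_total a b with hle | hle
  · have h1 := (Nat.modEq_iff_dvd' hle).1 hab
    have h2 := Nat.eq_zero_of_dvd_of_lt h1 (by omega)
    omega
  · have h1 := (Nat.modEq_iff_dvd' hle).1 hab.symm
    have h2 := Nat.eq_zero_of_dvd_of_lt h1 (by omega)
    omega

theorem sum_range_succ_mod (g : ℕ) (w : ℕ → ℕ) :
    ∑ c ∈ Finset.range g, w ((c + 1) % g) = ∑ c ∈ Finset.range g, w c := by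
  cases g with
  | zero => simp
  | succ g =>
    rw [Finset.sum_range_succ, Nat.mod_self, Finset.sum_range_succ' w]
    congr 1
    refine Finset.sum_congr rfl fun c hc => ?_
    rw [Nat.mod_eq_of_lt (by simpa using hc)]

end Arcs

/-! ### Propagation along chains, and counting by fibres and by levels. -/

/-- Along a strictly increasing partial map without fixed points, knowledge that propagates
backwards reaches every index. -/
theorem forall_of_chain {K : ℕ → Prop} {R : ℕ → ℕ → Prop} {u v : ℕ}
    (hR : ∀ i j i' j', R i i' → R j j' → i < j → i' < j')
    (h : ∀ i, u ≤ i → i < v → K i ∨ ∃ i', u ≤ i' ∧ i' < v ∧ i' ≠ i ∧ R i i' ∧ (K i' → K i)) :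
    ∀ i, u ≤ i → i < v → K i := by
  -- Once a chain steps down, monotonicity of `R` makes it continue downwards, and it must end at a
  -- known index before leaving `[u, v)`; `up` is the mirror image.
  have down : ∀ i, u ≤ i → i < v → ∀ i', u ≤ i' → i' < i → R i i' → (K i' → K i) → K i := by
    intro i
    induction i using Nat.strong_induction_on with
    | _ i ih =>
      intro h1 h2 i' h3 h4 h5 h6
      apply h6
      rcases h i' h3 (by omega) with h7 | ⟨i'', a1, a2, a3, a4, a5⟩
      · exact h7
      · exact ih i' h4 h3 (by omega) i'' a1 (hR _ _ _ _ a4 h5 h4) a4 a5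
  have up : ∀ d i, v - i = d → u ≤ i → i < v → ∀ i', i' < v → i < i' → R i i' →
      (K i' → K i) → K i := by
    intro d
    induction d using Nat.strong_induction_on with
    | _ d ih =>
      intro i hd h1 h2 i' h3 h4 h5 h6
      apply h6
      rcases h i' (by omega) h3 with h7 | ⟨i'', a1, a2, a3, a4, a5⟩
      · exact h7
      · exact ih (v - i') (by omega) i' rfl (by omega) h3 i'' a2 (hR _ _ _ _ h5 a4 h4) a4 a5
  intro i h1 h2
  rcases h i h1 h2 with h3 | ⟨i', a1, a2, a3, a4, a5⟩
  · exact h3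
  · rcases Nat.lt_or_gt_of_ne a3 with h4 | h4
    · exact down i h1 h2 i' a1 h4 a4 a5
    · exact up _ i rfl h1 h2 i' a2 h4 a4 a5

theorem sum_countP_fiber {β : Type*} (l : List β) (p : β → Prop) [DecidablePred p] (r : β → ℕ)
    (U : Finset ℕ) :
    ∑ u ∈ U, l.countP (fun a => decide (p a ∧ r a = u)) =
      l.countP (fun a => decide (p a ∧ r a ∈ U)) := by
  induction l with
  | nil => simp
  | cons a l ih =>
    simp only [List.countP_cons, Finset.sum_add_distrib, ih]
    congr 1
    by_cases ha : p a <;> simp [ha, Finset.sum_ite_eq]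

/-- A function on the vertices of a graph that changes along each edge by at most the weight of the
edge grows along a connected component by at most the sum of the weights. -/
theorem le_sum_of_levels {E : Type*} (s : Finset E) (wt lo hi : E → ℕ)
    (hE : ∀ e ∈ s, lo e ≤ hi e + wt e ∧ hi e ≤ lo e + wt e) {d : ℕ}
    (h : ∀ l, 1 ≤ l → l ≤ d → ∃ e ∈ s, ¬ (l ≤ lo e ↔ l ≤ hi e)) : d ≤ ∑ e ∈ s, wt e := by
  classical
  -- Each level from `1` to `d` is crossed by an edge, and an edge `e` crosses at most `wt e`
  -- levels.
  have h1 : Finset.Icc 1 d ⊆ s.biUnion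
      (fun e => Finset.Ioc (min (lo e) (hi e)) (max (lo e) (hi e))) := by
    intro l hl
    rw [Finset.mem_Icc] at hl
    obtain ⟨e, he, hne⟩ := h l hl.1 hl.2
    rw [Finset.mem_biUnion]
    refine ⟨e, he, ?_⟩
    rw [Finset.mem_Ioc]
    omega
  have h2 := (Finset.card_le_card h1).trans Finset.card_biUnion_le
  simp only [Nat.card_Icc, Nat.card_Ioc] at h2
  refine (by omega : d ≤ d + 1 - 1).trans (h2.trans (Finset.sum_le_sum fun e he => ?_))
  have := hE e he
  omega

open Classical in
theorem exists_of_lt_count {p : ℕ → Prop} {i n : ℕ} (h : i < Nat.count p n) :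
    ∃ x < n, p x ∧ Nat.count p x = i := by
  induction n with
  | zero => simp at h
  | succ n ih =>
    rw [Nat.count_succ] at h
    by_cases h' : i < Nat.count p n
    · obtain ⟨x, hx, h⟩ := ih h'
      exact ⟨x, by omega, h⟩
    · by_cases hp : p n
      · rw [if_pos hp] at h
        exact ⟨n, by omega, hp, by omega⟩
      · rw [if_neg hp] at h
        omega

/-! ### Black characters, their ranks, and alignments as shifts of ranks. -/

section Black

variable {α : Type u}

/-- The row in which a sequence of points starts. -/
def start (A : List (ℕ × ℕ)) : ℕ := (A.headD (0, 0)).2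

/-- The row in which a sequence of points ends. -/
def finish (A : List (ℕ × ℕ)) : ℕ := (A.getLastD (0, 0)).2

theorem Route.start_finish {p q : ℕ × ℕ} {A : List (ℕ × ℕ)} (h : Route p q A) :
    start A = p.2 ∧ finish A = q.2 := by
  obtain ⟨h1, h2, _⟩ := h.isChain
  simp [start, finish, List.headD_eq_head?_getD, List.getLastD_eq_getLast?, h1, h2]

variable (P T : List α) (k lo hi : ℕ) (S : Finset (List (ℕ × ℕ)))

/-- `A` is an alignment of cost at most `k` of `P` onto a fragment of `T[lo..hi)`. -/
structure Fits (A : List (ℕ × ℕ)) : Prop where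
  route : Route (0, start A) (P.length, finish A) A
  lo_le : lo ≤ start A
  le_hi : finish A ≤ hi
  cost_le : cost P T A ≤ k

/-- The characters of `P` (left) and of `T` (right) that the alignments in `S` connect
to an edited character. -/
inductive Red : ℕ ⊕ ℕ → Prop
  | pat {A s} : A ∈ S → s ∈ steps A → IsEdit P T s → s.2.1 = s.1.1 + 1 → Red (.inl s.1.1)
  | text {A s} : A ∈ S → s ∈ steps A → IsEdit P T s → s.2.2 = s.1.2 + 1 → Red (.inr s.1.2)
  | toText {A x y} : A ∈ S → Matched P T A x y → Red (.inl x) → Red (.inr y)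
  | toPat {A x y} : A ∈ S → Matched P T A x y → Red (.inr y) → Red (.inl x)

theorem Red.mono {S S' : Finset (List (ℕ × ℕ))} (h : S ⊆ S') {v : ℕ ⊕ ℕ} (hv : Red P T S v) :
    Red P T S' v := by
  induction hv with
  | pat h1 h2 h3 h4 => exact .pat (h h1) h2 h3 h4
  | text h1 h2 h3 h4 => exact .text (h h1) h2 h3 h4
  | toText h1 h2 _ ih => exact .toText (h h1) h2 ih
  | toPat h1 h2 _ ih => exact .toPat (h h1) h2 ih

def BlackP (x : ℕ) : Prop := x < P.length ∧ ¬ Red P T S (.inl x)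

def BlackT (y : ℕ) : Prop := lo ≤ y ∧ y < hi ∧ ¬ Red P T S (.inr y)

open Classical in
/-- The number of black characters of `P` before position `x`. -/
noncomputable def rankP (x : ℕ) : ℕ := Nat.count (BlackP P T S) x

open Classical in
/-- The number of black characters of `T` before position `y`. -/
noncomputable def rankT (y : ℕ) : ℕ := Nat.count (BlackT P T lo hi S) y

/-- The position of the black character of `P` of rank `i`. -/
noncomputable def posP (i : ℕ) : ℕ := Nat.nth (BlackP P T S) i

/-- The position of the black character of `T` of rank `t`. -/
noncomputable def posT (t : ℕ) : ℕ := Nat.nth (BlackT P T lo hi S) t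

/-- The number of black characters of `P`. -/
noncomputable def sizeP : ℕ := rankP P T S P.length

/-- The number of black characters of `T`. -/
noncomputable def sizeT : ℕ := rankT P T lo hi S hi

/-- The rank of the first black character of `T` that an alignment reaches. -/
noncomputable def shift (A : List (ℕ × ℕ)) : ℕ := rankT P T lo hi S (start A)

/-- The period of the black characters. -/
noncomputable def period : ℕ := stride (S.image (shift P T lo hi S)) (sizeP P T S)

/-- The alignments in `S` cover `T[lo..hi)`. -/
structure Enclosing : Prop where
  hi_le : hi ≤ T.length
  fits : ∀ A ∈ S, Fits P T k lo hi A
  pref : ∃ A ∈ S, start A = lo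
  suff : ∃ A ∈ S, finish A = hi
  -- This is the numerical condition needed for `Enclosing.sizeT_lt`; it leaves room for two
  -- alignments whose lengths and drifts are off by up to `k`.
  size : 2 * hi + 5 * k ≤ 3 * P.length + 2 * lo

variable {P T k lo hi S}

theorem rankP_mono {x x' : ℕ} (h : x ≤ x') : rankP P T S x ≤ rankP P T S x' := by
  classical exact Nat.count_monotone _ h

theorem rankT_mono {y y' : ℕ} (h : y ≤ y') : rankT P T lo hi S y ≤ rankT P T lo hi S y' := by
  classical exact Nat.count_monotone _ h

theorem rankP_succ_of_black {x : ℕ} (h : BlackP P T S x) :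
    rankP P T S (x + 1) = rankP P T S x + 1 := by
  simp [rankP, Nat.count_succ, h]

theorem rankP_succ_of_not {x : ℕ} (h : ¬ BlackP P T S x) :
    rankP P T S (x + 1) = rankP P T S x := by
  simp [rankP, Nat.count_succ, h]

theorem rankT_succ_of_black {y : ℕ} (h : BlackT P T lo hi S y) :
    rankT P T lo hi S (y + 1) = rankT P T lo hi S y + 1 := by
  simp [rankT, Nat.count_succ, h]

theorem rankT_succ_of_not {y : ℕ} (h : ¬ BlackT P T lo hi S y) :
    rankT P T lo hi S (y + 1) = rankT P T lo hi S y := by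
  simp [rankT, Nat.count_succ, h]

@[simp] theorem rankP_zero : rankP P T S 0 = 0 := by simp [rankP]

theorem rankT_lo : rankT P T lo hi S lo = 0 := by
  classical
  by_contra h
  obtain ⟨x, hx, h', _⟩ := exists_of_lt_count (p := BlackT P T lo hi S) (Nat.pos_of_ne_zero h)
  exact absurd h'.1 (by omega)

theorem rankP_lt {x x' : ℕ} (h : BlackP P T S x) (h' : x < x') :
    rankP P T S x < rankP P T S x' := by
  have := rankP_succ_of_black h
  have := rankP_mono (P := P) (T := T) (S := S) (show x + 1 ≤ x' from h')
  omega

theorem rankT_lt {y y' : ℕ} (h : BlackT P T lo hi S y) (h' : y < y') :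
    rankT P T lo hi S y < rankT P T lo hi S y' := by
  have := rankT_succ_of_black h
  have := rankT_mono (P := P) (T := T) (S := S) (lo := lo) (hi := hi) (show y + 1 ≤ y' from h')
  omega

theorem rankP_lt_size {x : ℕ} (h : BlackP P T S x) : rankP P T S x < sizeP P T S :=
  rankP_lt h h.1

theorem rankT_lt_size {y : ℕ} (h : BlackT P T lo hi S y) :
    rankT P T lo hi S y < sizeT P T lo hi S :=
  rankT_lt h h.2.1

theorem posP_rankP {x : ℕ} (h : BlackP P T S x) : posP P T S (rankP P T S x) = x := by
  classical exact Nat.nth_count h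

theorem posT_rankT {y : ℕ} (h : BlackT P T lo hi S y) :
    posT P T lo hi S (rankT P T lo hi S y) = y := by
  classical exact Nat.nth_count h

theorem posP_spec {i : ℕ} (h : i < sizeP P T S) :
    BlackP P T S (posP P T S i) ∧ rankP P T S (posP P T S i) = i := by
  classical
  obtain ⟨x, -, h1, h2⟩ := exists_of_lt_count h
  have h2 : rankP P T S x = i := h2
  rw [← h2, posP_rankP h1]
  exact ⟨h1, rfl⟩

theorem posT_spec {t : ℕ} (h : t < sizeT P T lo hi S) :
    BlackT P T lo hi S (posT P T lo hi S t) ∧ rankT P T lo hi S (posT P T lo hi S t) = t := by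
  classical
  obtain ⟨x, -, h1, h2⟩ := exists_of_lt_count h
  have h2 : rankT P T lo hi S x = t := h2
  rw [← h2, posT_rankT h1]
  exact ⟨h1, rfl⟩

theorem posP_lt {i i' : ℕ} (h : i < i') (h' : i' < sizeP P T S) :
    posP P T S i < posP P T S i' := by
  by_contra! h1
  have h2 := rankP_mono (P := P) (T := T) (S := S) h1
  rw [(posP_spec h').2, (posP_spec (h.trans h')).2] at h2
  omega

theorem posT_lt {t t' : ℕ} (h : t < t') (h' : t' < sizeT P T lo hi S) :
    posT P T lo hi S t < posT P T lo hi S t' := by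
  by_contra! h1
  have h2 := rankT_mono (P := P) (T := T) (S := S) (lo := lo) (hi := hi) h1
  rw [(posT_spec h').2, (posT_spec (h.trans h')).2] at h2
  omega

theorem Fits.matched_bounds {A : List (ℕ × ℕ)} (hA : Fits P T k lo hi A) {x y : ℕ}
    (h : Matched P T A x y) : x < P.length ∧ lo ≤ y ∧ y < hi := by
  have h1 := hA.route.bounds h.1
  have h2 := hA.lo_le
  have h3 := hA.le_hi
  simp only at h1
  omega

theorem Fits.blackP_iff {A : List (ℕ × ℕ)} (hA : Fits P T k lo hi A) (hAS : A ∈ S) {x y : ℕ}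
    (h : Matched P T A x y) : BlackP P T S x ↔ BlackT P T lo hi S y := by
  have hb := hA.matched_bounds h
  simp only [BlackP, BlackT, hb, true_and]
  exact not_congr ⟨fun h' => .toText hAS h h', fun h' => .toPat hAS h h'⟩

/-- Matches join black to black and edited characters are red, so the two ranks always advance
together. Hence their difference is constant along the alignment and equals its `shift`. -/
theorem Fits.rank_step {A : List (ℕ × ℕ)} (hA : Fits P T k lo hi A) (hAS : A ∈ S)
    {s : (ℕ × ℕ) × (ℕ × ℕ)} (hs : s ∈ steps A) :
    rankT P T lo hi S s.2.2 + rankP P T S s.1.1 =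
      rankT P T lo hi S s.1.2 + rankP P T S s.2.1 := by
  rcases isEdit_or_eq (X := P) (Y := T) (hA.route.step_of_mem hs) with h | ⟨_, h1, h2⟩
  · have hP : s.2.1 = s.1.1 + 1 → ¬ BlackP P T S s.1.1 :=
      fun h' hb => hb.2 (.pat hAS hs h h')
    have hT : s.2.2 = s.1.2 + 1 → ¬ BlackT P T lo hi S s.1.2 :=
      fun h' hb => hb.2.2 (.text hAS hs h h')
    rcases hA.route.step_of_mem hs with h' | h' | h' <;> simp only [h', true_implies] at hP hT ⊢
    · rw [rankP_succ_of_not hP, rankT_succ_of_not hT]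
    · rw [rankP_succ_of_not hP]
    · rw [rankT_succ_of_not hT]
  · obtain ⟨⟨x, y⟩, t⟩ := s
    simp only at h1 h2
    subst h1
    have hm : Matched P T A x y := ⟨hs, h2⟩
    simp only
    by_cases hb : BlackP P T S x
    · rw [rankP_succ_of_black hb, rankT_succ_of_black ((hA.blackP_iff hAS hm).1 hb)]
      omega
    · rw [rankP_succ_of_not hb, rankT_succ_of_not (mt (hA.blackP_iff hAS hm).2 hb)]

theorem Fits.rank_inv {A : List (ℕ × ℕ)} (hA : Fits P T k lo hi A) (hAS : A ∈ S) :
    rankT P T lo hi S (finish A) = sizeP P T S + shift P T lo hi S A ∧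
    ∀ s ∈ steps A, rankT P T lo hi S s.1.2 = rankP P T S s.1.1 + shift P T lo hi S A ∧
      rankT P T lo hi S s.2.2 = rankP P T S s.2.1 + shift P T lo hi S A :=
  hA.route.invariant (I := fun p => rankT P T lo hi S p.2 = rankP P T S p.1 + shift P T lo hi S A)
    (by simp [shift]) (fun s hs h => by
      have := hA.rank_step hAS hs
      omega)

theorem Fits.matched_of_blackP {A : List (ℕ × ℕ)} (hA : Fits P T k lo hi A) (hAS : A ∈ S)
    {x : ℕ} (hx : BlackP P T S x) :
    ∃ y, Matched P T A x y ∧ BlackT P T lo hi S y ∧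
      rankT P T lo hi S y = rankP P T S x + shift P T lo hi S A := by
  rcases hA.route.matched_or_edit_fst (X := P) (Y := T) (Nat.zero_le x) hx.1 with
    ⟨y, hy⟩ | ⟨s, hs, h1, h2, h3⟩
  · exact ⟨y, hy, (hA.blackP_iff hAS hy).1 hx, ((hA.rank_inv hAS).2 _ hy.1).1⟩
  · subst h2
    exact absurd (.pat hAS hs h1 h3) hx.2

theorem Fits.matched_pos {A : List (ℕ × ℕ)} (hA : Fits P T k lo hi A) (hAS : A ∈ S)
    {i : ℕ} (hi' : i < sizeP P T S) :
    i + shift P T lo hi S A < sizeT P T lo hi S ∧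
      Matched P T A (posP P T S i) (posT P T lo hi S (i + shift P T lo hi S A)) := by
  obtain ⟨h1, h2⟩ := posP_spec hi'
  obtain ⟨y, hy, hb, hr⟩ := hA.matched_of_blackP hAS h1
  rw [h2] at hr
  rw [← hr, posT_rankT hb]
  exact ⟨rankT_lt_size hb, hy⟩

/-- The distance from an alignment's start of two of its rows and columns differs by at most `k`. -/
theorem Fits.drift {A : List (ℕ × ℕ)} (hA : Fits P T k lo hi A) {s : (ℕ × ℕ) × (ℕ × ℕ)}
    (hs : s ∈ steps A) : s.1.1 + start A ≤ s.1.2 + k ∧ s.1.2 ≤ s.1.1 + start A + k := by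
  obtain ⟨A₁, A₂, h1, h2, h3⟩ := hA.route.split hs
  have h4 := h1.length_diff_le (X := P) (Y := T)
  have h5 := h1.le
  have h6 := hA.cost_le
  rw [cost_eq_editCount, h3, editCount_append, ← cost_eq_editCount] at h6
  simp only at h4 h5
  omega

theorem Fits.length_diff {A : List (ℕ × ℕ)} (hA : Fits P T k lo hi A) :
    P.length + start A ≤ finish A + k ∧ finish A ≤ P.length + start A + k := by
  have h4 := hA.route.length_diff_le (X := P) (Y := T)
  have h5 := hA.route.le
  have h6 := hA.cost_le
  simp only at h4 h5
  omega

namespace Enclosing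

variable (h : Enclosing P T k lo hi S)

include h in
theorem shift_add_le {A : List (ℕ × ℕ)} (hA : A ∈ S) :
    shift P T lo hi S A + sizeP P T S ≤ sizeT P T lo hi S := by
  have h1 := ((h.fits A hA).rank_inv hA).1
  have h2 := rankT_mono (P := P) (T := T) (S := S) (lo := lo) (hi := hi) (h.fits A hA).le_hi
  unfold sizeT
  omega

include h in
theorem size_le : sizeP P T S ≤ sizeT P T lo hi S := by
  obtain ⟨A, hA, _⟩ := h.pref
  have := h.shift_add_le hA
  omega

include h in
theorem zero_mem : ∃ A ∈ S, shift P T lo hi S A = 0 := by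
  obtain ⟨A, hA, h1⟩ := h.pref
  exact ⟨A, hA, by rw [shift, h1, rankT_lo]⟩

include h in
theorem last_mem : ∃ A ∈ S, shift P T lo hi S A = sizeT P T lo hi S - sizeP P T S := by
  obtain ⟨A, hA, h1⟩ := h.suff
  have h2 := ((h.fits A hA).rank_inv hA).1
  rw [h1] at h2
  exact ⟨A, hA, by unfold sizeT; omega⟩

include h in
-- Otherwise the leftmost alignment `A` matches the first black character of `P` before the start of
-- the rightmost `B`, while `B` matches it after the end of `A`. The drift bounds for these two
-- matches then contradict `size`. The strict bound puts the largest shift below the number of black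
-- characters of `P`, as periodicity requires.
theorem sizeT_lt (hM : 0 < sizeP P T S) : sizeT P T lo hi S < 2 * sizeP P T S := by
  obtain ⟨A, hA, hA1⟩ := h.pref
  obtain ⟨B, hB, hB1⟩ := h.suff
  have hAf := h.fits A hA
  have hBf := h.fits B hB
  have a1 := (hAf.rank_inv hA).1
  have b1 := (hBf.rank_inv hB).1
  rw [shift, hA1, rankT_lo] at a1
  rw [hB1, shift] at b1
  have a2 := hAf.length_diff
  have b2 := hBf.length_diff
  have hsz := h.size
  have hle : start B ≤ finish A := by omega
  have h3 := rankT_mono (P := P) (T := T) (S := S) (lo := lo) (hi := hi) hle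
  have h4 : sizeT P T lo hi S = rankT P T lo hi S hi := rfl
  by_contra! hcon
  obtain ⟨hx, -⟩ := posP_spec hM
  generalize posP P T S 0 = x at hx
  obtain ⟨y, hy, hyb, -⟩ := hAf.matched_of_blackP hA hx
  obtain ⟨z, hz, hzb, -⟩ := hBf.matched_of_blackP hB hx
  have d1 := hAf.drift hy.1
  have d2 := hBf.drift hz.1
  have e1 := (hAf.route.bounds hy.1).2
  have e2 := (hBf.route.bounds hz.1).1
  simp only at d1 d2 e1 e2
  have hy' : y < start B := by
    by_contra! hc
    have h5 := rankT_mono (P := P) (T := T) (S := S) (lo := lo) (hi := hi) hc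
    have h6 := rankT_lt hyb (show y < finish A by omega)
    omega
  have hz' : finish A ≤ z := by
    by_contra! hc
    have h5 := rankT_mono (P := P) (T := T) (S := S) (lo := lo) (hi := hi) e2.2
    have h6 := rankT_lt hzb hc
    omega
  omega

include h in
theorem covers {y : ℕ} (h1 : lo ≤ y) (h2 : y < hi) : ∃ A ∈ S, start A ≤ y ∧ y < finish A := by
  obtain ⟨A, hA, hA1⟩ := h.pref
  obtain ⟨B, hB, hB1⟩ := h.suff
  have a2 := (h.fits A hA).length_diff
  have b2 := (h.fits B hB).length_diff
  have hsz := h.size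
  by_cases hy : y < finish A
  · exact ⟨A, hA, by omega, hy⟩
  · exact ⟨B, hB, by omega, by omega⟩

include h in
theorem sizeT_eq_zero (h0 : sizeP P T S = 0) : sizeT P T lo hi S = 0 := by
  by_contra hc
  obtain ⟨hb, -⟩ := posT_spec (Nat.pos_of_ne_zero hc)
  generalize posT P T lo hi S 0 = y at hb
  obtain ⟨B, hB, h1, h2⟩ := h.covers hb.1 hb.2.1
  rcases (h.fits B hB).route.matched_or_edit_snd (X := P) (Y := T) h1 h2 with
    ⟨x, hx⟩ | ⟨s, hs, s1, s2, s3⟩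
  · have := rankP_lt_size (((h.fits B hB).blackP_iff hB hx).2 hb)
    omega
  · subst s2
    exact hb.2.2 (.text hB hs s1 s3)

include h in
theorem period_le : period P T lo hi S ≤ sizeP P T S := by
  apply stride_le
  intro s hs
  obtain ⟨A, hA, rfl⟩ := Finset.mem_image.1 hs
  have h1 := h.shift_add_le hA
  rcases Nat.eq_zero_or_pos (sizeP P T S) with h0 | h0
  · have := h.sizeT_eq_zero h0
    omega
  · have := h.sizeT_lt h0
    omega

theorem period_pos (hM : 0 < sizeP P T S) : 0 < period P T lo hi S := stride_pos hM

theorem period_dvd {A : List (ℕ × ℕ)} (hA : A ∈ S) :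
    period P T lo hi S ∣ shift P T lo hi S A :=
  stride_dvd (Finset.mem_image_of_mem _ hA)

include h in
/-- An indexed labelling that agrees along the alignments in `S` is periodic. -/
theorem label_eq {L : Type*} {fP fT : ℕ → L} {M' : ℕ} (hM' : M' ≤ sizeP P T S)
    (hqM : sizeT P T lo hi S - sizeP P T S ≤ M')
    (hf : ∀ A ∈ S, ∀ i < M', fT (i + shift P T lo hi S A) = fP i) {i t : ℕ} (hi' : i < M')
    (ht : t < M' + (sizeT P T lo hi S - sizeP P T S)) (hit : i % period P T lo hi S =
      t % period P T lo hi S) : fP i = fT t := by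
  obtain ⟨A, hA, h0⟩ := h.zero_mem
  obtain ⟨B, hB, hq⟩ := h.last_mem
  have h1 := hf A hA i hi'
  rw [h0, Nat.add_zero] at h1
  rw [← h1]
  refine label_eq_of_modEq (sh := S.image (shift P T lo hi S)) (M := sizeP P T S)
    (Finset.mem_image.2 ⟨B, hB, hq⟩) ?_ hM' hqM ?_ (by omega) ht hit
  · intro s hs
    obtain ⟨C, hC, rfl⟩ := Finset.mem_image.1 hs
    have := h.shift_add_le hC
    omega
  · intro s hs i hi
    obtain ⟨C, hC, rfl⟩ := Finset.mem_image.1 hs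
    have := hf A hA i hi
    rw [h0, Nat.add_zero] at this
    rw [this, hf C hC i hi]

include h in
/-- A labelling of characters that agrees along the alignments in `S` is periodic. -/
theorem label_pos_eq {L : Type*} {fP fT : ℕ → L}
    (hf : ∀ A ∈ S, ∀ x y, Matched P T A x y → BlackP P T S x → fT y = fP x) {i t : ℕ}
    (hi' : i < sizeP P T S) (ht : t < sizeT P T lo hi S)
    (hit : i % period P T lo hi S = t % period P T lo hi S) :
    fP (posP P T S i) = fT (posT P T lo hi S t) := by
  have h1 := h.sizeT_lt (by omega)
  have h2 := h.size_le
  refine h.label_eq (fP := fun i => fP (posP P T S i)) (fT := fun t => fT (posT P T lo hi S t))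
    le_rfl (by omega) ?_ hi' (by omega) hit
  intro A hA i hi'
  exact hf A hA _ _ ((h.fits A hA).matched_pos hA hi').2 (posP_spec hi').1

include h in
theorem insert {A : List (ℕ × ℕ)} (hA : Fits P T k lo hi A) :
    Enclosing P T k lo hi (insert A S) where
  hi_le := h.hi_le
  fits := by
    intro B hB
    rcases Finset.mem_insert.1 hB with rfl | hB
    · exact hA
    · exact h.fits B hB
  pref := by
    obtain ⟨B, hB, h'⟩ := h.pref
    exact ⟨B, Finset.mem_insert_of_mem hB, h'⟩
  suff := by
    obtain ⟨B, hB, h'⟩ := h.suff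
    exact ⟨B, Finset.mem_insert_of_mem hB, h'⟩
  size := h.size

end Enclosing

end Black

/-! ### Enlarging `S`: either the classes are halved or a whole class is shared. -/

section Shared

variable {α : Type u} {P T : List α} {k lo hi : ℕ} {S S' : Finset (List (ℕ × ℕ))}

theorem BlackP.anti (h : S ⊆ S') {x : ℕ} (hx : BlackP P T S' x) : BlackP P T S x :=
  ⟨hx.1, fun h' => hx.2 (h'.mono _ _ h)⟩

theorem BlackT.anti (h : S ⊆ S') {y : ℕ} (hy : BlackT P T lo hi S' y) : BlackT P T lo hi S y :=
  ⟨hy.1, hy.2.1, fun h' => hy.2.2 (h'.mono _ _ h)⟩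

variable (P T lo hi S) in
/-- The number of classes of black characters. -/
noncomputable def classes : ℕ := if sizeP P T S = 0 then 0 else period P T lo hi S

namespace Enclosing

/-- Being black for the larger set is itself a labelling that the alignments in `S` preserve, so a
class survives or turns red as a whole. -/
theorem black_iff (h : Enclosing P T k lo hi S) (hS : S ⊆ S') {i t : ℕ} (hi' : i < sizeP P T S)
    (ht : t < sizeT P T lo hi S) (hit : i % period P T lo hi S = t % period P T lo hi S) :
    BlackP P T S' (posP P T S i) ↔ BlackT P T lo hi S' (posT P T lo hi S t) := by
  refine iff_of_eq (h.label_pos_eq (fP := BlackP P T S') (fT := BlackT P T lo hi S') ?_ hi' ht hit)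
  intro A hA x y hm _
  exact (propext ((h.fits A hA).blackP_iff (hS hA) hm)).symm

open Classical in
/-- The number of indices below `t` whose residue class stays black for `S'`. -/
noncomputable def kept (P T : List α) (lo hi : ℕ) (S S' : Finset (List (ℕ × ℕ))) (t : ℕ) : ℕ :=
  Nat.count (fun t => BlackP P T S' (posP P T S (t % period P T lo hi S))) t

theorem kept_mul_add (u t : ℕ) : kept P T lo hi S S' (u * period P T lo hi S + t) =
    kept P T lo hi S S' (u * period P T lo hi S) + kept P T lo hi S S' t := by
  classical
  unfold kept
  rw [Nat.count_add]
  simp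

theorem kept_mul (u : ℕ) : kept P T lo hi S S' (u * period P T lo hi S) =
    u * kept P T lo hi S S' (period P T lo hi S) := by
  induction u with
  | zero => simp [kept]
  | succ u ih => rw [Nat.succ_mul, kept_mul_add, ih, Nat.succ_mul]

theorem kept_inj {t t' : ℕ}
    (ht : BlackP P T S' (posP P T S (t % period P T lo hi S)))
    (ht' : BlackP P T S' (posP P T S (t' % period P T lo hi S)))
    (h : kept P T lo hi S S' t = kept P T lo hi S S' t') : t = t' := by
  classical exact Nat.count_injective ht ht' h

theorem blackT_iff_residue (h : Enclosing P T k lo hi S) (hS : S ⊆ S') (hM : 0 < sizeP P T S)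
    {y : ℕ} (hy : BlackT P T lo hi S y) : BlackT P T lo hi S' y ↔
      BlackP P T S' (posP P T S (rankT P T lo hi S y % period P T lo hi S)) := by
  have h1 := Nat.mod_lt (rankT P T lo hi S y)
    (period_pos (P := P) (T := T) (lo := lo) (hi := hi) hM)
  have := h.black_iff hS (h1.trans_le h.period_le) (rankT_lt_size hy) (Nat.mod_mod _ _)
  rw [posT_rankT hy] at this
  exact this.symm

theorem blackP_iff_residue (h : Enclosing P T k lo hi S) (hS : S ⊆ S') (hM : 0 < sizeP P T S)
    {x : ℕ} (hx : BlackP P T S x) : BlackP P T S' x ↔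
      BlackP P T S' (posP P T S (rankP P T S x % period P T lo hi S)) := by
  have h1 := Nat.mod_lt (rankP P T S x) (period_pos (P := P) (T := T) (lo := lo) (hi := hi) hM)
  have h2 := rankP_lt_size hx
  have h3 := h.black_iff hS (h1.trans_le h.period_le) (h2.trans_le h.size_le) (Nat.mod_mod _ _)
  have h4 := h.black_iff hS h2 (h2.trans_le h.size_le) rfl
  rw [posP_rankP hx] at h4
  exact h4.trans h3.symm

/-- Since classes survive as a whole, whether a rank survives depends only on its residue; new ranks
are therefore obtained by counting the old ranks with surviving residues. -/
theorem rankT_eq_kept (h : Enclosing P T k lo hi S) (hS : S ⊆ S') (hM : 0 < sizeP P T S) (y : ℕ) :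
    rankT P T lo hi S' y = kept P T lo hi S S' (rankT P T lo hi S y) := by
  classical
  induction y with
  | zero => simp [rankT, kept]
  | succ y ih =>
    by_cases hb : BlackT P T lo hi S y
    · rw [rankT_succ_of_black hb, kept, Nat.count_succ, ← h.blackT_iff_residue hS hM hb]
      change _ = kept P T lo hi S S' _ + _
      rw [← ih]
      by_cases hb' : BlackT P T lo hi S' y
      · rw [rankT_succ_of_black hb', if_pos hb']
      · rw [rankT_succ_of_not hb', if_neg hb']
        rfl
    · rw [rankT_succ_of_not hb, rankT_succ_of_not (fun hb' => hb (hb'.anti hS)), ih]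

theorem rankP_eq_kept (h : Enclosing P T k lo hi S) (hS : S ⊆ S') (hM : 0 < sizeP P T S) (x : ℕ) :
    rankP P T S' x = kept P T lo hi S S' (rankP P T S x) := by
  classical
  induction x with
  | zero => simp [rankP, kept]
  | succ y ih =>
    by_cases hb : BlackP P T S y
    · rw [rankP_succ_of_black hb, kept, Nat.count_succ, ← h.blackP_iff_residue hS hM hb]
      change _ = kept P T lo hi S S' _ + _
      rw [← ih]
      by_cases hb' : BlackP P T S' y
      · rw [rankP_succ_of_black hb', if_pos hb']
      · rw [rankP_succ_of_not hb', if_neg hb']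
        rfl
    · rw [rankP_succ_of_not hb, rankP_succ_of_not (fun hb' => hb (hb'.anti hS)), ih]

/-- An alignment that does not halve the number of classes agrees with a shift by a multiple of the
period on a whole class. -/
theorem exists_shared (h : Enclosing P T k lo hi S) {X : List (ℕ × ℕ)} (hX : Fits P T k lo hi X)
    (hM : 0 < sizeP P T S)
    (hsat : ¬ 2 * classes P T lo hi (Insert.insert X S) ≤ classes P T lo hi S) :
    ∃ j, ∃ c < period P T lo hi S, ∀ i < sizeP P T S, i % period P T lo hi S = c →
      i + j * period P T lo hi S < sizeT P T lo hi S ∧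
      Matched P T X (posP P T S i) (posT P T lo hi S (i + j * period P T lo hi S)) := by
  classical
  set S' := Insert.insert X S with hS'
  have hS : S ⊆ S' := Finset.subset_insert _ _
  have hXS : X ∈ S' := Finset.mem_insert_self _ _
  have h' : Enclosing P T k lo hi S' := h.insert hX
  have hM' : 0 < sizeP P T S' := by
    by_contra h0
    apply hsat
    simp [classes, show sizeP P T S' = 0 by omega]
  have hg := period_pos (P := P) (T := T) (lo := lo) (hi := hi) hM
  have hgM := h.period_le
  set g := period P T lo hi S with hgdef
  set κ := kept P T lo hi S S' with hκ
  obtain ⟨r, hr, hrK⟩ : ∃ r < g, BlackP P T S' (posP P T S r) := by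
    obtain ⟨hb, -⟩ := posP_spec hM'
    have hb' := hb.anti hS
    exact ⟨_, Nat.mod_lt _ hg, (h.blackP_iff_residue hS hM hb').1 hb⟩
  have hκg : 0 < κ g := by
    refine (Nat.zero_le (κ r)).trans_lt (Nat.count_strict_mono ?_ hr)
    rwa [Nat.mod_eq_of_lt hr]
  have hκle : κ g ≤ g := Nat.count_le _
  have hshift : ∀ A, shift P T lo hi S' A = κ (shift P T lo hi S A) := fun A =>
    h.rankT_eq_kept hS hM _
  have hsizeT : sizeT P T lo hi S' = κ (sizeT P T lo hi S) := h.rankT_eq_kept hS hM _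
  have hsizeP : sizeP P T S' = κ (sizeP P T S) := h.rankP_eq_kept hS hM _
  -- In the new ranks, `X` shifts by a multiple of `κ g`, the new length of one old period. If `P`
  -- and `T` have equally many black characters the new shift is zero; otherwise the new gcd `d` is
  -- compared with `κ g`.
  have hj : ∃ j, shift P T lo hi S' X = κ (j * g) := by
    rcases h.size_le.eq_or_lt with hq | hq
    · refine ⟨0, ?_⟩
      have := h'.shift_add_le hXS
      rw [hsizeT, hsizeP, ← hq] at this
      rw [Nat.zero_mul, show κ 0 = 0 by simp [hκ, kept]]
      omega
    · set d := (S'.image (shift P T lo hi S')).gcd id with hd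
      have hdvd : ∀ A ∈ S', d ∣ shift P T lo hi S' A := fun A hA =>
        Finset.gcd_dvd (f := id) (Finset.mem_image_of_mem _ hA)
      obtain ⟨B, hB, hBq⟩ := h.last_mem
      have hgq : g ≤ sizeT P T lo hi S - sizeP P T S := by
        rw [← hBq]
        exact Nat.le_of_dvd (by omega) (period_dvd hB)
      have h2 := h.sizeT_lt hM
      -- The label `κ t % d` is constant along `S`, because a shift by `u * g` adds `u * κ g`, a new
      -- shift and so a multiple of `d`. Comparing the ranks `0` and `g` gives `d ∣ κ g`.
      have h0 := h.label_eq (fP := fun t => κ t % d) (fT := fun t => κ t % d) le_rfl (by omega)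
        (i := 0) (t := g) ?_ hM (by omega) (by simp [g])
      · have hκ0 : κ 0 = 0 := by simp [hκ, kept]
        simp only [hκ0, Nat.zero_mod] at h0
        have hdg : d ∣ κ g := Nat.dvd_of_mod_eq_zero h0.symm
        have hd0 : d ≠ 0 := by
          intro h0
          rw [h0, zero_dvd_iff] at hdg
          omega
        have hcl' : classes P T lo hi S' = d := by
          rw [classes, if_neg hM'.ne', period, stride, if_neg hd0]
        have hcl : classes P T lo hi S = g := by rw [classes, if_neg hM.ne']
        rw [hcl', hcl] at hsat
        -- As the classes are not halved, `2 * d > g ≥ κ g`, and the only positive multiple of `d`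
        -- in this range is `d` itself.
        have hdκ : d = κ g := by
          obtain ⟨e, he⟩ := hdg
          rcases Nat.lt_or_ge e 2 with he2 | he2
          · interval_cases e
            · omega
            · omega
          · have := Nat.mul_le_mul_left d he2
            omega
        obtain ⟨j, hj⟩ := hdvd X hXS
        refine ⟨j, ?_⟩
        rw [hj, hκ, kept_mul, ← hκ, ← hdκ, Nat.mul_comm]
      · intro A hA i _
        obtain ⟨u, hu⟩ := period_dvd (P := P) (T := T) (lo := lo) (hi := hi) hA
        have h3 := hshift A
        rw [hu, Nat.mul_comm] at h3
        rw [hu, Nat.mul_comm, Nat.add_comm, hκ, kept_mul_add, ← hκ, ← h3]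
        obtain ⟨v, hv⟩ := hdvd A (hS hA)
        rw [hv, Nat.add_comm, Nat.add_mul_mod_self_left]
  obtain ⟨j, hj⟩ := hj
  refine ⟨j, r, hr, fun i hi' hir => ?_⟩
  obtain ⟨hb, hbi⟩ := posP_spec hi'
  have hb' : BlackP P T S' (posP P T S i) := by
    rw [h.blackP_iff_residue hS hM hb, hbi, ← hgdef, hir]
    exact hrK
  obtain ⟨y, hy, hyb, hyr⟩ := hX.matched_of_blackP hXS hb'
  have hyb' := hyb.anti hS
  rw [h.rankT_eq_kept hS hM, h.rankP_eq_kept hS hM, hbi, ← hκ, hj, Nat.add_comm, hκ,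
    ← kept_mul_add] at hyr
  -- Surviving characters are determined by their new ranks, so equality of new ranks fixes the old
  -- rank of `y`.
  have hrank := kept_inj ((h.blackT_iff_residue hS hM hyb').1 hyb) (by
    rw [Nat.mul_add_mod', ← hgdef, hir]
    exact hrK) hyr
  rw [Nat.add_comm, ← hrank, posT_rankT hyb']
  exact ⟨rankT_lt_size hyb', hy⟩

end Enclosing

end Shared

/-! ### Saturated sets, and the cost of shifting by multiples of the period. -/

section Weights

variable {α : Type u} {P T : List α} {k lo hi : ℕ} {S : Finset (List (ℕ × ℕ))}

theorem sizeP_le_length : sizeP P T S ≤ P.length := by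
  classical exact Nat.count_le _

theorem Enclosing.classes_le (h : Enclosing P T k lo hi S) :
    classes P T lo hi S ≤ P.length := by
  unfold classes
  split_ifs
  · exact Nat.zero_le _
  · exact h.period_le.trans sizeP_le_length

/-- Each insertion that at least halves the number of classes shortens its binary expansion by a
digit, so greedy insertion stops after `Nat.size` many steps. -/
theorem Enclosing.exists_saturated {F : List (ℕ × ℕ) → Prop}
    (hF : ∀ X, F X → Fits P T k lo hi X) (h : Enclosing P T k lo hi S) (hS : ∀ A ∈ S, F A) :
    ∃ S', Enclosing P T k lo hi S' ∧ (∀ A ∈ S', F A) ∧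
      S'.card ≤ S.card + Nat.size (classes P T lo hi S) ∧
      (sizeP P T S' = 0 ∨
        ∀ X, F X → ¬ 2 * classes P T lo hi (Insert.insert X S') ≤ classes P T lo hi S') := by
  classical
  generalize hc : classes P T lo hi S = c
  induction c using Nat.strong_induction_on generalizing S with
  | _ c ih =>
    by_cases hsat : sizeP P T S = 0 ∨
        ∀ X, F X → ¬ 2 * classes P T lo hi (Insert.insert X S) ≤ classes P T lo hi S
    · exact ⟨S, h, hS, by omega, hsat⟩
    · push Not at hsat
      obtain ⟨h0, X, hX, hle⟩ := hsat
      have hpos : 0 < c := by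
        rw [← hc, classes, if_neg h0]
        exact period_pos (Nat.pos_of_ne_zero h0)
      rw [hc] at hle
      obtain ⟨S', h1, h2, h3, h4⟩ := ih (classes P T lo hi (Insert.insert X S)) (by omega)
        (h.insert (hF X hX)) (by
          intro A hA
          rcases Finset.mem_insert.1 hA with rfl | hA
          · exact hX
          · exact hS A hA) rfl
      refine ⟨S', h1, h2, h3.trans ?_, h4⟩
      have h5 := Finset.card_insert_le X S
      have h6 : Nat.size (classes P T lo hi (Insert.insert X S)) + 1 ≤ Nat.size c := by
        have h7 : 0 < Nat.size c := Nat.size_pos.2 hpos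
        have h8 := Nat.lt_size_self c
        obtain ⟨z, hz⟩ := Nat.exists_eq_succ_of_ne_zero h7.ne'
        rw [hz, Nat.pow_succ] at h8
        have h9 : Nat.size (classes P T lo hi (Insert.insert X S)) ≤ z := Nat.size_le.2 (by omega)
        omega
      omega

variable (P T lo hi S) in
open Classical in
/-- The number of edits in `S` just before the black characters whose rank is `c` modulo the
period. -/
noncomputable def weight (c : ℕ) : ℕ :=
  ∑ A ∈ S, (steps A).countP
    (fun s => decide (IsEdit P T s ∧ rankP P T S s.1.1 % period P T lo hi S = c))

theorem Enclosing.sum_weight_le (h : Enclosing P T k lo hi S) :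
    ∑ c ∈ Finset.range (period P T lo hi S), weight P T lo hi S c ≤ S.card * k := by
  classical
  unfold weight
  rw [Finset.sum_comm]
  refine (Finset.sum_le_sum (g := fun _ => k) fun A hA => ?_).trans (by simp)
  rw [sum_countP_fiber]
  refine le_trans (List.countP_mono_left fun s _ => ?_) (h.fits A hA).cost_le
  simp only [decide_eq_true_eq]
  exact fun h => h.1

variable (P T S) in
/-- The part of `P` between the black characters of ranks `u` and `u + 1`. -/
noncomputable def gapP (u : ℕ) : List α := fragment P (posP P T S u + 1) (posP P T S (u + 1))

variable (P T lo hi S) in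
/-- The part of `T` between the black characters of ranks `t` and `t + 1`. -/
noncomputable def gapT (t : ℕ) : List α :=
  fragment T (posT P T lo hi S t + 1) (posT P T lo hi S (t + 1))

open Classical in
-- `A` matches both ends of the gap with their shifted images, so its part in between turns one gap
-- into the other. The position of each of its edits in `P` has rank `u + 1`.
theorem Enclosing.editDist_gap_le (h : Enclosing P T k lo hi S) {A : List (ℕ × ℕ)} (hA : A ∈ S)
    {u : ℕ} (hu : u + 1 < sizeP P T S) :
    editDist (gapP P T S u) (gapT P T lo hi S (u + shift P T lo hi S A)) ≤
      (steps A).countP (fun s => decide (IsEdit P T s ∧ rankP P T S s.1.1 = u + 1)) := by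
  have hf := h.fits A hA
  obtain ⟨_, m1⟩ := hf.matched_pos hA (show u < sizeP P T S by omega)
  obtain ⟨_, m2⟩ := hf.matched_pos hA hu
  rw [Nat.add_right_comm] at m2
  have hlt := posP_lt (Nat.lt_succ_self u) hu
  have hlt' := (m1.lt_iff hf.route m2).1 hlt
  obtain ⟨A₁, B, A₂, _, hB, hA₂, hst⟩ := hf.route.between m1.1 m2.1 ⟨hlt, hlt'⟩
  have hle := hA₂.le
  simp only at hle
  have hhi := h.hi_le
  have hle2 := hf.le_hi
  have hed := hB.edits (X := P) (Y := T) (by simp only; omega) (by simp only; omega)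
  refine (editDist_le_iff.2 hed).trans ?_
  rw [hst, cost, List.countP_append, List.countP_cons, List.countP_append]
  have : (steps B).countP (fun s => decide (IsEdit P T s)) ≤
      (steps B).countP (fun s => decide (IsEdit P T s ∧ rankP P T S s.1.1 = u + 1)) := by
    refine List.countP_mono_left fun s hs => ?_
    simp only [decide_eq_true_eq]
    refine fun h => ⟨h, ?_⟩
    obtain ⟨b1, b2⟩ := hB.bounds hs
    have hstep := hB.step_of_mem hs
    have hs1 : s.1.1 ≤ s.2.1 := by rcases hstep with h | h | h <;> rw [h] <;> simp
    simp only at b1 b2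
    have r1 := rankP_mono (P := P) (T := T) (S := S) b1.1
    have r2 := rankP_mono (P := P) (T := T) (S := S) (hs1.trans b2.1)
    obtain ⟨c1, c2⟩ := posP_spec (show u < sizeP P T S by omega)
    obtain ⟨d1, d2⟩ := posP_spec hu
    rw [rankP_succ_of_black c1] at r1
    omega
  omega

/-- Gaps with congruent indices are similar. -/
theorem Enclosing.editDist_gap_le_weight (h : Enclosing P T k lo hi S) {u t : ℕ}
    (hu : u + 1 < sizeP P T S) (ht : t + 1 < sizeT P T lo hi S)
    (hut : u % period P T lo hi S = t % period P T lo hi S) :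
    editDist (gapP P T S u) (gapT P T lo hi S t) ≤
      weight P T lo hi S ((u + 1) % period P T lo hi S) := by
  classical
  have hN := h.sizeT_lt (by omega)
  have hMN := h.size_le
  set g := period P T lo hi S with hg
  set U := (Finset.range (sizeP P T S - 1)).filter (fun v => v % g = u % g) with hU
  let wt : List (ℕ × ℕ) × ℕ → ℕ := fun e =>
    (steps e.1).countP (fun s => decide (IsEdit P T s ∧ rankP P T S s.1.1 = e.2 + 1))
  let dP : ℕ → ℕ := fun v => editDist (gapP P T S u) (gapP P T S v)
  let dT : ℕ → ℕ := fun v => editDist (gapP P T S u) (gapT P T lo hi S v)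
  -- The gaps of one residue class are the vertices of a graph with an edge from `v` to its shift by
  -- each alignment. The distance from gap `u` changes along an edge by at most the edits made
  -- there, and `le_sum_of_levels` sums each edge only once, however long the path to `t` is.
  have key : dT t ≤ ∑ e ∈ S ×ˢ U, wt e := by
    refine le_sum_of_levels (S ×ˢ U) wt (fun e => dP e.2)
      (fun e => dT (e.2 + shift P T lo hi S e.1)) ?_ ?_
    · rintro ⟨A, v⟩ he
      simp only [Finset.mem_product, hU, Finset.mem_filter, Finset.mem_range] at he
      have h1 := h.editDist_gap_le he.1 (u := v) (by omega)
      have h2 := editDist_triangle (gapP P T S u) (gapP P T S v)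
        (gapT P T lo hi S (v + shift P T lo hi S A))
      have h3 := editDist_triangle (gapP P T S u) (gapT P T lo hi S (v + shift P T lo hi S A))
        (gapP P T S v)
      rw [editDist_comm (gapT P T lo hi S _) (gapP P T S v)] at h3
      simp only [dP, dT, wt]
      omega
    · intro l hl hld
      by_contra! hcon
      -- If no edge crosses level `l`, being in the class and at level at least `l` is a preserved
      -- labelling. It is false at `u` and true at `t`. There is one gap fewer than black
      -- characters, hence `M' = sizeP - 1`.
      have hlab := h.label_eq (fP := fun v => v % g = u % g ∧ l ≤ dP v)
        (fT := fun v => v % g = u % g ∧ l ≤ dT v) (M' := sizeP P T S - 1) (by omega) (by omega)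
        ?_ (i := u) (t := t) (by omega) (by omega) hut
      · simp only [eq_iff_iff, dP, editDist_self, true_and] at hlab
        have := hlab.2 ⟨hut.symm, hld⟩
        omega
      · intro A hA v hv
        have hmod : (v + shift P T lo hi S A) % g = v % g := by
          obtain ⟨z, hz⟩ := period_dvd (P := P) (T := T) (lo := lo) (hi := hi) hA
          rw [hz, ← hg, Nat.add_mul_mod_self_left]
        simp only [hmod, eq_iff_iff]
        refine and_congr_right fun hvu => ?_
        have := hcon (A, v) (by
          simp only [Finset.mem_product, hU, Finset.mem_filter, Finset.mem_range]
          exact ⟨hA, hv, hvu⟩)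
        exact this.symm
  refine key.trans ?_
  rw [Finset.sum_product, weight]
  refine Finset.sum_le_sum fun A hA => ?_
  simp only [wt]
  rw [← Finset.sum_image (s := U) (g := (· + 1))
    (f := fun v => (steps A).countP (fun s => decide (IsEdit P T s ∧ rankP P T S s.1.1 = v)))
    (fun a _ b _ hab => Nat.succ_injective hab), sum_countP_fiber]
  refine List.countP_mono_left fun s _ => ?_
  simp only [decide_eq_true_eq, Finset.mem_image, hU, Finset.mem_filter]
  rintro ⟨h1, v, ⟨_, h2⟩, h3⟩
  refine ⟨h1, ?_⟩
  rw [← h3, ← hg]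
  exact Nat.ModEq.add_right 1 h2

theorem fragment_succ (X : List α) {x : ℕ} (h : x < X.length) :
    fragment X x (x + 1) = [X[x]] := by
  rw [fragment_eq_cons (by omega) (by omega), fragment_self]

theorem Enclosing.getElem?_eq (h : Enclosing P T k lo hi S) {i t : ℕ} (hi' : i < sizeP P T S)
    (ht : t < sizeT P T lo hi S) (hit : i % period P T lo hi S = t % period P T lo hi S) :
    P[posP P T S i]? = T[posT P T lo hi S t]? :=
  h.label_pos_eq (fP := fun x => P[x]?) (fT := fun y => T[y]?)
    (fun _ _ _ _ hm _ => hm.2.symm) hi' ht hit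

/-- Shifting by a multiple of the period turns parts of `P` into similar parts of `T`. -/
theorem Enclosing.edits_between (h : Enclosing P T k lo hi S) {u v j : ℕ} (huv : u < v)
    (hv : v < sizeP P T S) (hj : v + j * period P T lo hi S < sizeT P T lo hi S) :
    Edits (∑ l ∈ Finset.Ioc u v, weight P T lo hi S (l % period P T lo hi S))
      (fragment P (posP P T S u + 1) (posP P T S v))
      (fragment T (posT P T lo hi S (u + j * period P T lo hi S) + 1)
        (posT P T lo hi S (v + j * period P T lo hi S))) := by
  set g := period P T lo hi S with hg
  induction v, huv using Nat.le_induction with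
  | base =>
    have h1 := editDist_le_iff.1 (h.editDist_gap_le_weight (u := u) (t := u + j * g) hv
      (by omega) (by rw [← hg, Nat.add_mul_mod_self_right]))
    simp only [gapP, gapT] at h1
    rw [Nat.Ioc_succ_singleton, Finset.sum_singleton,
      show u + 1 + j * g = u + j * g + 1 by omega]
    exact h1
  | succ v huv ih =>
    have ih := ih (by omega) (by omega)
    have h1 := editDist_le_iff.1 (h.editDist_gap_le_weight (u := v) (t := v + j * g) hv
      (by omega) (by rw [← hg, Nat.add_mul_mod_self_right]))
    simp only [gapP, gapT] at h1
    have h2 := h.getElem?_eq (i := v) (t := v + j * g) (by omega) (by omega)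
      (by rw [← hg, Nat.add_mul_mod_self_right])
    have p1 := posP_lt huv (show v < sizeP P T S by omega)
    have p2 := posP_lt (show v < v + 1 by omega) hv
    have p3 : posP P T S (v + 1) < P.length := (posP_spec hv).1.1
    have t1 := posT_lt (show u + j * g < v + j * g by omega)
      (show v + j * g < sizeT P T lo hi S by omega)
    have t2 := posT_lt (show v + j * g < v + j * g + 1 by omega)
      (show v + j * g + 1 < sizeT P T lo hi S by omega)
    have t3 := (posT_spec (show v + j * g + 1 < sizeT P T lo hi S by omega)).1.2.1
    have t4 := h.hi_le
    rw [show v + 1 + j * g = v + j * g + 1 by omega, ← Finset.sum_Ioc_consecutive _ (by omega)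
      (Nat.le_succ v), Nat.Ioc_succ_singleton, Finset.sum_singleton]
    have h3 : Edits 0 (fragment P (posP P T S v) (posP P T S v + 1))
        (fragment T (posT P T lo hi S (v + j * g)) (posT P T lo hi S (v + j * g) + 1)) := by
      rw [List.getElem?_eq_getElem (by omega), List.getElem?_eq_getElem (by omega),
        Option.some_inj] at h2
      rw [fragment_succ _ (by omega), fragment_succ _ (by omega), h2]
      exact .refl _
    have h4 := (ih.append h3).append h1
    rwa [fragment_append (by omega) (by omega) (by omega),
      fragment_append (by omega) (by omega) (by omega),
      fragment_append (by omega) (by omega) (by omega),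
      fragment_append (by omega) (by omega) (by omega)] at h4

end Weights

/-! ### A second input that agrees along the alignments in `S`. -/

section Agree

variable {α : Type u} (P T P' T' : List α)

/-- The alignment `A` makes the same edits in `(P, T)` and in `(P', T')`. -/
def Agree (A : List (ℕ × ℕ)) : Prop :=
  ∀ s ∈ steps A, (IsEdit P T s ↔ IsEdit P' T' s) ∧
    (IsEdit P T s → (s.2.1 = s.1.1 + 1 → P'[s.1.1]? = P[s.1.1]?) ∧
      (s.2.2 = s.1.2 + 1 → T'[s.1.2]? = T[s.1.2]?))

variable {P T P' T'} {k lo hi : ℕ} {S : Finset (List (ℕ × ℕ))} {A : List (ℕ × ℕ)}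

theorem Agree.eq_of_matched (h : Agree P T P' T' A) {x y : ℕ} (hm : Matched P T A x y) :
    P'[x]? = T'[y]? := by
  have h1 := mt (h _ hm.1).1.2 hm.not_isEdit
  by_contra hne
  exact h1 (.inr (.inr ⟨rfl, hne⟩))

/-- Edited characters are known from agreement, and knowledge travels along matches because these
are matches in both inputs. -/
theorem Red.known (hS : ∀ A ∈ S, Agree P T P' T' A) {v : ℕ ⊕ ℕ} (hv : Red P T S v) :
    (∀ x, v = .inl x → P'[x]? = P[x]?) ∧ (∀ y, v = .inr y → T'[y]? = T[y]?) := by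
  induction hv with
  | pat h1 h2 h3 h4 =>
    refine ⟨fun x hx => ?_, fun y hy => by simp at hy⟩
    cases hx
    exact ((hS _ h1 _ h2).2 h3).1 h4
  | text h1 h2 h3 h4 =>
    refine ⟨fun x hx => by simp at hx, fun y hy => ?_⟩
    cases hy
    exact ((hS _ h1 _ h2).2 h3).2 h4
  | toText h1 h2 _ ih =>
    refine ⟨fun x hx => by simp at hx, fun y hy => ?_⟩
    cases hy
    rw [← (hS _ h1).eq_of_matched h2, ih.1 _ rfl, h2.2]
  | toPat h1 h2 _ ih =>
    refine ⟨fun x hx => ?_, fun y hy => by simp at hy⟩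
    cases hx
    rw [(hS _ h1).eq_of_matched h2, ih.2 _ rfl, h2.2]

theorem knownP_of_not_black (hS : ∀ A ∈ S, Agree P T P' T' A) {x : ℕ} (hx : x < P.length)
    (h : ¬ BlackP P T S x) : P'[x]? = P[x]? := by
  have h1 : Red P T S (.inl x) := by
    by_contra h1
    exact h ⟨hx, h1⟩
  exact (h1.known hS).1 x rfl

theorem knownT_of_not_black (hS : ∀ A ∈ S, Agree P T P' T' A) {y : ℕ} (h1 : lo ≤ y) (h2 : y < hi)
    (h : ¬ BlackT P T lo hi S y) : T'[y]? = T[y]? := by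
  have h1 : Red P T S (.inr y) := by
    by_contra h3
    exact h ⟨h1, h2, h3⟩
  exact (h1.known hS).2 y rfl

variable (P T P' S) in
/-- The black characters of index `c` coincide in `P` and `P'`. -/
def Known (c : ℕ) : Prop := P'[posP P T S c]? = P[posP P T S c]?

namespace Enclosing

variable (h : Enclosing P T k lo hi S)

include h in
theorem getElem?_eq_of_agree (hS : ∀ A ∈ S, Agree P T P' T' A) {i t : ℕ} (hi' : i < sizeP P T S)
    (ht : t < sizeT P T lo hi S) (hit : i % period P T lo hi S = t % period P T lo hi S) :
    P'[posP P T S i]? = T'[posT P T lo hi S t]? :=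
  h.label_pos_eq (fP := fun x => P'[x]?) (fT := fun y => T'[y]?)
    (fun A hA _ _ hm _ => ((hS A hA).eq_of_matched hm).symm) hi' ht hit

include h in
-- A residue class carries a single character in each of the two inputs, so it is known as a whole
-- or not at all.
theorem knownT_iff (hS : ∀ A ∈ S, Agree P T P' T' A) {i t : ℕ} (hi' : i < sizeP P T S)
    (ht : t < sizeT P T lo hi S) (hit : i % period P T lo hi S = t % period P T lo hi S) :
    T'[posT P T lo hi S t]? = T[posT P T lo hi S t]? ↔ Known P T P' S i := by
  rw [Known, h.getElem?_eq_of_agree hS hi' ht hit, h.getElem?_eq hi' ht hit]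

include h in
theorem known_iff (hS : ∀ A ∈ S, Agree P T P' T' A) {i i' : ℕ} (hi' : i < sizeP P T S)
    (hi'' : i' < sizeP P T S) (hit : i % period P T lo hi S = i' % period P T lo hi S) :
    Known P T P' S i ↔ Known P T P' S i' := by
  have := h.size_le
  rw [← h.knownT_iff hS hi' (show i' < sizeT P T lo hi S by omega) hit,
    ← h.knownT_iff hS hi'' (show i' < sizeT P T lo hi S by omega) rfl]

end Enclosing

variable (P T lo hi S) in
/-- The alignment `X` matches the black character `i` of `P` with its image under the shift by `j`
periods. -/
def SharedAt (X : List (ℕ × ℕ)) (j i : ℕ) : Prop :=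
  i < sizeP P T S ∧ i + j * period P T lo hi S < sizeT P T lo hi S ∧
    Matched P T X (posP P T S i) (posT P T lo hi S (i + j * period P T lo hi S))

theorem Fits.index_lt {X : List (ℕ × ℕ)} (hX : Fits P T k lo hi X) {i i' t t' : ℕ}
    (hi' : i' < sizeP P T S) (ht : t < sizeT P T lo hi S)
    (h1 : Matched P T X (posP P T S i) (posT P T lo hi S t))
    (h2 : Matched P T X (posP P T S i') (posT P T lo hi S t')) (hlt : i < i') : t < t' := by
  have h3 := (h1.lt_iff hX.route h2).1 (posP_lt hlt hi')
  by_contra! hc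
  rcases hc.eq_or_lt with rfl | hc
  · omega
  · have := posT_lt hc ht
    omega

theorem Fits.index_le {X : List (ℕ × ℕ)} (hX : Fits P T k lo hi X) {i i' t t' : ℕ}
    (hM : i' < sizeP P T S) (ht : t < sizeT P T lo hi S)
    (h1 : Matched P T X (posP P T S i) (posT P T lo hi S t))
    (h2 : Matched P T X (posP P T S i') (posT P T lo hi S t')) (hlt : t' < t) : i' < i := by
  by_contra! hc
  rcases hc.eq_or_lt with rfl | hc
  · have := (h1.eq_iff hX.route h2).1 rfl
    have := posT_lt hlt ht
    omega
  · have h3 := (h1.lt_iff hX.route h2).1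
    have := h3 (posP_lt hc hM)
    have := posT_lt hlt ht
    omega

/-- Along an alignment, knowledge reaches all black characters of a range in which the alignment
avoids the shift by `j` periods. -/
theorem Enclosing.known_of_unshared (h : Enclosing P T k lo hi S)
    (hS : ∀ A ∈ S, Agree P T P' T' A) {X B : List (ℕ × ℕ)} (hX : Fits P T k lo hi X)
    (hB : Agree P T P' T' B) {u v j : ℕ} (hv : v ≤ sizeP P T S)
    (hsub : ∀ i, u ≤ i → i < v → ∀ s ∈ steps X, s.1.1 = posP P T S i → s.2.1 = posP P T S i + 1 →
      s ∈ steps B)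
    (hun : ∀ i, u ≤ i → i < v → ¬ SharedAt P T lo hi S X j i)
    (hexit : ∀ i t, u ≤ i → i < v → t < sizeT P T lo hi S →
      Matched P T X (posP P T S i) (posT P T lo hi S t) →
      Known P T P' S i ∨ ∃ i', u ≤ i' ∧ i' < v ∧ t = i' + j * period P T lo hi S) :
    ∀ i, u ≤ i → i < v → Known P T P' S i := by
  refine forall_of_chain (R := fun i i' => i < sizeP P T S ∧
    i' + j * period P T lo hi S < sizeT P T lo hi S ∧
    Matched P T X (posP P T S i) (posT P T lo hi S (i' + j * period P T lo hi S))) ?_ ?_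
  · rintro i j i' j' ⟨_, h1, h2⟩ ⟨h3, _, h4⟩ hlt
    have := hX.index_lt h3 h1 h2 h4 hlt
    omega
  · intro i h1 h2
    have hiM : i < sizeP P T S := by omega
    obtain ⟨hb, -⟩ := posP_spec hiM
    rcases hX.route.matched_or_edit_fst (X := P) (Y := T) (Nat.zero_le _) hb.1 with
      ⟨y, hy⟩ | ⟨s, hs, s1, s2, s3⟩
    · have hyB : Matched P T B (posP P T S i) y := ⟨hsub i h1 h2 _ hy.1 rfl rfl, hy.2⟩
      have heq := hB.eq_of_matched hyB
      have hbd := hX.matched_bounds hy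
      by_cases hyb : BlackT P T lo hi S y
      · have ht := rankT_lt_size hyb
        rw [← posT_rankT hyb] at hy
        rcases hexit i _ h1 h2 ht hy with h3 | ⟨i', h3, h4, h5⟩
        · exact .inl h3
        · rw [h5] at ht hy
          -- The match leads to the image of an index `i'`, different from `i` because `X` avoids
          -- the shift. That image is in the class of `i'`, so knowledge of `i'` passes through the
          -- match back to `i`.
          refine .inr ⟨i', h3, h4, ?_, ⟨hiM, ht, hy⟩, fun hk => ?_⟩
          · rintro rfl
            exact hun i' h1 h2 ⟨hiM, ht, hy⟩
          · have h6 := (h.knownT_iff hS (show i' < sizeP P T S by omega) ht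
              (by rw [Nat.add_mul_mod_self_right])).2 hk
            rw [← h5, posT_rankT hyb] at h6
            rw [Known, heq, h6, hyB.2]
      · left
        rw [Known, heq, knownT_of_not_black hS hbd.2.1 hbd.2.2 hyb, hy.2]
    · left
      rw [Known, ← s2]
      rw [← s2] at s3
      exact ((hB s (hsub i h1 h2 s hs s2 (by rw [s3, s2]))).2 s1).1 s3

theorem posP_add_le {i i' : ℕ} (hle : i ≤ i') (hi' : i' < sizeP P T S) :
    posP P T S i + (i' - i) ≤ posP P T S i' := by
  induction i', hle using Nat.le_induction with
  | base => simp
  | succ n hn ih =>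
    have := ih (by omega)
    have := posP_lt (show n < n + 1 by omega) hi'
    omega

/-- The cost of an alignment between two of its matches bounds the difference of the lengths. -/
theorem Fits.drift_between {X : List (ℕ × ℕ)} (hX : Fits P T k lo hi X) {x y x' y' : ℕ}
    (h1 : Matched P T X x y) (h2 : Matched P T X x' y') (hlt : x < x') :
    x' + y ≤ x + y' + k ∧ x + y' ≤ x' + y + k ∧ y < y' := by
  have hlt' := (h1.lt_iff hX.route h2).1 hlt
  obtain ⟨A₁, B, A₂, _, hB, _, hst⟩ := hX.route.between h1.1 h2.1 ⟨hlt, hlt'⟩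
  have h3 := hB.length_diff_le (X := P) (Y := T)
  have h4 := hX.cost_le
  rw [cost_eq_editCount, hst, editCount_append, editCount_cons, editCount_append] at h4
  rw [cost_eq_editCount] at h3
  simp only at h3
  omega

namespace Enclosing

variable (h : Enclosing P T k lo hi S)

include h in
theorem sum_weight_Ioc_le {u v : ℕ} (huv : v ≤ u + period P T lo hi S) :
    ∑ l ∈ Finset.Ioc u v, weight P T lo hi S (l % period P T lo hi S) ≤ S.card * k := by
  refine le_trans ?_ h.sum_weight_le
  have h1 : Finset.Ioc u v = Finset.Ioo u (v + 1) := by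
    ext
    simp only [Finset.mem_Ioc, Finset.mem_Ioo]
    omega
  rw [h1, ← sum_arc (by omega)]
  apply Finset.sum_le_sum_of_subset
  intro c hc
  simp only [arc, Finset.mem_image, Finset.mem_Ioo] at hc
  obtain ⟨l, hl, rfl⟩ := hc
  rw [Finset.mem_range]
  apply Nat.mod_lt
  omega

include h in
theorem length_between {u v j : ℕ} (huv : u < v)
    (hv : v < sizeP P T S) (hj : v + j * period P T lo hi S < sizeT P T lo hi S)
    (hg : v ≤ u + period P T lo hi S) :
    posP P T S v + posT P T lo hi S (u + j * period P T lo hi S) ≤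
      posP P T S u + posT P T lo hi S (v + j * period P T lo hi S) + S.card * k := by
  have h1 := (h.edits_between huv hv hj).length_le
  have h2 := h.sum_weight_Ioc_le hg
  have h3 := (posP_spec hv).1.1
  have h4 := (posT_spec hj).1.2.1
  have h5 := h.hi_le
  have h6 := posP_lt huv hv
  have h7 := posT_lt (show u + j * period P T lo hi S < v + j * period P T lo hi S by omega) hj
  rw [length_fragment (by omega), length_fragment (by omega)] at h1
  omega

include h in
-- Up to the shared match at `c`, `P` from its first black character and `T` from rank `j * g` have
-- nearly equal lengths by `length_between`. A match further left in `T` can deviate from this by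
-- only `k`, so its partner in `P` is close to the first black character.
theorem index_lt_of_before {X : List (ℕ × ℕ)} (hX : Fits P T k lo hi X) {j c i t : ℕ}
    (hc : c < period P T lo hi S) (hcs : SharedAt P T lo hi S X j c)
    (ht : t < j * period P T lo hi S) (hm : Matched P T X (posP P T S i) (posT P T lo hi S t))
    (hi' : i < sizeP P T S) : i < S.card * k + k := by
  obtain ⟨c1, c2, c3⟩ := hcs
  have hic := hX.index_le hi' c2 c3 hm (by omega)
  have h1 := hX.drift_between hm c3 (posP_lt hic c1)
  have h2 := h.length_between (u := 0) (v := c) (j := j) (by omega) c1 c2 (by omega)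
  have h3 := posP_add_le (Nat.zero_le i) hi'
  have h4 := posT_lt (show t < 0 + j * period P T lo hi S by omega)
    (show 0 + j * period P T lo hi S < sizeT P T lo hi S by omega)
  omega

include h in
-- The mirror image, with the last shared member `u` of the class in the role of `c`.
theorem index_lt_of_after {X : List (ℕ × ℕ)} (hX : Fits P T k lo hi X) {j c i t : ℕ}
    (hc : c < period P T lo hi S)
    (hcs : ∀ i < sizeP P T S, i % period P T lo hi S = c → SharedAt P T lo hi S X j i)
    (ht : sizeP P T S + j * period P T lo hi S ≤ t) (ht' : t < sizeT P T lo hi S)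
    (hm : Matched P T X (posP P T S i) (posT P T lo hi S t)) (hi' : i < sizeP P T S) :
    sizeP P T S - 1 - i < S.card * k + k := by
  have hle := h.period_le
  set g := period P T lo hi S with hg
  set M := sizeP P T S with hM
  -- The last index of residue `c` is less than a period from the end, so the weights passed after
  -- it are each counted at most once.
  obtain ⟨u, hu, huM, hug⟩ : ∃ u, u < M ∧ M ≤ u + g ∧ u % g = c := by
    refine ⟨c + (M - 1 - c) / g * g, ?_, ?_, ?_⟩
    · have := Nat.div_mul_le_self (M - 1 - c) g
      omega
    · have := Nat.mod_add_div (M - 1 - c) g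
      have := Nat.mod_lt (M - 1 - c) (show 0 < g by omega)
      rw [Nat.mul_comm]
      omega
    · rw [Nat.add_mul_mod_self_right, Nat.mod_eq_of_lt hc]
  obtain ⟨c1, c2, c3⟩ := hcs u hu hug
  rw [← hg] at c2 c3
  have hic := hX.index_le c1 ht' hm c3 (by omega)
  have h1 := hX.drift_between c3 hm (posP_lt hic hi')
  have h2 := h.length_between (u := u) (v := M - 1) (j := j) (by omega) (by omega)
    (by rw [← hg]; omega) (by rw [← hg]; omega)
  rw [← hg] at h2
  have h3 := posP_add_le (P := P) (T := T) (S := S) (show i ≤ M - 1 by omega) (by omega)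
  have h4 := posT_lt (show M - 1 + j * g < t by omega) ht'
  omega

/-- Agreement on an alignment follows from knowledge of the characters that it does not share with
the shift by `j` periods. -/
theorem _root_.EditMatching.agree_of_known (h : Enclosing P T k lo hi S)
    (hS : ∀ A ∈ S, Agree P T P' T' A) {X : List (ℕ × ℕ)} (hX : Fits P T k lo hi X) {j : ℕ}
    (hP : ∀ i < sizeP P T S, SharedAt P T lo hi S X j i ∨ Known P T P' S i)
    (hT : ∀ t < sizeT P T lo hi S, rankT P T lo hi S (start X) ≤ t →
      t < rankT P T lo hi S (finish X) → (∃ i, t = i + j * period P T lo hi S ∧ i < sizeP P T S) ∨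
      T'[posT P T lo hi S t]? = T[posT P T lo hi S t]?) : Agree P T P' T' X := by
  have kP : ∀ x < P.length, (∃ i, x = posP P T S i ∧ SharedAt P T lo hi S X j i) ∨
      P'[x]? = P[x]? := by
    intro x hx
    by_cases hb : BlackP P T S x
    · rcases hP _ (rankP_lt_size hb) with h1 | h1
      · exact .inl ⟨_, (posP_rankP hb).symm, h1⟩
      · rw [Known, posP_rankP hb] at h1
        exact .inr h1
    · exact .inr (knownP_of_not_black hS hx hb)
  have kT : ∀ y, start X ≤ y → y < finish X →
      (∃ i, y = posT P T lo hi S (i + j * period P T lo hi S) ∧ SharedAt P T lo hi S X j i) ∨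
      T'[y]? = T[y]? := by
    intro y h1 h2
    have h3 := hX.lo_le
    have h4 := hX.le_hi
    by_cases hb : BlackT P T lo hi S y
    · rcases hT _ (rankT_lt_size hb) (rankT_mono h1) (rankT_lt hb h2) with ⟨i, hi1, hi2⟩ | h5
      · rcases hP i hi2 with h6 | h6
        · exact .inl ⟨i, by rw [← hi1, posT_rankT hb], h6⟩
        · right
          have := (h.knownT_iff hS hi2 (rankT_lt_size hb)
            (by rw [hi1, Nat.add_mul_mod_self_right])).2 h6
          rwa [posT_rankT hb] at this
      · rw [posT_rankT hb] at h5
        exact .inr h5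
    · exact .inr (knownT_of_not_black hS (by omega) (by omega) hb)
  -- The character of an edit cannot lie on a shared match, since two steps of a route through the
  -- same character coincide; so it is known. `uT` is the same for `T`.
  have uP : ∀ s ∈ steps X, IsEdit P T s → s.2.1 = s.1.1 + 1 → P'[s.1.1]? = P[s.1.1]? := by
    intro s hs he hx
    have hb := (hX.route.bounds hs).2.1
    rcases kP s.1.1 (by simp only at hb; omega) with ⟨i, h1, _, _, h2⟩ | h1
    · exfalso
      have h3 := hX.route.trichotomy hs h2.1
      simp only at h3
      rcases h3 with rfl | h3 | h3
      · exact h2.not_isEdit he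
      · omega
      · omega
    · exact h1
  have uT : ∀ s ∈ steps X, IsEdit P T s → s.2.2 = s.1.2 + 1 → T'[s.1.2]? = T[s.1.2]? := by
    intro s hs he hx
    have hb := hX.route.bounds hs
    simp only at hb
    rcases kT s.1.2 hb.1.2 (by omega) with ⟨i, h1, _, _, h2⟩ | h1
    · exfalso
      have h3 := hX.route.trichotomy hs h2.1
      simp only at h3
      rcases h3 with rfl | h3 | h3
      · exact h2.not_isEdit he
      · omega
      · omega
    · exact h1
  intro s hs
  refine ⟨?_, fun he => ⟨uP s hs he, uT s hs he⟩⟩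
  rcases isEdit_or_eq (X := P) (Y := T) (hX.route.step_of_mem hs) with he | ⟨hne, h1, h2⟩
  · refine iff_of_true he ?_
    rcases he with h1 | h1 | ⟨h1, h2⟩
    · exact .inl h1
    · exact .inr (.inl h1)
    · refine .inr (.inr ⟨h1, ?_⟩)
      have he : IsEdit P T s := .inr (.inr ⟨h1, h2⟩)
      rw [uP s hs he (by rw [h1]), uT s hs he (by rw [h1])]
      exact h2
  · refine iff_of_false hne ?_
    obtain ⟨⟨x, y⟩, q⟩ := s
    simp only at h1 h2
    subst h1
    have hm : Matched P T X x y := ⟨hs, h2⟩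
    have hb := hX.route.bounds hs
    simp only at hb
    -- If either end of the match is on a shared match, the two matches are equal and periodicity in
    -- the second input applies; otherwise both ends are known.
    have heq : P'[x]? = T'[y]? := by
      have shared : ∀ i, SharedAt P T lo hi S X j i → (x = posP P T S i ∨
          y = posT P T lo hi S (i + j * period P T lo hi S)) → P'[x]? = T'[y]? := by
        rintro i ⟨h3, h4, h5⟩ h6
        have h7 := hm.eq_iff hX.route h5
        have h8 := h.getElem?_eq_of_agree hS h3 h4 (by rw [Nat.add_mul_mod_self_right])
        have h9 : x = posP P T S i := by tauto
        have h10 := h7.1 h9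
        rw [h9, h10]
        exact h8
      rcases kP x (by omega) with ⟨i, h3, h4⟩ | h3
      · exact shared i h4 (.inl h3)
      · rcases kT y hb.1.2 (by omega) with ⟨i, h4, h5⟩ | h4
        · exact shared i h5 (.inr h4)
        · rw [h3, h4, h2]
    simp [IsEdit, heq]

end Enclosing

end Agree

/-! ### Pieces and extremal alignments that reveal the black characters. -/

section Certificate

variable {α : Type u} {P T P' T' : List α} {k lo hi : ℕ} {S : Finset (List (ℕ × ℕ))}

variable (P lo hi) in
/-- `B` is an alignment between fragments of `P` and of `T[lo..hi)`. -/
def Boxed (B : List (ℕ × ℕ)) : Prop :=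
  ∃ p q, Route p q B ∧ lo ≤ p.2 ∧ q.1 ≤ P.length ∧ q.2 ≤ hi

theorem Fits.boxed {X : List (ℕ × ℕ)} (hX : Fits P T k lo hi X) : Boxed P lo hi X :=
  ⟨_, _, hX.route, hX.lo_le, le_rfl, hX.le_hi⟩

variable (P T lo hi S) in
/-- The weight on both sides of a black character. -/
noncomputable def weight₂ (c : ℕ) : ℕ :=
  weight P T lo hi S c + weight P T lo hi S ((c + 1) % period P T lo hi S)

namespace Enclosing

theorem sum_weight₂_le (h : Enclosing P T k lo hi S) :
    ∑ c ∈ Finset.range (period P T lo hi S), weight₂ P T lo hi S c ≤ 2 * (S.card * k) := by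
  unfold weight₂
  rw [Finset.sum_add_distrib, sum_range_succ_mod]
  have := h.sum_weight_le
  omega

/-- The gaps `u + 1, …, v` outnumber the inner characters by one. The weight at `v` is charged to
the right-hand side of the character `v - 1`, which explains the two-sided `weight₂`. -/
theorem sum_Ioc_le_arc {u v : ℕ} (huv : u + 1 < v) (hg : v ≤ u + period P T lo hi S) :
    ∑ l ∈ Finset.Ioc u v, weight P T lo hi S (l % period P T lo hi S) ≤
      ∑ c ∈ arc (period P T lo hi S) u v, weight₂ P T lo hi S c := by
  rw [sum_arc (by omega)]
  unfold weight₂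
  rw [Finset.sum_add_distrib]
  have h1 : Finset.Ioc u v = Insert.insert v (Finset.Ioo u v) := by
    ext
    simp only [Finset.mem_Ioc, Finset.mem_Ioo, Finset.mem_insert]
    omega
  rw [h1, Finset.sum_insert (by simp), Nat.add_comm]
  have h2 := Finset.single_le_sum (s := Finset.Ioo u v) (f := fun l => weight P T lo hi S
    ((l % period P T lo hi S + 1) % period P T lo hi S)) (fun _ _ => Nat.zero_le _)
    (show v - 1 ∈ Finset.Ioo u v by rw [Finset.mem_Ioo]; omega)
  simp only [Nat.mod_add_mod] at h2
  rw [Nat.sub_add_cancel (by omega)] at h2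
  simp only [Nat.mod_add_mod]
  omega

variable (h : Enclosing P T k lo hi S)

include h in
/-- The part of an optimal alignment between two consecutive matches that it shares with a shift is
cheap and determines the black characters in between. -/
theorem exists_piece {X : List (ℕ × ℕ)} (hX : Fits P T k lo hi X)
    (hopt : IsOptimalAlignment P T (start X) (finish X) X) {j u v : ℕ}
    (hu : SharedAt P T lo hi S X j u) (hv : SharedAt P T lo hi S X j v) (huv : u + 1 < v)
    (hg : v ≤ u + period P T lo hi S)
    (hun : ∀ i, u < i → i < v → ¬ SharedAt P T lo hi S X j i) :
    ∃ B, Boxed P lo hi B ∧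
      cost P T B + 1 ≤ 2 * ∑ c ∈ arc (period P T lo hi S) u v, weight₂ P T lo hi S c ∧
      ∀ P' T', (∀ A ∈ S, Agree P T P' T' A) → Agree P T P' T' B →
        ∀ i, u < i → i < v → Known P T P' S i := by
  obtain ⟨u1, u2, u3⟩ := hu
  obtain ⟨v1, v2, v3⟩ := hv
  have hx := posP_lt (show u < v by omega) v1
  have hy := (u3.lt_iff hX.route v3).1 hx
  obtain ⟨A₁, B, A₂, hA₁, hB, hA₂, hst⟩ := hX.route.between u3.1 v3.1 ⟨hx, hy⟩
  have hhi := h.hi_le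
  have hpart := hopt.part_le (hX.le_hi.trans hhi) hA₁ (.inl rfl) hB (.inl rfl) hA₂ hst
    (h.edits_between (by omega) v1 v2)
  have hsum := sum_Ioc_le_arc (P := P) (T := T) (lo := lo) (hi := hi) (S := S) huv hg
  -- This absorbs the `+ 1`. With total weight zero, `B` has no edits and the first gap has the same
  -- length in `P` as in its image. Then `B` matches `u + 1` with its shifted image, although
  -- nothing is shared between `u` and `v`.
  have hpos : 1 ≤ ∑ c ∈ arc (period P T lo hi S) u v, weight₂ P T lo hi S c := by
    by_contra! hlt
    have hcost : cost P T B = 0 := by omega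
    have hle := Finset.single_le_sum (s := Finset.Ioc u v)
      (f := fun l => weight P T lo hi S (l % period P T lo hi S)) (fun _ _ => Nat.zero_le _)
      (show u + 1 ∈ Finset.Ioc u v by rw [Finset.mem_Ioc]; omega)
    have hgap := h.editDist_gap_le_weight (u := u) (t := u + j * period P T lo hi S) (by omega)
      (by omega) (by rw [Nat.add_mul_mod_self_right])
    have hlen := (editDist_le_iff.1 (hgap.trans (hle.trans hsum))).length_le
    have p1 := posP_lt (show u < u + 1 by omega) (show u + 1 < sizeP P T S by omega)
    have p2 := posP_lt (show u + 1 < v by omega) v1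
    have p3 := (posP_spec v1).1.1
    have t1 := posT_lt (show u + j * period P T lo hi S < u + j * period P T lo hi S + 1 by omega)
      (show u + j * period P T lo hi S + 1 < sizeT P T lo hi S by omega)
    have t2 := (posT_spec (show u + j * period P T lo hi S + 1 < sizeT P T lo hi S by omega)).1.2.1
    rw [gapP, gapT, length_fragment (by omega), length_fragment (by omega)] at hlen
    rcases hB.matched_or_edit_fst (X := P) (Y := T) (x := posP P T S (u + 1)) p1 p2 with
      ⟨y, hm⟩ | ⟨s, hs, he, _⟩
    · obtain ⟨B₁, B₂, hB₁, _, hst'⟩ := hB.split hm.1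
      have hd := hB₁.length_diff_le (X := P) (Y := T)
      have hle1 := hB₁.le
      rw [cost_eq_editCount, hst', editCount_append] at hcost
      rw [cost_eq_editCount] at hd
      simp only at hd hle1
      have hy : y = posT P T lo hi S (u + j * period P T lo hi S + 1) := by omega
      refine hun (u + 1) (by omega) huv ⟨by omega, by omega, ?_⟩
      rw [Nat.add_right_comm, ← hy]
      exact ⟨by rw [hst]; simp [hm.1], hm.2⟩
    · obtain ⟨B₁, B₂, _, _, hst'⟩ := hB.split hs
      rw [cost_eq_editCount, hst', editCount_append, editCount_cons, editCount_edit he] at hcost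
      omega
  refine ⟨B, ⟨_, _, hB, ?_, ?_, ?_⟩, by omega, ?_⟩
  · have := (posT_spec u2).1.1
    simp only
    omega
  · exact (posP_spec v1).1.1.le
  · exact (posT_spec v2).1.2.1.le
  · intro P' T' hS hag i hi1 hi2
    refine h.known_of_unshared hS hX hag v1.le (u := u + 1) (j := j) ?_
      (fun i h1 h2 => hun i h1 h2) ?_ i hi1 hi2
    · intro i h1 h2 s hs s1 s2
      have q1 := posP_lt (show u < i by omega) (show i < sizeP P T S by omega)
      have q2 := posP_lt h2 v1
      rw [hst] at hs
      simp only [List.mem_append, List.mem_cons] at hs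
      rcases hs with hs | rfl | hs | rfl | hs
      · have := (hA₁.bounds hs).2.1
        simp only at this
        omega
      · simp only at s1
        omega
      · exact hs
      · simp only at s1
        omega
      · have := (hA₂.bounds hs).1.1
        simp only at this
        omega
    · intro i t h1 h2 ht hm
      -- Matches do not cross, so between two shared matches the chain cannot leave `(u, v)`.
      have q1 := hX.index_lt (show i < sizeP P T S by omega) u2 u3 hm (by omega)
      have q2 := hX.index_lt v1 ht hm v3 h2
      exact .inr ⟨t - j * period P T lo hi S, by omega, by omega, by omega⟩

variable {F : List (ℕ × ℕ) → Prop} {jj : List (ℕ × ℕ) → ℕ}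
  (hF : ∀ X, F X → Fits P T k lo hi X)
  (hopt : ∀ X, F X → IsOptimalAlignment P T (start X) (finish X) X)
  (hsh : ∀ X, F X → ∃ c < period P T lo hi S, ∀ i < sizeP P T S,
    i % period P T lo hi S = c → SharedAt P T lo hi S X (jj X) i)

theorem exists_residue {g c u : ℕ} (hc : c < g) : ∃ i, u < i ∧ i ≤ u + g ∧ i % g = c := by
  have h1 := Nat.mod_add_div u g
  have h2 := Nat.mod_lt u (show 0 < g by omega)
  by_cases h3 : u % g < c
  · exact ⟨c + g * (u / g), by omega, by omega, by
      rw [Nat.add_mul_mod_self_left, Nat.mod_eq_of_lt hc]⟩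
  · refine ⟨c + g * (u / g + 1), ?_, ?_, by rw [Nat.add_mul_mod_self_left, Nat.mod_eq_of_lt hc]⟩ <;>
    · rw [Nat.mul_add]
      omega

include h hF hopt hsh in
/-- Few pieces determine the black characters between shared matches. -/
theorem exists_interior : ∃ L : List (List (ℕ × ℕ)), (∀ B ∈ L, Boxed P lo hi B) ∧
    (L.map (fun B => cost P T B + 1)).sum ≤ 8 * (S.card * k) ∧
    ∀ P' T', (∀ A ∈ S, Agree P T P' T' A) → (∀ B ∈ L, Agree P T P' T' B) →
      ∀ X, F X → ∀ u i v, SharedAt P T lo hi S X (jj X) u → SharedAt P T lo hi S X (jj X) v →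
        ¬ SharedAt P T lo hi S X (jj X) i → u < i → i < v → Known P T P' S i := by
  classical
  set g := period P T lo hi S with hg
  -- There may be many alignments, but their arcs are subsets of the `g` residues, so they form a
  -- finite family to which `exists_subcover` applies.
  let C : Finset (Finset ℕ) := (Finset.range g).powerset.filter (fun A => ∃ X u v, F X ∧
    SharedAt P T lo hi S X (jj X) u ∧ SharedAt P T lo hi S X (jj X) v ∧ u + 1 < v ∧ v ≤ u + g ∧
    (∀ i, u < i → i < v → ¬ SharedAt P T lo hi S X (jj X) i) ∧ A = arc g u v)
  obtain ⟨C', hC', hun, hmult⟩ := exists_subcover g C (by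
    intro A hA
    obtain ⟨X, u, v, _, _, _, _, _, _, h1⟩ := (Finset.mem_filter.1 hA).2
    exact ⟨u, v, h1⟩)
  have hpiece : ∀ A ∈ C', ∃ B, Boxed P lo hi B ∧
      cost P T B + 1 ≤ 2 * ∑ c ∈ A, weight₂ P T lo hi S c ∧
      ∀ P' T', (∀ A ∈ S, Agree P T P' T' A) → Agree P T P' T' B →
        ∀ i < sizeP P T S, i % g ∈ A → Known P T P' S i := by
    intro A hA
    obtain ⟨X, u, v, h1, h2, h3, h4, h5, h6, rfl⟩ := (Finset.mem_filter.1 (hC' hA)).2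
    obtain ⟨B, b1, b2, b3⟩ := h.exists_piece (hF X h1) (hopt X h1) h2 h3 h4 h5 h6
    refine ⟨B, b1, b2, fun P' T' hS hB i hi1 hi2 => ?_⟩
    simp only [arc, Finset.mem_image, Finset.mem_Ioo] at hi2
    obtain ⟨l, hl, hl'⟩ := hi2
    have := h3.1
    exact (h.known_iff hS (show l < sizeP P T S by omega) hi1 hl').1 (b3 P' T' hS hB l hl.1 hl.2)
  choose! B b1 b2 b3 using hpiece
  refine ⟨C'.toList.map B, ?_, ?_, ?_⟩
  · intro D hD
    simp only [List.mem_map, Finset.mem_toList] at hD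
    obtain ⟨A, hA, rfl⟩ := hD
    exact b1 A hA
  · rw [List.map_map]
    change (C'.toList.map (fun A => cost P T (B A) + 1)).sum ≤ _
    rw [Finset.sum_map_toList]
    refine (Finset.sum_le_sum b2).trans ?_
    rw [← Finset.mul_sum]
    have h1 := sum_sum_le_of_multiplicity (U := Finset.range g) (weight₂ P T lo hi S)
      (fun A hA => Finset.mem_powerset.1 (Finset.mem_filter.1 (hC' hA)).1) hmult
    have h2 := h.sum_weight₂_le
    rw [← hg] at h2
    omega
  · intro P' T' hS hL X hX u i v hu hv hi' hui hiv
    -- Shrink to the shared indices nearest to `i` on either side.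
    obtain ⟨u', ⟨hu1, hu2⟩, hu3⟩ := exists_maximum
      (p := fun b => SharedAt P T lo hi S X (jj X) b ∧ b < i) ⟨u, hu, hui⟩ id (K := i)
      (fun b hb => hb.2.le)
    have hex : ∃ b, SharedAt P T lo hi S X (jj X) b ∧ i < b := ⟨v, hv, hiv⟩
    obtain ⟨hv1, hv2⟩ := Nat.find_spec hex
    have hv3 : ∀ b, SharedAt P T lo hi S X (jj X) b → i < b → Nat.find hex ≤ b :=
      fun b h1 h2 => Nat.find_min' hex ⟨h1, h2⟩
    generalize Nat.find hex = v' at hv1 hv2 hv3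
    have hnone : ∀ b, u' < b → b < v' → ¬ SharedAt P T lo hi S X (jj X) b := by
      intro b h1 h2 h3
      rcases lt_trichotomy b i with h4 | h4 | h4
      · have := hu3 b ⟨h3, h4⟩
        simp only [id] at this
        omega
      · exact hi' (h4 ▸ h3)
      · have := hv3 b h3 h4
        omega
    -- `X` shares a whole residue class, so shared indices are at most one period apart.
    have hle : v' ≤ u' + g := by
      by_contra! hc
      obtain ⟨c, c1, c2⟩ := hsh X hX
      obtain ⟨b, e1, e2, e3⟩ := exists_residue (u := u') c1
      have := hv1.1
      exact hnone b e1 (by omega) (c2 b (by omega) e3)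
    have hmem : arc g u' v' ∈ C := by
      simp only [C, Finset.mem_filter, Finset.mem_powerset]
      refine ⟨fun c hc => ?_, X, u', v', hX, hu1, hv1, by omega, hle, hnone, rfl⟩
      simp only [arc, Finset.mem_image, Finset.mem_Ioo] at hc
      obtain ⟨l, hl, rfl⟩ := hc
      rw [Finset.mem_range]
      exact Nat.mod_lt _ (by omega)
    have hiC : i % g ∈ C'.biUnion id := by
      rw [hun, Finset.mem_biUnion]
      refine ⟨_, hmem, ?_⟩
      simp only [arc, id, Finset.mem_image, Finset.mem_Ioo]
      exact ⟨i, ⟨hu2, hv2⟩, rfl⟩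
    rw [Finset.mem_biUnion] at hiC
    obtain ⟨A, hA, hiA⟩ := hiC
    have := hv1.1
    exact b3 A hA P' T' hS (hL _ (List.mem_map.2 ⟨A, Finset.mem_toList.2 hA, rfl⟩)) i (by omega) hiA

/-- The deletion of `P[x]`. -/
def deletion (lo x : ℕ) : List (ℕ × ℕ) := [(x, lo), (x + 1, lo)]

theorem _root_.EditMatching.Agree.of_deletion {x : ℕ} (hA : Agree P T P' T' (deletion lo x)) :
    P'[x]? = P[x]? :=
  ((hA ((x, lo), (x + 1, lo)) (by simp [deletion, steps])).2 (.inl rfl)).1 rfl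

theorem deletion_boxed {x : ℕ} (hx : x < P.length) (hle : lo ≤ hi) :
    Boxed P lo hi (deletion lo x) :=
  ⟨_, _, .cons (.inr (.inl rfl)) (.single _), le_rfl, hx, hle⟩

theorem cost_deletion_le (x : ℕ) : cost P T (deletion lo x) ≤ 1 :=
  List.countP_le_length

/-- Deletions determine the black characters of `P` close to its ends. -/
theorem exists_deletions (hM : 0 < sizeP P T S) (hle : lo ≤ hi) (K : ℕ) :
    ∃ L : List (List (ℕ × ℕ)), (∀ B ∈ L, Boxed P lo hi B) ∧
    (L.map (fun B => cost P T B + 1)).sum ≤ 4 * K ∧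
    ∀ P' T', (∀ B ∈ L, Agree P T P' T' B) → ∀ i < sizeP P T S,
      (i < K ∨ sizeP P T S - 1 - i < K) → Known P T P' S i := by
  refine ⟨(List.range K).map (fun e => deletion lo (posP P T S (min e (sizeP P T S - 1)))) ++
    (List.range K).map (fun e => deletion lo (posP P T S (sizeP P T S - 1 - e))), ?_, ?_, ?_⟩
  · intro B hB
    simp only [List.mem_append, List.mem_map] at hB
    rcases hB with ⟨e, _, rfl⟩ | ⟨e, _, rfl⟩ <;>
      exact deletion_boxed (posP_spec (by omega)).1.1 hle
  · have key : ∀ f : ℕ → ℕ, (((List.range K).map (fun e => deletion lo (f e))).map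
        (fun B => cost P T B + 1)).sum ≤ 2 * K := by
      intro f
      refine (List.sum_le_card_nsmul _ 2 ?_).trans (by simp [Nat.mul_comm])
      intro x hx
      simp only [List.mem_map] at hx
      obtain ⟨_, ⟨e, _, rfl⟩, rfl⟩ := hx
      have := cost_deletion_le (P := P) (T := T) (lo := lo) (f e)
      omega
    rw [List.map_append, List.sum_append]
    have h1 := key (fun e => posP P T S (min e (sizeP P T S - 1)))
    have h2 := key (fun e => posP P T S (sizeP P T S - 1 - e))
    omega
  · intro P' T' hL i hi1 hi2
    rcases hi2 with hi2 | hi2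
    · have := hL (deletion lo (posP P T S (min i (sizeP P T S - 1))))
        (List.mem_append_left _ (List.mem_map.2 ⟨i, List.mem_range.2 hi2, rfl⟩))
      rw [show min i (sizeP P T S - 1) = i by omega] at this
      exact this.of_deletion
    · have := hL (deletion lo (posP P T S (sizeP P T S - 1 - (sizeP P T S - 1 - i))))
        (List.mem_append_right _ (List.mem_map.2 ⟨_, List.mem_range.2 hi2, rfl⟩))
      rw [show sizeP P T S - 1 - (sizeP P T S - 1 - i) = i by omega] at this
      exact this.of_deletion

include h hF hsh in
-- `B` is an alignment whose first shared match comes latest: the indices before it include all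
-- those before the first shared match of any other alignment. A chain along `B` can leave this
-- range only to the left, where `index_lt_of_before` and the deletions apply.
theorem exists_first (hne : ∃ X, F X) : ∃ B, F B ∧ ∀ P' T', (∀ A ∈ S, Agree P T P' T' A) →
    Agree P T P' T' B → (∀ i < sizeP P T S, i < S.card * k + k → Known P T P' S i) →
    ∀ X, F X → ∀ i, (∀ i' ≤ i, ¬ SharedAt P T lo hi S X (jj X) i') → Known P T P' S i := by
  classical
  have hgM := h.period_le
  have hfirst : ∀ X, F X → ∃ v, SharedAt P T lo hi S X (jj X) v ∧
      ∀ i < v, ¬ SharedAt P T lo hi S X (jj X) i := by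
    intro X hX
    obtain ⟨c, c1, c2⟩ := hsh X hX
    have hex : ∃ v, SharedAt P T lo hi S X (jj X) v :=
      ⟨c, c2 c (by omega) (Nat.mod_eq_of_lt c1)⟩
    exact ⟨Nat.find hex, Nat.find_spec hex, fun i hi => Nat.find_min hex hi⟩
  obtain ⟨X₀, hX₀⟩ := hne
  obtain ⟨v₀, hv₀⟩ := hfirst X₀ hX₀
  obtain ⟨⟨B, v⟩, ⟨hB, hv, hlt⟩, hmax⟩ := exists_maximum
    (p := fun b : List (ℕ × ℕ) × ℕ => F b.1 ∧ SharedAt P T lo hi S b.1 (jj b.1) b.2 ∧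
      ∀ i < b.2, ¬ SharedAt P T lo hi S b.1 (jj b.1) i) ⟨(X₀, v₀), hX₀, hv₀⟩ Prod.snd
    (K := sizeP P T S) (fun b hb => hb.2.1.1.le)
  simp only at hB hv hlt
  refine ⟨B, hB, fun P' T' hS hag hrev X hX i hi' => ?_⟩
  obtain ⟨w, hw1, hw2⟩ := hfirst X hX
  have hwv := hmax (X, w) ⟨hX, hw1, hw2⟩
  have hiw : i < w := by
    by_contra! hc
    exact hi' w hc hw1
  simp only at hwv
  refine h.known_of_unshared hS (hF B hB) hag hv.1.le (u := 0) (j := jj B)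
    (fun _ _ _ s hs _ _ => hs) (fun i _ h2 => hlt i h2) ?_ i (Nat.zero_le _) (by omega)
  intro i t _ h2 ht hm
  have hvM := hv.1
  have q2 := (hF B hB).index_lt hv.1 ht hm hv.2.2 h2
  by_cases hjt : t < jj B * period P T lo hi S
  · left
    obtain ⟨c, c1, c2⟩ := hsh B hB
    exact hrev i (by omega) (h.index_lt_of_before (hF B hB) c1
      (c2 c (by omega) (Nat.mod_eq_of_lt c1)) hjt hm (by omega))
  · exact .inr ⟨t - jj B * period P T lo hi S, by omega, by omega, by omega⟩

include h hF hsh in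
-- Mirror image: `B` is an alignment whose last shared match comes earliest, and chains can leave
-- only to the right.
theorem exists_last (hne : ∃ X, F X) : ∃ B, F B ∧ ∀ P' T', (∀ A ∈ S, Agree P T P' T' A) →
    Agree P T P' T' B →
    (∀ i < sizeP P T S, sizeP P T S - 1 - i < S.card * k + k → Known P T P' S i) →
    ∀ X, F X → ∀ i < sizeP P T S,
      (∀ i', i ≤ i' → ¬ SharedAt P T lo hi S X (jj X) i') → Known P T P' S i := by
  classical
  have hgM := h.period_le
  have hlast : ∀ X, F X → ∃ u, SharedAt P T lo hi S X (jj X) u ∧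
      ∀ i, u < i → ¬ SharedAt P T lo hi S X (jj X) i := by
    intro X hX
    obtain ⟨c, c1, c2⟩ := hsh X hX
    obtain ⟨u, hu, hmax⟩ := exists_maximum (p := fun v => SharedAt P T lo hi S X (jj X) v)
      ⟨c, c2 c (by omega) (Nat.mod_eq_of_lt c1)⟩ id (K := sizeP P T S) (fun b hb => hb.1.le)
    exact ⟨u, hu, fun i hi h' => absurd (hmax i h') (by simp only [id]; omega)⟩
  obtain ⟨X₀, hX₀⟩ := hne
  obtain ⟨v₀, hv₀⟩ := hlast X₀ hX₀
  obtain ⟨⟨B, u⟩, ⟨hB, hu, hlt⟩, hmax⟩ := exists_maximum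
    (p := fun b : List (ℕ × ℕ) × ℕ => F b.1 ∧ SharedAt P T lo hi S b.1 (jj b.1) b.2 ∧
      ∀ i, b.2 < i → ¬ SharedAt P T lo hi S b.1 (jj b.1) i) ⟨(X₀, v₀), hX₀, hv₀⟩
    (fun b => sizeP P T S - b.2) (K := sizeP P T S) (fun b _ => Nat.sub_le _ _)
  simp only at hB hu hlt
  refine ⟨B, hB, fun P' T' hS hag hrev X hX i hiM hi' => ?_⟩
  obtain ⟨w, hw1, hw2⟩ := hlast X hX
  have hwv := hmax (X, w) ⟨hX, hw1, hw2⟩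
  have hiw : w < i := by
    by_contra! hc
    exact hi' w hc hw1
  have hu1 := hu.1
  simp only at hwv
  refine h.known_of_unshared hS (hF B hB) hag le_rfl (u := u + 1) (j := jj B)
    (fun _ _ _ s hs _ _ => hs) (fun i h2 _ => hlt i h2) ?_ i (by omega) hiM
  intro i t h1 h2 ht hm
  have q2 := (hF B hB).index_lt h2 hu.2.1 hu.2.2 hm h1
  by_cases hjt : sizeP P T S + jj B * period P T lo hi S ≤ t
  · left
    obtain ⟨c, c1, c2⟩ := hsh B hB
    exact hrev i h2 (h.index_lt_of_after (hF B hB) c1 c2 hjt ht hm h2)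
  · exact .inr ⟨t - jj B * period P T lo hi S, by omega, by omega, by omega⟩

include hF in
/-- What an alignment tells about the black characters of `T` before or after the image of `P`. -/
theorem knownT_of_agree (hS : ∀ A ∈ S, Agree P T P' T' A) {B : List (ℕ × ℕ)} (hB : F B)
    (hag : Agree P T P' T' B) {t : ℕ} (ht : t < sizeT P T lo hi S)
    (h1 : rankT P T lo hi S (start B) ≤ t) (h2 : t < rankT P T lo hi S (finish B))
    (hrev : ∀ i < sizeP P T S, Matched P T B (posP P T S i) (posT P T lo hi S t) →
      Known P T P' S i) :
    T'[posT P T lo hi S t]? = T[posT P T lo hi S t]? := by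
  obtain ⟨hb, hbt⟩ := posT_spec ht
  have hy1 : start B ≤ posT P T lo hi S t := by
    by_contra! hc
    have := rankT_lt hb hc
    omega
  have hy2 : posT P T lo hi S t < finish B := by
    by_contra! hc
    have := rankT_mono (P := P) (T := T) (S := S) (lo := lo) (hi := hi) hc
    omega
  rcases (hF B hB).route.matched_or_edit_snd (X := P) (Y := T) hy1 hy2 with
    ⟨x, hx⟩ | ⟨s, hs, s1, s2, s3⟩
  · have hxlt := ((hF B hB).matched_bounds hx).1
    rw [← hag.eq_of_matched hx, ← hx.2]
    by_cases hxb : BlackP P T S x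
    · rw [← posP_rankP hxb] at hx ⊢
      exact hrev _ (rankP_lt_size hxb) hx
    · exact knownP_of_not_black hS hxlt hxb
  · rw [← s2] at s3 ⊢
    exact ((hag s hs).2 s1).2 s3

include h hF hsh in
-- `B` reaches furthest, in ranks, to the left of its own image `j * g` of index `0`. Each rank that
-- `X` reaches there corresponds to the rank of `B` at the same distance before its image, which is
-- congruent modulo the period. A black character of `P` matched by `B` to it is close to the left
-- end and hence known.
theorem exists_before (hne : ∃ X, F X) : ∃ B, F B ∧ ∀ P' T', (∀ A ∈ S, Agree P T P' T' A) →
    Agree P T P' T' B → (∀ i < sizeP P T S, i < S.card * k + k → Known P T P' S i) →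
    ∀ X, F X → ∀ t, rankT P T lo hi S (start X) ≤ t → t < jj X * period P T lo hi S →
      T'[posT P T lo hi S t]? = T[posT P T lo hi S t]? := by
  have hgM := h.period_le
  have hbound : ∀ X, F X → jj X * period P T lo hi S < rankT P T lo hi S (finish X) := by
    intro X hX
    obtain ⟨c, c1, c2⟩ := hsh X hX
    obtain ⟨_, e2, e3⟩ := c2 c (by omega) (Nat.mod_eq_of_lt c1)
    have := ((hF X hX).route.bounds e3.1).2.2
    obtain ⟨p1, p2⟩ := posT_spec e2
    have := rankT_lt p1 (show _ < finish X from this)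
    omega
  have hN : ∀ X, F X → rankT P T lo hi S (finish X) ≤ sizeT P T lo hi S := fun X hX =>
    rankT_mono (hF X hX).le_hi
  obtain ⟨B, hB, hmax⟩ := exists_maximum hne
    (fun X => jj X * period P T lo hi S - rankT P T lo hi S (start X))
    (K := sizeT P T lo hi S) (fun X hX => by
      have := hbound X hX
      have := hN X hX
      omega)
  refine ⟨B, hB, fun P' T' hS hag hrev X hX t h1 h2 => ?_⟩
  have hXmax := hmax X hX
  have b1 := hbound X hX
  have b2 := hbound B hB
  have b3 := hN X hX
  have b4 := hN B hB
  have hlt : jj B * period P T lo hi S - (jj X * period P T lo hi S - t) <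
      jj B * period P T lo hi S := by omega
  have key := knownT_of_agree hF hS hB hag
    (t := jj B * period P T lo hi S - (jj X * period P T lo hi S - t)) (by omega) (by omega)
    (by omega) (by
      intro i hi' hm
      obtain ⟨c, c1, c2⟩ := hsh B hB
      exact hrev i hi' (h.index_lt_of_before (hF B hB) c1
        (c2 c (by omega) (Nat.mod_eq_of_lt c1)) hlt hm hi'))
  have hg0 : 0 < period P T lo hi S := by
    obtain ⟨c, c1, _⟩ := hsh B hB
    omega
  have hmod := Nat.mod_lt t hg0
  have hcong : (jj B * period P T lo hi S - (jj X * period P T lo hi S - t)) %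
      period P T lo hi S = t % period P T lo hi S := by
    have e1 : jj B * period P T lo hi S - (jj X * period P T lo hi S - t) +
        jj X * period P T lo hi S = t + jj B * period P T lo hi S := by omega
    rw [← Nat.add_mul_mod_self_right, e1, Nat.add_mul_mod_self_right]
  have k1 := (h.knownT_iff hS (show t % period P T lo hi S < sizeP P T S by omega) (by omega)
    (by rw [Nat.mod_mod, hcong])).1 key
  exact (h.knownT_iff hS (by omega) (by omega) (Nat.mod_mod _ _)).2 k1

include h hF hsh in
-- The same for an alignment that reaches furthest beyond the image `sizeP + j * g` of the right
-- end.
theorem exists_after (hne : ∃ X, F X) : ∃ B, F B ∧ ∀ P' T', (∀ A ∈ S, Agree P T P' T' A) →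
    Agree P T P' T' B →
    (∀ i < sizeP P T S, sizeP P T S - 1 - i < S.card * k + k → Known P T P' S i) →
    ∀ X, F X → ∀ t, sizeP P T S + jj X * period P T lo hi S ≤ t →
      t < rankT P T lo hi S (finish X) →
      T'[posT P T lo hi S t]? = T[posT P T lo hi S t]? := by
  have hgM := h.period_le
  have hbound : ∀ X, F X → rankT P T lo hi S (start X) ≤
      sizeP P T S + jj X * period P T lo hi S := by
    intro X hX
    obtain ⟨c, c1, c2⟩ := hsh X hX
    obtain ⟨_, e2, e3⟩ := c2 c (by omega) (Nat.mod_eq_of_lt c1)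
    have := ((hF X hX).route.bounds e3.1).1.2
    obtain ⟨p1, p2⟩ := posT_spec e2
    have := rankT_mono (P := P) (T := T) (S := S) (lo := lo) (hi := hi)
      (show start X ≤ posT P T lo hi S (c + jj X * period P T lo hi S) from this)
    omega
  have hN : ∀ X, F X → rankT P T lo hi S (finish X) ≤ sizeT P T lo hi S := fun X hX =>
    rankT_mono (hF X hX).le_hi
  obtain ⟨B, hB, hmax⟩ := exists_maximum hne
    (fun X => rankT P T lo hi S (finish X) - (sizeP P T S + jj X * period P T lo hi S))
    (K := sizeT P T lo hi S) (fun X hX => by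
      have := hN X hX
      omega)
  refine ⟨B, hB, fun P' T' hS hag hrev X hX t h1 h2 => ?_⟩
  have hXmax := hmax X hX
  have b2 := hbound B hB
  have b3 := hN X hX
  have b4 := hN B hB
  have hle : sizeP P T S + jj B * period P T lo hi S ≤ sizeP P T S + jj B * period P T lo hi S +
      (t - (sizeP P T S + jj X * period P T lo hi S)) := by omega
  have hlt : sizeP P T S + jj B * period P T lo hi S +
      (t - (sizeP P T S + jj X * period P T lo hi S)) < sizeT P T lo hi S := by omega
  have key := knownT_of_agree hF hS hB hag hlt (by omega) (by omega) (by
      intro i hi' hm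
      obtain ⟨c, c1, c2⟩ := hsh B hB
      exact hrev i hi' (h.index_lt_of_after (hF B hB) c1 c2 hle hlt hm hi'))
  have hg0 : 0 < period P T lo hi S := by
    obtain ⟨c, c1, _⟩ := hsh B hB
    omega
  have hmod := Nat.mod_lt t hg0
  have hcong : (sizeP P T S + jj B * period P T lo hi S +
      (t - (sizeP P T S + jj X * period P T lo hi S))) %
      period P T lo hi S = t % period P T lo hi S := by
    have e1 : sizeP P T S + jj B * period P T lo hi S +
      (t - (sizeP P T S + jj X * period P T lo hi S)) +
        jj X * period P T lo hi S = t + jj B * period P T lo hi S := by omega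
    rw [← Nat.add_mul_mod_self_right, e1, Nat.add_mul_mod_self_right]
  have k1 := (h.knownT_iff hS (show t % period P T lo hi S < sizeP P T S by omega) hlt
    (by rw [Nat.mod_mod, hcong])).1 key
  exact (h.knownT_iff hS (by omega) (by omega) (Nat.mod_mod _ _)).2 k1

end Enclosing

end Certificate

/-! ### The certificate of a window. -/

section Window

variable {α : Type u}

/-- `X` is an optimal alignment of cost at most `k` of `P` onto a fragment of `T` that starts in
`[a, a + W)`. -/
structure InWindow (P T : List α) (k a W : ℕ) (X : List (ℕ × ℕ)) : Prop where
  route : Route (0, start X) (P.length, finish X) X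
  le_start : a ≤ start X
  start_lt : start X < a + W
  finish_le : finish X ≤ T.length
  optimal : IsOptimalAlignment P T (start X) (finish X) X
  cost_le : cost P T X ≤ k

theorem sum_cost_le {P T : List α} {k : ℕ} {S : Finset (List (ℕ × ℕ))}
    (h : ∀ A ∈ S, cost P T A ≤ k) :
    (S.toList.map (fun B => cost P T B + 1)).sum ≤ S.card * (k + 1) := by
  refine (List.sum_le_card_nsmul _ (k + 1) ?_).trans (by simp)
  intro x hx
  simp only [List.mem_map, Finset.mem_toList] at hx
  obtain ⟨A, hA, rfl⟩ := hx
  have := h A hA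
  omega

/-- If nothing is black, `S` suffices. Otherwise the cost is the sum of `S`, the interior pieces (`8
|S| k`), the deletions (`4 (|S| k + k)`) and four alignments of cost at most `k`. An unshared index
has shared indices on both sides, or lies before the first, or after the last one, and each case has
been provided for. -/
theorem Enclosing.exists_certificate {P T : List α} {k lo hi : ℕ} {S : Finset (List (ℕ × ℕ))}
    (h : Enclosing P T k lo hi S) {F : List (ℕ × ℕ) → Prop} (hne : ∃ X, F X)
    (hF : ∀ X, F X → Fits P T k lo hi X)
    (hopt : ∀ X, F X → IsOptimalAlignment P T (start X) (finish X) X)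
    (hsat : sizeP P T S = 0 ∨
      ∀ X, F X → ¬ 2 * classes P T lo hi (Insert.insert X S) ≤ classes P T lo hi S) :
    ∃ L : List (List (ℕ × ℕ)), (∀ B ∈ L, Boxed P lo hi B) ∧
      (L.map (fun B => cost P T B + 1)).sum ≤
        S.card * (k + 1) + 12 * (S.card * k) + 8 * k + 4 ∧
      ∀ P' T', (∀ B ∈ L, Agree P T P' T' B) → ∀ X, F X → Agree P T P' T' X := by
  have hScost := sum_cost_le fun A hA => (h.fits A hA).cost_le
  rcases Nat.eq_zero_or_pos (sizeP P T S) with h0 | hM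
  · refine ⟨S.toList, fun B hB => (h.fits B (Finset.mem_toList.1 hB)).boxed, by omega, ?_⟩
    intro P' T' hL X hX
    have hT0 := h.sizeT_eq_zero h0
    exact agree_of_known h (fun A hA => hL A (Finset.mem_toList.2 hA)) (hF X hX) (j := 0)
      (fun i hi' => by omega) (fun t ht => by omega)
  · have hsh : ∀ X, F X → ∃ j, ∃ c < period P T lo hi S, ∀ i < sizeP P T S,
        i % period P T lo hi S = c → SharedAt P T lo hi S X j i := by
      intro X hX
      obtain ⟨j, c, h1, h2⟩ := h.exists_shared (hF X hX) hM (hsat.resolve_left hM.ne' X hX)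
      exact ⟨j, c, h1, fun i h3 h4 => ⟨h3, h2 i h3 h4⟩⟩
    choose! jj hsh using hsh
    have hle : lo ≤ hi := by
      obtain ⟨X, hX⟩ := hne
      have h1 := (hF X hX).route.le
      have h2 := (hF X hX).lo_le
      have h3 := (hF X hX).le_hi
      simp only at h1
      omega
    obtain ⟨L₁, a1, a2, a3⟩ := h.exists_interior hF hopt hsh
    obtain ⟨L₂, b1, b2, b3⟩ := exists_deletions (P := P) (T := T) (S := S) hM hle (S.card * k + k)
    obtain ⟨B₁, c1, c2⟩ := h.exists_first hF hsh hne
    obtain ⟨B₂, d1, d2⟩ := h.exists_last hF hsh hne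
    obtain ⟨B₃, e1, e2⟩ := h.exists_before hF hsh hne
    obtain ⟨B₄, f1, f2⟩ := h.exists_after hF hsh hne
    refine ⟨S.toList ++ (L₁ ++ (L₂ ++ [B₁, B₂, B₃, B₄])), ?_, ?_, ?_⟩
    · intro B hB
      simp only [List.mem_append, List.mem_cons, List.not_mem_nil, or_false] at hB
      rcases hB with hB | hB | hB | rfl | rfl | rfl | rfl
      · exact (h.fits B (Finset.mem_toList.1 hB)).boxed
      · exact a1 B hB
      · exact b1 B hB
      · exact (hF _ c1).boxed
      · exact (hF _ d1).boxed
      · exact (hF _ e1).boxed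
      · exact (hF _ f1).boxed
    · simp only [List.map_append, List.sum_append, List.map_cons, List.map_nil, List.sum_cons,
        List.sum_nil]
      have := (hF _ c1).cost_le
      have := (hF _ d1).cost_le
      have := (hF _ e1).cost_le
      have := (hF _ f1).cost_le
      omega
    · intro P' T' hL X hX
      simp only [List.mem_append, List.mem_cons, List.not_mem_nil, or_false] at hL
      have hS : ∀ A ∈ S, Agree P T P' T' A := fun A hA => hL A (.inl (Finset.mem_toList.2 hA))
      have a3 := a3 P' T' hS (fun B hB => hL B (.inr (.inl hB)))
      have b3 := b3 P' T' (fun B hB => hL B (.inr (.inr (.inl hB))))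
      have b4 : ∀ i < sizeP P T S, i < S.card * k + k → Known P T P' S i :=
        fun i h1 h2 => b3 i h1 (.inl h2)
      have b5 : ∀ i < sizeP P T S, sizeP P T S - 1 - i < S.card * k + k → Known P T P' S i :=
        fun i h1 h2 => b3 i h1 (.inr h2)
      have c2 := c2 P' T' hS (hL _ (by simp)) b4 X hX
      have d2 := d2 P' T' hS (hL _ (by simp)) b5 X hX
      have e2 := e2 P' T' hS (hL _ (by simp)) b4 X hX
      have f2 := f2 P' T' hS (hL _ (by simp)) b5 X hX
      refine agree_of_known h hS (hF X hX) (j := jj X) ?_ ?_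
      · intro i hi'
        by_cases hsi : SharedAt P T lo hi S X (jj X) i
        · exact .inl hsi
        right
        by_cases hlow : ∃ u < i, SharedAt P T lo hi S X (jj X) u
        · by_cases hup : ∃ v, i < v ∧ SharedAt P T lo hi S X (jj X) v
          · obtain ⟨u, hu, hu'⟩ := hlow
            obtain ⟨v, hv, hv'⟩ := hup
            exact a3 X hX u i v hu' hv' hsi hu hv
          · push Not at hup
            refine d2 i hi' fun i' h1 => ?_
            rcases h1.eq_or_lt with rfl | h1
            · exact hsi
            · exact hup i' h1
        · push Not at hlow
          refine c2 i fun i' h1 => ?_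
          rcases h1.eq_or_lt with rfl | h1
          · exact hsi
          · exact hlow i' h1
      · intro t ht h1 h2
        by_cases h3 : t < jj X * period P T lo hi S
        · exact .inr (e2 t h1 h3)
        · by_cases h4 : sizeP P T S + jj X * period P T lo hi S ≤ t
          · exact .inr (f2 t h4 h2)
          · exact .inl ⟨t - jj X * period P T lo hi S, by omega, by omega⟩

/-- A few alignments of small total cost determine the edits of all alignments in a window. -/
theorem exists_certificate (P T : List α) {k a W : ℕ} (hk : 1 ≤ k) (hkm : 16 * k ≤ P.length)
    (hW : 4 * W ≤ P.length) :
    ∃ L : List (List (ℕ × ℕ)),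
      (∀ B ∈ L, Boxed P a (min T.length (a + 2 * P.length)) B) ∧
      (L.map (fun B => cost P T B + 1)).sum ≤ 54 * (Nat.size P.length * k) ∧
      ∀ P' T', (∀ B ∈ L, Agree P T P' T' B) → ∀ X, InWindow P T k a W X → Agree P T P' T' X := by
  classical
  by_cases hne : ∃ X, InWindow P T k a W X
  swap
  · push Not at hne
    exact ⟨[], by simp, by simp, fun _ _ _ X hX => absurd hX (hne X)⟩
  -- The enclosing interval runs from the leftmost start to the rightmost end among the alignments
  -- of the window.
  obtain ⟨X₁, h1, hmin⟩ := exists_maximum hne (fun X => T.length - start X) (K := T.length)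
    (fun _ _ => Nat.sub_le _ _)
  obtain ⟨X₂, h2, hmax⟩ := exists_maximum hne finish (K := T.length) (fun _ hX => hX.finish_le)
  have hF : ∀ X, InWindow P T k a W X → Fits P T k (start X₁) (finish X₂) X := by
    intro X hX
    have hr := hX.route.le
    have := hX.finish_le
    have := hmin X hX
    have hr1 := h1.route.le
    have := h1.finish_le
    simp only at hr hr1 this
    exact ⟨hX.route, by omega, hmax X hX, hX.cost_le⟩
  have hd := (hF X₂ h2).length_diff
  have h3 := h2.start_lt
  have h4 := h1.le_start
  have henc : Enclosing P T k (start X₁) (finish X₂) {X₁, X₂} := by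
    -- Here `hi < a + W + |P| + k` and `lo ≥ a`, so `size` follows from `4 * W ≤ |P|` and `16 * k ≤
    -- |P|`.
    refine ⟨h2.finish_le, ?_, ⟨X₁, by simp, rfl⟩, ⟨X₂, by simp, rfl⟩, by omega⟩
    intro A hA
    rcases Finset.mem_insert.1 hA with rfl | hA
    · exact hF _ h1
    · rw [Finset.mem_singleton.1 hA]
      exact hF _ h2
  obtain ⟨S, s1, s2, s3, s4⟩ := henc.exists_saturated hF (by
    intro A hA
    rcases Finset.mem_insert.1 hA with rfl | hA
    · exact h1
    · rw [Finset.mem_singleton.1 hA]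
      exact h2)
  obtain ⟨L, l1, l2, l3⟩ := s1.exists_certificate hne hF (fun X hX => hX.optimal) s4
  refine ⟨L, ?_, l2.trans ?_, l3⟩
  · intro B hB
    obtain ⟨p, q, b1, b2, b3, b4⟩ := l1 B hB
    have := h2.finish_le
    exact ⟨p, q, b1, by omega, b3, by omega⟩
  -- With `s = Nat.size |P|` and `|S| ≤ 2 + s`, the bound `13 |S| k + |S| + 8 k + 4` is at most `54
  -- s k`, as `s` and `k` are positive.
  · have c1 : ({X₁, X₂} : Finset (List (ℕ × ℕ))).card ≤ 2 := Finset.card_le_two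
    have c2 : Nat.size (classes P T (start X₁) (finish X₂) {X₁, X₂}) ≤ Nat.size P.length :=
      Nat.size_le_size henc.classes_le
    have c3 : S.card ≤ 2 + Nat.size P.length := by omega
    have c4 : 0 < Nat.size P.length := Nat.size_pos.2 (by omega)
    have c5 := Nat.mul_le_mul_right k c3
    have c6 := Nat.mul_le_mul_right k (show 1 ≤ Nat.size P.length from c4)
    rw [Nat.mul_add, Nat.mul_one]
    rw [Nat.add_mul] at c5
    have c7 : Nat.size P.length ≤ Nat.size P.length * k := Nat.le_mul_of_pos_right _ hk
    omega

end Window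

/-! ### Self-delimiting binary codes. -/

section Codes

variable {β γ : Type*}

/-- `e` is an injective encoding that can be decoded from any extension. -/
def PrefixCode (e : β → List Bool) : Prop :=
  ∀ a b r r', e a ++ r = e b ++ r' → a = b ∧ r = r'

def codeList (e : β → List Bool) : List β → List Bool
  | [] => [false]
  | a :: l => true :: (e a ++ codeList e l)

def codeProd (e : β → List Bool) (f : γ → List Bool) (p : β × γ) : List Bool := e p.1 ++ f p.2

def codeOption (e : β → List Bool) : Option β → List Bool
  | none => [false]
  | some a => true :: e a

def codeNat (n : ℕ) : List Bool := codeList (fun b => [b]) n.bits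

theorem PrefixCode.list {e : β → List Bool} (h : PrefixCode e) : PrefixCode (codeList e) := by
  intro a
  induction a with
  | nil =>
    intro b r r' heq
    cases b with
    | nil => simpa [codeList] using heq
    | cons b l => simp [codeList] at heq
  | cons a l ih =>
    intro b r r' heq
    cases b with
    | nil => simp [codeList] at heq
    | cons b l' =>
      simp only [codeList, List.cons_append, List.cons.injEq, true_and, List.append_assoc] at heq
      obtain ⟨rfl, h1⟩ := h _ _ _ _ heq
      obtain ⟨rfl, h2⟩ := ih _ _ _ h1
      exact ⟨rfl, h2⟩

theorem PrefixCode.prod {e : β → List Bool} {f : γ → List Bool} (he : PrefixCode e)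
    (hf : PrefixCode f) : PrefixCode (codeProd e f) := by
  rintro ⟨a, c⟩ ⟨b, d⟩ r r' heq
  simp only [codeProd, List.append_assoc] at heq
  obtain ⟨rfl, h1⟩ := he _ _ _ _ heq
  obtain ⟨rfl, h2⟩ := hf _ _ _ _ h1
  exact ⟨rfl, h2⟩

theorem PrefixCode.option {e : β → List Bool} (h : PrefixCode e) : PrefixCode (codeOption e) := by
  rintro (_ | a) (_ | b) r r' heq
  · simpa [codeOption] using heq
  · simp [codeOption] at heq
  · simp [codeOption] at heq
  · simp only [codeOption, List.cons_append, List.cons.injEq, true_and] at heq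
    obtain ⟨rfl, h1⟩ := h _ _ _ _ heq
    exact ⟨rfl, h1⟩

theorem bits_injective : Function.Injective Nat.bits := by
  have h : ∀ n : ℕ, n.bits.foldr Nat.bit 0 = n := by
    intro n
    induction n using Nat.binaryRec' with
    | zero => simp
    | bit b n hn ih => rw [Nat.bits_append_bit _ _ hn, List.foldr_cons, ih]
  exact Function.LeftInverse.injective h

theorem prefixCode_nat : PrefixCode codeNat := by
  intro a b r r' heq
  have h : PrefixCode (fun b : Bool => [b]) := by
    intro a b r r' h
    simpa using h
  obtain ⟨h1, h2⟩ := h.list _ _ _ _ heq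
  exact ⟨bits_injective h1, h2⟩

theorem length_codeList (e : β → List Bool) (l : List β) :
    (codeList e l).length = (l.map (fun a => (e a).length + 1)).sum + 1 := by
  induction l with
  | nil => simp [codeList]
  | cons a l ih =>
    simp only [codeList, List.length_cons, List.length_append, ih, List.map_cons, List.sum_cons]
    omega

theorem length_codeList_le {e : β → List Bool} {l : List β} {K : ℕ}
    (h : ∀ a ∈ l, (e a).length ≤ K) : (codeList e l).length ≤ l.length * (K + 1) + 1 := by
  rw [length_codeList]
  have : (l.map (fun a => (e a).length + 1)).sum ≤ (l.map (fun a => (e a).length + 1)).length •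
      (K + 1) := by
    refine List.sum_le_card_nsmul _ _ ?_
    intro x hx
    obtain ⟨a, ha, rfl⟩ := List.mem_map.1 hx
    have := h a ha
    omega
  simp only [List.length_map, smul_eq_mul] at this
  omega

theorem length_codeNat (n : ℕ) : (codeNat n).length = 2 * n.size + 1 := by
  rw [codeNat, length_codeList, ← Nat.size_eq_bits_len]
  simp
  omega

theorem length_codeNat_le {n K : ℕ} (h : n ≤ K) : (codeNat n).length ≤ 2 * K.size + 1 := by
  have := Nat.size_le_size h
  rw [length_codeNat]
  omega

end Codes

/-! ### Recovering an alignment from its ends and its edits. -/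

section Data

variable {α : Type u}

open Classical in
/-- The edits of an alignment in order, with rows counted from `a`. -/
noncomputable def editList (a : ℕ) (P T : List α) (A : List (ℕ × ℕ)) :
    List (ℕ × Option α × ℕ × Option α) :=
  ((steps A).filter (fun s => decide (IsEdit P T s))).map
    (fun s => (s.1.1, readChar P s.1.1 s.2.1, s.1.2 - a, readChar T s.1.2 s.2.2))

theorem length_editList (a : ℕ) (P T : List α) (A : List (ℕ × ℕ)) :
    (editList a P T A).length = cost P T A := by
  rw [editList, List.length_map, cost, List.countP_eq_length_filter]

theorem editList_cons_of_edit {a : ℕ} {P T : List α} {p r q : ℕ × ℕ} {A : List (ℕ × ℕ)}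
    (h : Route r q A) (he : IsEdit P T (p, r)) : editList a P T (p :: A) =
      (p.1, readChar P p.1 r.1, p.2 - a, readChar T p.2 r.2) :: editList a P T A := by
  simp [editList, h.steps_cons, he]

theorem editList_cons_of_not {a : ℕ} {P T : List α} {p r q : ℕ × ℕ} {A : List (ℕ × ℕ)}
    (h : Route r q A) (he : ¬ IsEdit P T (p, r)) : editList a P T (p :: A) =
      editList a P T A := by
  simp [editList, h.steps_cons, he]

theorem readChar_isSome {X : List α} {x x' : ℕ} (h : x' ≤ X.length) :
    (readChar X x x').isSome ↔ x' = x + 1 := by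
  unfold readChar
  split_ifs with h1
  · simp [h1]
    omega
  · simp [h1]

theorem Agree.cons {P T P' T' : List α} {p r q : ℕ × ℕ} {A : List (ℕ × ℕ)} (h : Route r q A)
    (h1 : IsEdit P T (p, r) ↔ IsEdit P' T' (p, r))
    (h2 : IsEdit P T (p, r) → (r.1 = p.1 + 1 → P'[p.1]? = P[p.1]?) ∧
      (r.2 = p.2 + 1 → T'[p.2]? = T[p.2]?)) (hA : Agree P T P' T' A) :
    Agree P T P' T' (p :: A) := by
  intro s hs
  rw [h.steps_cons, List.mem_cons] at hs
  rcases hs with rfl | hs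
  · exact ⟨h1, h2⟩
  · exact hA s hs

theorem Route.not_step_self {p r : ℕ × ℕ} {A : List (ℕ × ℕ)} (hs : Step p r)
    (h : Route r p A) : False := by
  have := h.le
  rcases hs with rfl | rfl | rfl <;> simp only at this <;> omega

/-- Its ends and its edits determine an alignment. -/
theorem Route.eq_and_agree {P T P' T' : List α} (hP : P.length = P'.length)
    (hT : T.length = T'.length) {a : ℕ} {p q : ℕ × ℕ} {A : List (ℕ × ℕ)} (h : Route p q A)
    (hq1 : q.1 ≤ P.length) (hq2 : q.2 ≤ T.length) :
    ∀ {A' : List (ℕ × ℕ)}, Route p q A' → editList a P T A = editList a P' T' A' →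
      A = A' ∧ Agree P T P' T' A := by
  induction h with
  | single p =>
    intro A' h' _
    cases h' with
    | single => exact ⟨rfl, fun s hs => by simp [steps] at hs⟩
    | cons hs h' => exact (h'.not_step_self hs).elim
  | @cons p r q A hs h ih =>
    intro A' h' heq
    cases h' with
    | single => exact (h.not_step_self hs).elim
    | @cons _ r' _ A' hs' h' =>
      have hrq := h.le
      have hrq' := h'.le
      -- After a diagonal step all later edits lie in larger columns, so a list beginning with an
      -- edit in the current column cannot arise; this excludes an edit in one input against a match
      -- in the other.
      have far : ∀ {Q U : List α} {B : List (ℕ × ℕ)} {e l}, Route (p.1 + 1, p.2 + 1) q B →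
          (p.1, e) :: l ≠ editList a Q U B := by
        intro Q U B e l hB heq
        have : (p.1, e) ∈ editList a Q U B := by rw [← heq]; simp
        simp only [editList, List.mem_map, List.mem_filter, Prod.mk.injEq] at this
        obtain ⟨s, ⟨hs, _⟩, h1, _⟩ := this
        have := (hB.bounds hs).1.1
        simp only at this
        omega
      rcases isEdit_or_eq (X := P) (Y := T) (s := (p, r)) hs with he | ⟨he, hr, heq1⟩ <;>
      rcases isEdit_or_eq (X := P') (Y := T') (s := (p, r')) hs' with he' | ⟨he', hr', heq2⟩
      · rw [editList_cons_of_edit h he, editList_cons_of_edit h' he', List.cons.injEq] at heq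
        obtain ⟨heq1, heq2⟩ := heq
        simp only [Prod.mk.injEq, true_and] at heq1
        obtain ⟨e1, e2⟩ := heq1
        have d1 := readChar_isSome (X := P) (x := p.1) (x' := r.1) (by omega)
        have d2 := readChar_isSome (X := P') (x := p.1) (x' := r'.1) (by omega)
        have d3 := readChar_isSome (X := T) (x := p.2) (x' := r.2) (by omega)
        have d4 := readChar_isSome (X := T') (x := p.2) (x' := r'.2) (by omega)
        rw [e1, d2] at d1
        rw [e2, d4] at d3
        have hrr : r = r' := by
          obtain ⟨r1, r2⟩ := r
          obtain ⟨r1', r2'⟩ := r'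
          simp only [Step, Prod.mk.injEq] at *
          omega
        subst hrr
        obtain ⟨rfl, hag⟩ := ih hq1 hq2 h' heq2
        refine ⟨rfl, hag.cons h (iff_of_true he he') fun _ => ⟨fun h3 => ?_, fun h3 => ?_⟩⟩
        · simpa [readChar, h3] using e1.symm
        · simpa [readChar, h3] using e2.symm
      · rw [editList_cons_of_edit h he, editList_cons_of_not h' he'] at heq
        simp only at hr'
        subst hr'
        exact (far h' heq).elim
      · rw [editList_cons_of_not h he, editList_cons_of_edit h' he'] at heq
        simp only at hr
        subst hr
        exact (far h heq.symm).elim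
      · rw [editList_cons_of_not h he, editList_cons_of_not h' he'] at heq
        simp only at hr hr'
        subst hr
        subst hr'
        obtain ⟨rfl, hag⟩ := ih hq1 hq2 h' heq
        exact ⟨rfl, hag.cons h (iff_of_false he he') fun h3 => absurd h3 he⟩

/-- The first and the last point of an alignment and its edits, with rows counted from `a`. -/
noncomputable def data (a : ℕ) (P T : List α) (A : List (ℕ × ℕ)) :
    (ℕ × ℕ) × (ℕ × ℕ) × List (ℕ × Option α × ℕ × Option α) :=
  (((A.headD (0, 0)).1, start A - a), ((A.getLastD (0, 0)).1, finish A - a), editList a P T A)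

theorem Route.data_eq {p q : ℕ × ℕ} {A : List (ℕ × ℕ)} (h : Route p q A) (a : ℕ)
    (P T : List α) : data a P T A = ((p.1, p.2 - a), (q.1, q.2 - a), editList a P T A) := by
  obtain ⟨h1, h2, _⟩ := h.isChain
  simp [data, start, finish, List.headD_eq_head?_getD, List.getLastD_eq_getLast?, h1, h2]

/-- Both paths stay in rows from `a` on, so the truncated subtraction of `a` loses nothing. -/
theorem Boxed.eq_and_agree {P T P' T' : List α} (hP : P.length = P'.length)
    (hT : T.length = T'.length) {a b : ℕ} {A A' : List (ℕ × ℕ)}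
    (h : Boxed P a (min T.length b) A) (h' : Boxed P' a (min T'.length b) A')
    (heq : data a P T A = data a P' T' A') : A = A' ∧ Agree P T P' T' A := by
  obtain ⟨p, q, h1, h2, h3, h4⟩ := h
  obtain ⟨p', q', h1', h2', h3', h4'⟩ := h'
  rw [h1.data_eq, h1'.data_eq] at heq
  simp only [Prod.mk.injEq] at heq
  obtain ⟨⟨e1, e2⟩, ⟨e3, e4⟩, e5⟩ := heq
  have hle := h1.le
  have hle' := h1'.le
  obtain rfl : p = p' := Prod.ext e1 (by omega)
  obtain rfl : q = q' := Prod.ext e3 (by omega)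
  exact h1.eq_and_agree hP hT h3 (by omega) h1' e5

theorem agree_of_map_data_eq {P T P' T' : List α} (hP : P.length = P'.length)
    (hT : T.length = T'.length) {a b : ℕ} : ∀ {L L' : List (List (ℕ × ℕ))},
    (∀ B ∈ L, Boxed P a (min T.length b) B) → (∀ B ∈ L', Boxed P' a (min T'.length b) B) →
    L.map (data a P T) = L'.map (data a P' T') → ∀ B ∈ L, Agree P T P' T' B
  | [], _, _, _, _ => by simp
  | A :: L, [], _, _, heq => by simp at heq
  | A :: L, A' :: L', h, h', heq => by
    simp only [List.map_cons, List.cons.injEq] at heq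
    intro B hB
    rcases List.mem_cons.1 hB with rfl | hB
    · exact ((h _ (by simp)).eq_and_agree hP hT (h' A' (by simp)) heq.1).2
    · exact agree_of_map_data_eq hP hT (fun B hB => h B (by simp [hB]))
        (fun B hB => h' B (by simp [hB])) heq.2 B hB

end Data

/-! ### Alice's message and its length in bits. -/

section Message

def codeEdit : ℕ × Option ℕ × ℕ × Option ℕ → List Bool :=
  codeProd codeNat (codeProd (codeOption codeNat) (codeProd codeNat (codeOption codeNat)))

def codeData : (ℕ × ℕ) × (ℕ × ℕ) × List (ℕ × Option ℕ × ℕ × Option ℕ) → List Bool :=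
  codeProd (codeProd codeNat codeNat)
    (codeProd (codeProd codeNat codeNat) (codeList codeEdit))

theorem prefixCode_data : PrefixCode codeData :=
  (prefixCode_nat.prod prefixCode_nat).prod ((prefixCode_nat.prod prefixCode_nat).prod
    (prefixCode_nat.prod (prefixCode_nat.option.prod
      (prefixCode_nat.prod prefixCode_nat.option))).list)

theorem length_codeOption_readChar {X : List ℕ} {K : ℕ} (h : ∀ c ∈ X, c ≤ K) (x x' : ℕ) :
    (codeOption codeNat (readChar X x x')).length ≤ 2 * K.size + 2 := by
  unfold readChar
  split_ifs
  · cases hc : X[x]? with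
    | none => simp [codeOption]
    | some c =>
      have := length_codeNat_le (h c (List.mem_of_getElem? hc))
      simp only [codeOption, List.length_cons]
      omega
  · simp [codeOption]

/-- Rows are counted from the start of the window, so positions have `O(log m)` rather than `O(log
n)` bits. The extra `1` pays for the marker bit in the enclosing list. -/
theorem length_codeData_le {P T : List ℕ} {a b K : ℕ} (hP : ∀ c ∈ P, c ≤ K) (hT : ∀ c ∈ T, c ≤ K)
    {A : List (ℕ × ℕ)} (h : Boxed P a (min T.length (a + b)) A) :
    (codeData (data a P T A)).length + 1 ≤
      (cost P T A + 1) * (8 * (P.length + b).size + 4 * K.size + 7) := by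
  obtain ⟨p, q, h1, h2, h3, h4⟩ := h
  have hle := h1.le
  set N := (P.length + b).size with hN
  have hnat : ∀ {n : ℕ}, n ≤ P.length + b → (codeNat n).length ≤ 2 * N + 1 :=
    fun h => length_codeNat_le h
  have hedit : (codeList codeEdit (editList a P T A)).length ≤
      cost P T A * (4 * N + 4 * K.size + 7) + 1 := by
    rw [← length_editList a P T A]
    refine length_codeList_le ?_
    intro e he
    simp only [editList, List.mem_map, List.mem_filter] at he
    obtain ⟨s, ⟨hs, _⟩, rfl⟩ := he
    have hb := h1.bounds hs
    have hst := h1.step_of_mem hs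
    have hs1 : s.1.1 ≤ s.2.1 ∧ s.1.2 ≤ s.2.2 := by
      rcases hst with h | h | h <;> rw [h] <;> simp
    have n1 := hnat (show s.1.1 ≤ P.length + b by omega)
    have n2 := hnat (show s.1.2 - a ≤ P.length + b by omega)
    have n3 := length_codeOption_readChar hP s.1.1 s.2.1
    have n4 := length_codeOption_readChar hT s.1.2 s.2.2
    simp only [codeEdit, codeProd, List.length_append]
    omega
  rw [h1.data_eq]
  simp only [codeData, codeProd, List.length_append]
  have n1 := hnat (show p.1 ≤ P.length + b by omega)
  have n2 := hnat (show p.2 - a ≤ P.length + b by omega)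
  have n3 := hnat (show q.1 ≤ P.length + b by omega)
  have n4 := hnat (show q.2 - a ≤ P.length + b by omega)
  have n5 : cost P T A * (4 * N + 4 * K.size + 7) ≤ cost P T A * (8 * N + 4 * K.size + 7) :=
    Nat.mul_le_mul_left _ (by omega)
  rw [Nat.add_mul, Nat.one_mul]
  omega

open Classical in
/-- Alignments whose edits determine all alignments in a window. -/
noncomputable def certificate (P T : List ℕ) (k a W : ℕ) : List (List (ℕ × ℕ)) :=
  if h : 1 ≤ k ∧ 16 * k ≤ P.length ∧ 4 * W ≤ P.length then
    (exists_certificate P T (a := a) h.1 h.2.1 h.2.2).choose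
  else []

theorem certificate_spec {P T : List ℕ} {k a W : ℕ}
    (h : 1 ≤ k ∧ 16 * k ≤ P.length ∧ 4 * W ≤ P.length) :
    (∀ B ∈ certificate P T k a W, Boxed P a (min T.length (a + 2 * P.length)) B) ∧
      ((certificate P T k a W).map (fun B => cost P T B + 1)).sum ≤
        54 * (Nat.size P.length * k) ∧
      ∀ P' T', (∀ B ∈ certificate P T k a W, Agree P T P' T' B) →
        ∀ X, InWindow P T k a W X → Agree P T P' T' X := by
  unfold certificate
  rw [dif_pos h]
  exact (exists_certificate P T (a := a) h.1 h.2.1 h.2.2).choose_spec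

/-- Alice's message about the windows of the text. -/
noncomputable def windowsMessage (P T : List ℕ) (k : ℕ) : List Bool :=
  codeList (codeList codeData) ((List.range (T.length / (P.length / 4) + 1)).map (fun b =>
    (certificate P T k (b * (P.length / 4)) (P.length / 4)).map
      (data (b * (P.length / 4)) P T)))

/-- Alice's message. -/
noncomputable def messageNat (I : Instance ℕ) : List Bool :=
  codeNat I.pattern.length ++ (codeNat I.text.length ++ (codeNat I.threshold ++
    if 16 * I.threshold ≤ I.pattern.length then
      windowsMessage I.pattern I.text I.threshold
    else codeList codeNat I.pattern ++ codeList codeNat I.text))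

theorem length_windowsMessage_le {P T : List ℕ} {k K : ℕ} (hk : 1 ≤ k) (hkm : 16 * k ≤ P.length)
    (hP : ∀ c ∈ P, c ≤ K) (hT : ∀ c ∈ T, c ≤ K) :
    (windowsMessage P T k).length ≤ (T.length / (P.length / 4) + 1) *
      (54 * (Nat.size P.length * k) * (8 * (3 * P.length).size + 4 * K.size + 7) + 2) + 1 := by
  unfold windowsMessage
  refine (length_codeList_le (K := 54 * (Nat.size P.length * k) *
    (8 * (3 * P.length).size + 4 * K.size + 7) + 1) ?_).trans (by simp)
  intro l hl
  obtain ⟨b, _, rfl⟩ := List.mem_map.1 hl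
  obtain ⟨c1, c2, -⟩ := certificate_spec (P := P) (T := T) (k := k) (a := b * (P.length / 4))
    (W := P.length / 4) ⟨hk, hkm, by omega⟩
  rw [length_codeList, List.map_map, Nat.add_le_add_iff_right]
  generalize certificate P T k (b * (P.length / 4)) (P.length / 4) = L at c1 c2
  refine le_trans ?_ (Nat.mul_le_mul_right _ c2)
  clear c2
  induction L with
  | nil => simp
  | cons B L ih =>
    have h1 := length_codeData_le hP hT (c1 B (by simp))
    have h2 := ih fun B hB => c1 B (by simp [hB])
    simp only [List.map_cons, List.sum_cons, Nat.add_mul, Function.comp] at h1 h2 ⊢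
    rw [show 3 * P.length = P.length + 2 * P.length by omega]
    rw [show 3 * P.length = P.length + 2 * P.length by omega] at h2
    omega

/-- The alignment belongs to the window numbered `i / (m / 4)`; equal data there transfers the
certificate, and the certificate forces agreement. -/
theorem agree_of_windowsMessage_eq {P T P' T' : List ℕ} {k : ℕ} (hk : 1 ≤ k)
    (hkm : 16 * k ≤ P.length) (hP : P.length = P'.length) (hT : T.length = T'.length)
    (h : windowsMessage P T k = windowsMessage P' T' k) {X : List (ℕ × ℕ)} {i j : ℕ}
    (hij : i ≤ j) (hj : j ≤ T.length) (hX : IsOptimalAlignment P T i j X)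
    (hc : cost P T X ≤ k) : Agree P T P' T' X := by
  unfold windowsMessage at h
  have h1 := (prefixCode_data.list.list _ _ [] [] (congrArg (· ++ []) h)).1
  rw [← hP, ← hT, List.map_inj_left] at h1
  have hW : 0 < P.length / 4 := by omega
  have h2 := h1 (i / (P.length / 4)) (by
    rw [List.mem_range, Nat.lt_succ_iff]
    exact Nat.div_le_div_right (by omega))
  have hr := Route.isAlignment_iff.1 hX.1
  obtain ⟨hs1, hs2⟩ := hr.start_finish
  simp only at hs1 hs2
  obtain ⟨c1, -, c3⟩ := certificate_spec (P := P) (T := T) (k := k)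
    (a := i / (P.length / 4) * (P.length / 4)) (W := P.length / 4) ⟨hk, hkm, by omega⟩
  obtain ⟨d1, -, -⟩ := certificate_spec (P := P') (T := T') (k := k)
    (a := i / (P.length / 4) * (P.length / 4)) (W := P.length / 4) ⟨hk, by omega, by omega⟩
  rw [← hP] at d1
  refine c3 P' T' (agree_of_map_data_eq hP hT c1 d1 h2) X ?_
  have h3 := Nat.div_add_mod' i (P.length / 4)
  have h4 := Nat.mod_lt i hW
  refine ⟨by rw [hs1, hs2]; exact hr, by omega, by omega, by omega, by rw [hs1, hs2]; exact hX, hc⟩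

end Message

/-! ### Mutual agreement determines the output. -/

section Transfer

variable {α : Type u}

theorem Agree.refl (P T : List α) (A : List (ℕ × ℕ)) : Agree P T P T A :=
  fun _ _ => ⟨Iff.rfl, fun _ => ⟨fun _ => rfl, fun _ => rfl⟩⟩

theorem Agree.cost_eq {P T P' T' : List α} {A : List (ℕ × ℕ)} (h : Agree P T P' T' A) :
    cost P T A = cost P' T' A := by
  classical
  unfold cost
  refine List.countP_congr fun s hs => ?_
  simpa using (h s hs).1

theorem exists_isOptimalAlignment (P T : List α) {i j : ℕ} (hij : i ≤ j) (hj : j ≤ T.length) :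
    ∃ A, IsOptimalAlignment P T i j A := by
  have h := edits_editDist P (fragment T i j)
  conv at h => arg 2; rw [← fragment_full P]
  obtain ⟨A, h1, h2⟩ := h.exists_route (Nat.zero_le _) hij le_rfl hj
  exact ⟨A, Route.isAlignment_iff.2 h1, le_antisymm h2 (h1.editDist_le hj)⟩

/-- Agreement on all cheap optimal alignments. -/
def CheapAgree (I I' : Instance α) : Prop :=
  ∀ X i j, i ≤ j → j ≤ I.text.length → IsOptimalAlignment I.pattern I.text i j X →
    cost I.pattern I.text X ≤ I.threshold →
    Agree I.pattern I.text I'.pattern I'.text X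

variable {I I' : Instance α} (hP : I.pattern.length = I'.pattern.length)
  (hT : I.text.length = I'.text.length) (hk : I.threshold = I'.threshold)
  (h : CheapAgree I I') (h' : CheapAgree I' I)

include hP hT h in
theorem CheapAgree.editDist_le {i j : ℕ} (hij : i ≤ j) (hj : j ≤ I.text.length)
    (hle : editDist I.pattern (fragment I.text i j) ≤ I.threshold) :
    editDist I'.pattern (fragment I'.text i j) ≤ editDist I.pattern (fragment I.text i j) := by
  obtain ⟨X, hX⟩ := exists_isOptimalAlignment I.pattern I.text hij hj
  rw [← hX.2] at hle ⊢
  rw [(h X i j hij hj hX hle).cost_eq]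
  have hr := Route.isAlignment_iff.1 hX.1
  rw [hP] at hr
  exact hr.editDist_le (by omega)

include hP hT hk h h' in
-- Costs transfer in both directions, so the distances of the fragment agree in both inputs; an
-- alignment that keeps its cost then stays optimal.
theorem CheapAgree.mem_optimalAlignments {a : (ℕ × ℕ) × List (ℕ × ℕ)}
    (ha : a ∈ I.optimalAlignments) : a ∈ I'.optimalAlignments := by
  obtain ⟨⟨h1, h2, h3⟩, h4, h5⟩ := ha
  have h6 := h.editDist_le hP hT h1 h2 h3
  have h7 := h'.editDist_le hP.symm hT.symm h1 (by omega) (by omega)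
  refine ⟨⟨h1, by omega, by omega⟩, by rw [← hP]; exact h4, ?_⟩
  rw [← (h a.2 a.1.1 a.1.2 h1 h2 ⟨h4, h5⟩ (by omega)).cost_eq]
  omega

include hP hT hk h h' in
theorem CheapAgree.optimalAlignments_eq : I.optimalAlignments = I'.optimalAlignments :=
  Set.Subset.antisymm (fun _ ha => h.mem_optimalAlignments hP hT hk h' ha)
    (fun _ ha => h'.mem_optimalAlignments hP.symm hT.symm hk.symm h ha)

theorem readChar_ne_of_agree {P T P' T' : List α} {A : List (ℕ × ℕ)} {p q : ℕ × ℕ}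
    (hA : Route p q A) (h : Agree P T P' T' A)
    {s : (ℕ × ℕ) × (ℕ × ℕ)} (hs : s ∈ steps A)
    (hne : readChar P s.1.1 s.2.1 ≠ readChar T s.1.2 s.2.2) :
    readChar P s.1.1 s.2.1 = readChar P' s.1.1 s.2.1 ∧
      readChar T s.1.2 s.2.2 = readChar T' s.1.2 s.2.2 := by
  rcases isEdit_or_eq (X := P) (Y := T) (hA.step_of_mem hs) with he | ⟨_, h1, h2⟩
  · obtain ⟨h1, h2⟩ := (h s hs).2 he
    unfold readChar
    constructor
    · split_ifs with h3
      · exact (h1 h3).symm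
      · rfl
    · split_ifs with h3
      · exact (h2 h3).symm
      · rfl
  · exact absurd (by simp [readChar, h1, h2]) hne

theorem Agree.editInfo_subset {P T P' T' : List α} {A : List (ℕ × ℕ)} {p q : ℕ × ℕ}
    (hA : Route p q A) (h : Agree P T P' T' A) : editInfo P T A ⊆ editInfo P' T' A := by
  rintro e ⟨s, hs, hne, rfl⟩
  obtain ⟨h1, h2⟩ := readChar_ne_of_agree hA h hs hne
  exact ⟨s, hs, by rwa [← h1, ← h2], by rw [h1, h2]⟩

include hP hT hk h h' in
theorem CheapAgree.editInfo_eq {a : (ℕ × ℕ) × List (ℕ × ℕ)} (ha : a ∈ I.optimalAlignments) :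
    editInfo I.pattern I.text a.2 = editInfo I'.pattern I'.text a.2 := by
  have key : ∀ {I I' : Instance α}, CheapAgree I I' → a ∈ I.optimalAlignments →
      editInfo I.pattern I.text a.2 ⊆ editInfo I'.pattern I'.text a.2 := by
    rintro I I' h ⟨⟨h1, h2, h3⟩, h4⟩
    exact (h a.2 a.1.1 a.1.2 h1 h2 h4 (by rw [h4.2]; exact h3)).editInfo_subset
      (Route.isAlignment_iff.1 h4.1)
  exact (key h ha).antisymm (key h' (h.mem_optimalAlignments hP hT hk h' ha))

end Transfer

theorem eq_of_messageNat_eq {I I' : Instance ℕ} (hk : 1 ≤ I.threshold)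
    (h : messageNat I = messageNat I') : I.pattern.length = I'.pattern.length ∧
      I.text.length = I'.text.length ∧ I.threshold = I'.threshold ∧
      CheapAgree I I' ∧ CheapAgree I' I := by
  obtain ⟨h1, h⟩ := prefixCode_nat _ _ _ _ h
  obtain ⟨h2, h⟩ := prefixCode_nat _ _ _ _ h
  obtain ⟨h3, h⟩ := prefixCode_nat _ _ _ _ h
  refine ⟨h1, h2, h3, ?_⟩
  rw [← h1, ← h3] at h
  split_ifs at h with hc
  · refine ⟨fun X i j hij hj hX hcost => ?_, fun X i j hij hj hX hcost => ?_⟩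
    · exact agree_of_windowsMessage_eq hk hc h1 h2 h hij hj hX hcost
    · rw [← h3] at hcost
      exact agree_of_windowsMessage_eq hk (by omega) h1.symm h2.symm h.symm hij hj hX hcost
  · obtain ⟨e1, e2⟩ := prefixCode_nat.list _ _ _ _ h
    obtain ⟨e2, -⟩ := prefixCode_nat.list _ _ [] [] (by simpa using e2)
    refine ⟨fun X _ _ _ _ _ _ => ?_, fun X _ _ _ _ _ _ => ?_⟩
    · rw [e1, e2]
      exact .refl _ _ _
    · rw [e1, e2]
      exact .refl _ _ _

/-! ### Estimates of the message length. -/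

section Length

/-- The header contains `n`, so `log n` must be absorbed into a bound of order `n / m` times powers
of `log m`. -/
theorem size_le_add_div {m : ℕ} (hm : 0 < m) (n : ℕ) : n.size ≤ m.size + n / m := by
  rw [Nat.size_le, pow_add]
  calc n < m * (n / m + 1) := Nat.lt_mul_div_succ n hm
    _ ≤ 2 ^ m.size * 2 ^ (n / m) :=
      Nat.mul_le_mul (Nat.lt_size_self m).le Nat.lt_two_pow_self

theorem size_three_mul_le (m : ℕ) : (3 * m).size ≤ m.size + 2 := by
  rw [Nat.size_le, pow_add]
  have := Nat.lt_size_self m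
  omega

theorem two_le_size {m : ℕ} (hm : 2 ≤ m) : 2 ≤ m.size :=
  Nat.lt_size.2 (by simpa using hm)

theorem mul_length_messageNat_le {I : Instance ℕ} {m n k K : ℕ} (hPm : I.pattern.length = m)
    (hTn : I.text.length = n) (hIk : I.threshold = k) (hm : 2 ≤ m) (hmn : m ≤ n) (hk : 1 ≤ k)
    (hP : ∀ c ∈ I.pattern, c ≤ K) (hT : ∀ c ∈ I.text, c ≤ K) :
    m * (messageNat I).length ≤ 7000 * (n * (m.size * k * (m.size + K.size))) := by
  have hs := two_le_size hm
  have hX1 : m.size * 1 * 1 ≤ m.size * k * (m.size + K.size) := by gcongr; omega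
  have hX2 : 2 * k * (2 + K.size) ≤ m.size * k * (m.size + K.size) := by gcongr
  have hX3 : k ≤ k * (2 + K.size) := Nat.le_mul_of_pos_right _ (by omega)
  rw [Nat.mul_assoc] at hX2
  generalize hX : m.size * k * (m.size + K.size) = X at *
  have hn : m * n.size ≤ n * (X + 1) := by
    calc m * n.size ≤ m * (m.size + n / m) := Nat.mul_le_mul_left _ (size_le_add_div (by omega) n)
      _ = m * m.size + m * (n / m) := Nat.mul_add _ _ _
      _ ≤ n * X + n := Nat.add_le_add (Nat.mul_le_mul hmn (by omega)) (Nat.mul_div_le n m)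
      _ = n * (X + 1) := by ring
  have hms : m * m.size ≤ n * X := Nat.mul_le_mul hmn (by omega)
  have hks : m * k.size ≤ n * X :=
    Nat.mul_le_mul hmn ((Nat.size_le.2 Nat.lt_two_pow_self).trans (by omega))
  have hnX : n * 1 ≤ n * X := Nat.mul_le_mul_left _ (by omega)
  have hbody : m * (if 16 * k ≤ m then windowsMessage I.pattern I.text k
      else codeList codeNat I.pattern ++ codeList codeNat I.text).length ≤ 6500 * (n * X) := by
    split_ifs with hc
    · have h1 := length_windowsMessage_le (K := K) hk (by rwa [hPm]) hP hT
      rw [hPm, hTn] at h1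
      have h2 : 54 * (m.size * k) * (8 * (3 * m).size + 4 * K.size + 7) + 2 ≤ 1081 * X := by
        have h3 := size_three_mul_le m
        have h4 : 54 * (m.size * k) * (8 * (3 * m).size + 4 * K.size + 7) ≤
            54 * (m.size * k) * (20 * (m.size + K.size)) := by
          gcongr
          omega
        have h5 : 54 * (m.size * k) * (20 * (m.size + K.size)) = 1080 * X := by
          rw [← hX]
          ring
        omega
      -- From `k ≥ 1` and `16 * k ≤ m` follows `m ≥ 16`, hence `m ≤ 5 * (m / 4)` despite the
      -- rounding.
      have h3 : m * (n / (m / 4) + 1) ≤ 6 * n := by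
        have h4 : m * (n / (m / 4)) ≤ (5 * (m / 4)) * (n / (m / 4)) :=
          Nat.mul_le_mul_right _ (by omega)
        have h5 := Nat.mul_div_le n (m / 4)
        rw [Nat.mul_assoc] at h4
        rw [Nat.mul_add]
        omega
      calc _ ≤ m * ((n / (m / 4) + 1) * (1081 * X) + 1) :=
            Nat.mul_le_mul_left _ (h1.trans (by gcongr))
        _ = m * (n / (m / 4) + 1) * (1081 * X) + m := by ring
        _ ≤ 6 * n * (1081 * X) + n * X := by gcongr; omega
        _ ≤ 6500 * (n * X) := by
          rw [show 6 * n * (1081 * X) = 6486 * (n * X) by ring]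
          omega
    -- Now `m < 16 * k`, so `n` is at most `16 * k * n / m` and verbatim transmission fits the
    -- bound.
    · have h1 := length_codeList_le (e := codeNat) fun c hc => length_codeNat_le (hP c hc)
      have h2 := length_codeList_le (e := codeNat) fun c hc => length_codeNat_le (hT c hc)
      rw [hPm] at h1
      rw [hTn] at h2
      rw [List.length_append]
      have h3 : m * (2 * K.size + 1 + 1) ≤ n * (2 * K.size + 1 + 1) :=
        Nat.mul_le_mul_right _ hmn
      calc _ ≤ m * (2 * (n * (2 * K.size + 1 + 1)) + 2) := Nat.mul_le_mul_left _ (by omega)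
        _ = 2 * n * (m * (2 * K.size + 2)) + 2 * m := by ring
        _ ≤ 2 * n * ((16 * k) * (2 * (2 + K.size))) + 2 * n := by gcongr <;> omega
        _ = 32 * (n * (2 * (k * (2 + K.size)))) + 2 * n := by ring
        _ ≤ 32 * (n * X) + 2 * n := by gcongr
        _ ≤ _ := by omega
  subst hPm hTn hIk
  simp only [messageNat, List.length_append, length_codeNat] at hbody ⊢
  simp only [Nat.mul_add] at hn ⊢
  rw [← Nat.mul_assoc _ 2, ← Nat.mul_assoc _ 2, ← Nat.mul_assoc _ 2, Nat.mul_comm _ 2,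
    Nat.mul_assoc, Nat.mul_assoc, Nat.mul_assoc]
  omega

theorem size_le_logb {m : ℕ} (hm : 1 ≤ m) : (m.size : ℝ) ≤ Real.logb 2 m + 1 := by
  have h : m.size - 1 < m.size := Nat.sub_lt (Nat.size_pos.2 hm) one_pos
  have h1 := Nat.lt_size.1 h
  have h2 : ((m.size - 1 : ℕ) : ℝ) ≤ Real.logb 2 m := by
    rw [Real.le_logb_iff_rpow_le (by norm_num) (by exact_mod_cast hm), Real.rpow_natCast]
    exact_mod_cast h1
  rw [Nat.cast_sub (by omega)] at h2
  push_cast at h2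
  linarith

theorem one_le_logb {m : ℕ} (hm : 2 ≤ m) : 1 ≤ Real.logb 2 m := by
  rw [Real.le_logb_iff_rpow_le (by norm_num) (by exact_mod_cast (by omega : 0 < m)),
    Real.rpow_one]
  exact_mod_cast hm

theorem length_messageNat_le {I : Instance ℕ} {m n k K : ℕ} (hPm : I.pattern.length = m)
    (hTn : I.text.length = n) (hIk : I.threshold = k) (hm : 2 ≤ m) (hmn : m ≤ n) (hk : 1 ≤ k)
    (hP : ∀ c ∈ I.pattern, c ≤ K) (hT : ∀ c ∈ I.text, c ≤ K) (hK : 1 ≤ K) :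
    ((messageNat I).length : ℝ) ≤
      42000 * ((n : ℝ) / m * k * Real.logb 2 m * Real.logb 2 ((m : ℝ) * K)) := by
  have h := mul_length_messageNat_le hPm hTn hIk hm hmn hk hP hT
  have hm0 : (0 : ℝ) < m := by exact_mod_cast (by omega : 0 < m)
  have hK0 : (0 : ℝ) < K := by exact_mod_cast hK
  have h1 := one_le_logb hm
  have h2 := size_le_logb (m := m) (by omega)
  have h3 := size_le_logb hK
  have h4 : 0 ≤ Real.logb 2 K := Real.logb_nonneg (by norm_num) (by exact_mod_cast hK)
  rw [Real.logb_mul hm0.ne' hK0.ne']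
  generalize Real.logb 2 m = x at *
  generalize Real.logb 2 K = y at *
  have h5 : (m : ℝ) * (messageNat I).length ≤ 7000 * (n * (m.size * k * (m.size + K.size))) := by
    exact_mod_cast h
  -- Since `log m ≥ 1`, rounding up costs a factor `2` in `m.size` and `3` in `m.size + K.size`,
  -- whence `42000`.
  have h6 : (7000 : ℝ) * (n * (m.size * k * (m.size + K.size))) ≤
      7000 * (n * ((2 * x) * k * (3 * (x + y)))) := by
    gcongr <;> linarith
  rw [show (42000 : ℝ) * (n / m * k * x * (x + y)) =
    (7000 * (n * ((2 * x) * k * (3 * (x + y))))) / m by ring, le_div_iff₀ hm0]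
  linarith

end Length

/-! ### Renaming characters to numbers. -/

section Rename

variable {α : Type u} {ρ : α → ℕ} {P T : List α}

/-- `ρ` does not identify a character of `P` with a different character of `T`. -/
def Separates (ρ : α → ℕ) (P T : List α) : Prop :=
  ∀ c ∈ P, ∀ d ∈ T, ρ c = ρ d → c = d

theorem Separates.getElem?_eq_iff (h : Separates ρ P T) (x y : ℕ) :
    (P.map ρ)[x]? = (T.map ρ)[y]? ↔ P[x]? = T[y]? := by
  rw [List.getElem?_map, List.getElem?_map]
  cases hx : P[x]? with
  | none => cases T[y]? <;> simp
  | some c =>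
    cases hy : T[y]? with
    | none => simp
    | some d =>
      simp only [Option.map_some, Option.some.injEq]
      exact ⟨h c (List.mem_of_getElem? hx) d (List.mem_of_getElem? hy), congrArg ρ⟩

theorem Separates.cost_map (h : Separates ρ P T) (A : List (ℕ × ℕ)) :
    cost (P.map ρ) (T.map ρ) A = cost P T A := by
  classical
  unfold cost
  refine List.countP_congr fun s _ => ?_
  have hs : IsEdit (P.map ρ) (T.map ρ) s ↔ IsEdit P T s := by
    simp only [IsEdit, ne_eq, h.getElem?_eq_iff]
  simpa using hs

theorem Separates.editDist_map (h : Separates ρ P T) :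
    editDist (P.map ρ) (T.map ρ) = editDist P T := by
  simp only [editDist, List.length_map, h.cost_map]

theorem fragment_map (ρ : α → ℕ) (T : List α) (i j : ℕ) :
    fragment (T.map ρ) i j = (fragment T i j).map ρ := by
  simp [fragment]

theorem Separates.fragment (h : Separates ρ P T) (i j : ℕ) :
    Separates ρ P (fragment T i j) :=
  fun c hc d hd => h c hc d (List.mem_of_mem_take (List.mem_of_mem_drop hd))

/-- The input with renamed characters. -/
def Instance.rename (ρ : α → ℕ) (I : Instance α) : Instance ℕ :=
  ⟨I.pattern.map ρ, I.text.map ρ, I.threshold⟩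

theorem Instance.optimalAlignments_rename {I : Instance α}
    (h : Separates ρ I.pattern I.text) :
    (I.rename ρ).optimalAlignments = I.optimalAlignments := by
  simp only [Instance.optimalAlignments, Instance.fragments, Instance.rename, IsOptimalAlignment,
    List.length_map, h.cost_map, fragment_map, (h.fragment _ _).editDist_map]

theorem readChar_map (ρ : α → ℕ) (X : List α) (a b : ℕ) :
    readChar (X.map ρ) a b = (readChar X a b).map ρ := by
  unfold readChar
  split_ifs <;> simp

theorem editInfo_map (hρ : Function.Injective ρ) (P T : List α) (A : List (ℕ × ℕ)) :
    editInfo (P.map ρ) (T.map ρ) A =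
      (Prod.map id (Prod.map (Option.map ρ) (Prod.map id (Option.map ρ)))) '' editInfo P T A := by
  ext e
  simp only [editInfo, readChar_map, ne_eq, (Option.map_injective hρ).eq_iff, Set.mem_ofPred_eq,
    Set.mem_image]
  constructor
  · rintro ⟨s, hs, hne, rfl⟩
    exact ⟨_, ⟨s, hs, hne, rfl⟩, rfl⟩
  · rintro ⟨_, ⟨s, hs, hne, rfl⟩, rfl⟩
    exact ⟨s, hs, hne, rfl⟩

theorem editInfo_map_injective (hρ : Function.Injective ρ) {P' T' : List α} {A : List (ℕ × ℕ)}
    (h : editInfo (P.map ρ) (T.map ρ) A = editInfo (P'.map ρ) (T'.map ρ) A) :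
    editInfo P T A = editInfo P' T' A := by
  rw [editInfo_map hρ, editInfo_map hρ] at h
  refine Set.image_injective.2 ?_ h
  exact Function.injective_id.prodMap ((Option.map_injective hρ).prodMap
    (Function.injective_id.prodMap (Option.map_injective hρ)))

end Rename

/-! ### From messages to protocols. -/

section Protocol

variable {α : Type u}

theorem Instance.mem_fragments_iff {I : Instance α} {f : ℕ × ℕ} :
    f ∈ I.fragments ↔ ∃ A, (f, A) ∈ I.optimalAlignments := by
  refine ⟨fun h => ?_, fun ⟨A, h⟩ => h.1⟩
  obtain ⟨A, hA⟩ := exists_isOptimalAlignment I.pattern I.text h.1 h.2.1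
  exact ⟨A, h, hA⟩

theorem Instance.mem_occ_iff {I : Instance α} {i : ℕ} :
    i ∈ I.occ ↔ ∃ j, (i, j) ∈ I.fragments :=
  ⟨fun ⟨_, j, h⟩ => ⟨j, h⟩, fun ⟨j, h1, h2, h3⟩ => ⟨le_trans h1 h2, j, h1, h2, h3⟩⟩

theorem Instance.fragments_eq {I I' : Instance α}
    (h : I.optimalAlignments = I'.optimalAlignments) : I.fragments = I'.fragments := by
  ext f
  rw [mem_fragments_iff, mem_fragments_iff, h]

theorem Instance.occ_eq {I I' : Instance α} (h : I.fragments = I'.fragments) :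
    I.occ = I'.occ := by
  ext i
  rw [mem_occ_iff, mem_occ_iff, h]

/-- A message from which the output is determined gives a protocol. -/
theorem exists_protocol {Input Output : Type*} [Inhabited Output] (valid : Input → Prop)
    (msg : Input → List Bool) (out : Input → Output)
    (h : ∀ I I', valid I → valid I' → msg I = msg I' → out I = out I') :
    ∃ π : OneWayProtocol Input Output, π.message = msg ∧
      ∀ I, valid I → π.output (msg I) = out I := by
  classical
  refine ⟨⟨msg, fun b => if hb : ∃ I, valid I ∧ msg I = b then out hb.choose else default⟩,
    rfl, fun I hI => ?_⟩
  have hb : ∃ I', valid I' ∧ msg I' = msg I := ⟨I, hI, rfl⟩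
  simp only [dif_pos hb]
  exact h _ _ hb.choose_spec.1 hI hb.choose_spec.2

/-- The renamings may depend on the inputs, because alignments contain no characters. -/
theorem optimalAlignments_eq_of_messageNat_eq {I I' : Instance α} {ρ ρ' : α → ℕ}
    (h : Separates ρ I.pattern I.text) (h' : Separates ρ' I'.pattern I'.text)
    (hk : 1 ≤ I.threshold) (heq : messageNat (I.rename ρ) = messageNat (I'.rename ρ')) :
    I.optimalAlignments = I'.optimalAlignments := by
  obtain ⟨h1, h2, h3, h4, h5⟩ := eq_of_messageNat_eq hk heq
  rw [← Instance.optimalAlignments_rename h, ← Instance.optimalAlignments_rename h']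
  exact h4.optimalAlignments_eq h1 h2 h3 h5

/-- Edit information contains characters, so here both inputs share one injective renaming that Bob
can invert. -/
theorem alignmentsWithInfo_eq_of_messageNat_eq {I I' : Instance α} {ρ : α → ℕ}
    (hρ : Function.Injective ρ) (hk : 1 ≤ I.threshold)
    (heq : messageNat (I.rename ρ) = messageNat (I'.rename ρ)) :
    I.alignmentsWithInfo = I'.alignmentsWithInfo := by
  have hsep : ∀ P T : List α, Separates ρ P T := fun _ _ _ _ _ _ h => hρ h
  have hopt := optimalAlignments_eq_of_messageNat_eq (hsep _ _) (hsep _ _) hk heq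
  obtain ⟨h1, h2, h3, h4, h5⟩ := eq_of_messageNat_eq hk heq
  have hinfo : ∀ a ∈ I.optimalAlignments,
      editInfo I.pattern I.text a.2 = editInfo I'.pattern I'.text a.2 := by
    intro a ha
    rw [← Instance.optimalAlignments_rename (hsep _ _)] at ha
    exact editInfo_map_injective hρ (h4.editInfo_eq h1 h2 h3 h5 ha)
  ext e
  simp only [Instance.alignmentsWithInfo, Set.mem_ofPred_eq, ← hopt]
  exact and_congr_right fun he => by rw [hinfo _ he]

end Protocol

end EditMatching

open EditMatching in
/-- Here `m = |P| ≥ 2`, `n = |T| ≥ m` and `k ≥ 1`. A single message of `O(n/m · k log² m)` bits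
determines the set of `k`-error occurrences, the family of all fragments within distance `k`, and
all their optimal alignments; with `O(n/m · k log m log (m|α|))` bits over a finite alphabet `α`
it also determines the edit information of each of these alignments. The constants are absolute. -/
theorem mainTheorem1 :
    (∃ C : ℝ, ∀ α : Type u,
      ∃ π : OneWayProtocol (Instance α) (Set ℕ × Set (ℕ × ℕ) × Set ((ℕ × ℕ) × List (ℕ × ℕ))),
        ∀ I : Instance α, ∀ m n k : ℕ,
          I.pattern.length = m → I.text.length = n → I.threshold = k →
          2 ≤ m → m ≤ n → 1 ≤ k →
            π.output (π.message I) = (I.occ, I.fragments, I.optimalAlignments) ∧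
            ((π.message I).length : ℝ) ≤
              C * ((n : ℝ) / (m : ℝ) * (k : ℝ) * Real.logb 2 (m : ℝ) ^ 2)) ∧
    (∃ C : ℝ, ∀ (α : Type u) [Fintype α],
      ∃ π : OneWayProtocol (Instance α)
          (Set ℕ × Set (ℕ × ℕ) × Set ((ℕ × ℕ) × List (ℕ × ℕ)) ×
            Set (((ℕ × ℕ) × List (ℕ × ℕ)) × Set (ℕ × Option α × ℕ × Option α))),
        ∀ I : Instance α, ∀ m n k : ℕ,
          I.pattern.length = m → I.text.length = n → I.threshold = k →
          2 ≤ m → m ≤ n → 1 ≤ k →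
            π.output (π.message I) =
              (I.occ, I.fragments, I.optimalAlignments, I.alignmentsWithInfo) ∧
            ((π.message I).length : ℝ) ≤
              C * ((n : ℝ) / (m : ℝ) * (k : ℝ) * Real.logb 2 (m : ℝ) *
                Real.logb 2 ((m : ℝ) * (Fintype.card α : ℝ)))) := by
  classical
  constructor
  · refine ⟨42000 * 2, fun α => ?_⟩
    -- Characters absent from `P` are all sent to `|P|`. This may identify characters of `T` with
    -- each other, but never with a character of `P`.
    have hsep : ∀ I : Instance α, Separates (fun c => I.pattern.idxOf c) I.pattern I.text :=
      fun I c hc d _ h => (List.idxOf_inj hc).1 h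
    obtain ⟨π, hπ, hout⟩ := exists_protocol
      (fun I : Instance α => 1 ≤ I.threshold)
      (fun I => messageNat (I.rename fun c => I.pattern.idxOf c))
      (fun I => (I.occ, I.fragments, I.optimalAlignments)) (fun I I' hk _ h => by
        have h1 := optimalAlignments_eq_of_messageNat_eq (hsep I) (hsep I') hk h
        have h2 := Instance.fragments_eq h1
        rw [h1, h2, Instance.occ_eq h2])
    refine ⟨π, fun I m n k hm hn hk h2m hmn h1k => ?_⟩
    rw [hπ]
    refine ⟨hout I (by omega), ?_⟩
    have hle : ∀ X : List α, ∀ c ∈ X.map (fun c => I.pattern.idxOf c), c ≤ m := by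
      intro X c hc
      obtain ⟨d, _, rfl⟩ := List.mem_map.1 hc
      exact hm ▸ List.idxOf_le_length
    have h := length_messageNat_le (I := I.rename fun c => I.pattern.idxOf c) (K := m)
      (by simpa [Instance.rename] using hm) (by simpa [Instance.rename] using hn) hk h2m hmn h1k
      (hle _) (hle _) (by omega)
    have hm0 : (m : ℝ) ≠ 0 := by exact_mod_cast (by omega : m ≠ 0)
    rw [Real.logb_mul hm0 hm0] at h
    refine h.trans (le_of_eq ?_)
    ring
  · refine ⟨42000, fun α _ => ?_⟩
    let ρ : α → ℕ := fun c => Fintype.equivFin α c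
    have hρ : Function.Injective ρ := Fin.val_injective.comp (Fintype.equivFin α).injective
    obtain ⟨π, hπ, hout⟩ := exists_protocol
      (fun I : Instance α => 1 ≤ I.threshold) (fun I => messageNat (I.rename ρ))
      (fun I => (I.occ, I.fragments, I.optimalAlignments, I.alignmentsWithInfo))
      (fun I I' hk _ h => by
        have h1 := optimalAlignments_eq_of_messageNat_eq (fun _ _ _ _ h => hρ h)
          (fun _ _ _ _ h => hρ h) hk h
        have h2 := Instance.fragments_eq h1
        rw [h1, h2, Instance.occ_eq h2, alignmentsWithInfo_eq_of_messageNat_eq hρ hk h])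
    refine ⟨π, fun I m n k hm hn hk h2m hmn h1k => ?_⟩
    rw [hπ]
    refine ⟨hout I (by omega), ?_⟩
    have hle : ∀ X : List α, ∀ c ∈ X.map ρ, c ≤ Fintype.card α := by
      intro X c hc
      obtain ⟨d, _, rfl⟩ := List.mem_map.1 hc
      exact (Fintype.equivFin α d).isLt.le
    have hcard : 1 ≤ Fintype.card α :=
      Fintype.card_pos_iff.2 ⟨I.pattern[0]'(by omega)⟩
    exact length_messageNat_le (I := I.rename ρ)
      (by simpa [Instance.rename] using hm) (by simpa [Instance.rename] using hn) hk h2m hmn h1k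
      (hle _) (hle _) hcard
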